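/- Let $\mathbf{k}$ be a field. For $n,m\ge 0$ let ${}_nB^c_m$ be the set of isotopy classes of crossingless diagrams in a strip with $n$ endpoints on the left and $m$ endpoints on the right boundary line, made of through arcs (without critical points with respect to the projection to the $x$-axis) and left and right returns (arcs joining two points of the same boundary line, with exactly one critical point). Let $A^c$ be the non-unital $\mathbf{k}$-algebra with basis $\bigsqcup_{n,m}{}_nB^c_m$; the product of $x\in{}_nB^c_m$ and $y\in{}_lB^c_s$ is the horizontal concatenation $xy$ if $m=l$ and every component of the concatenation has at most one critical point, and is $0$ otherwise. Let $1_n$ be the idempotent made of $n$ through arcs. Modules are left modules $V$ with $V=\bigoplus_n 1_nV$. Put $P_n=A^c1_n$, and let the standard module $M_n$ be the quotient of $P_n$ by the submodule spanned by the diagrams with $n$ right endpoints and at least one right return. Let $\widetilde Y_{m,n}\subset{}_mB^c_n$ be the set of diagrams without left returns and with no two nested right returns. Let $K_0(A^c)$ be the split Grothendieck group of finitely generated projective $A^c$-modules, and let $\otimes$ be the tensor product of modules induced by vertical stacking of diagrams, so that $P_a\otimes P_b\cong P_{a+b}$. **Theorem (Categorification of the Chebyshev polynomials of the second kind).** 1.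 The tensor product of finitely generated projective modules is finitely generated projective, and there is an isomorphism $K_0(A^c)\cong\mathbb{Z}[x]$ with $[P_n]\mapsto x^n$, under which $[V\otimes W]$ corresponds to the product of the polynomials of $[V]$ and $[W]$. The inclusion of finitely generated projective modules, placed in degree $0$, into the homotopy category $\mathcal{C}$ of bounded complexes of such modules induces an isomorphism of $K_0(A^c)$ with the Grothendieck group $K_0(\mathcal{C})$ of the triangulated category $\mathcal{C}$. 2. For every $n\ge 0$ the standard module $M_n$ has the finite projective resolution $$0\to\cdots\to P_{n-2k}^{\widetilde Y_{n-2k,n}}\xrightarrow{d_k}P_{n-2(k-1)}^{\widetilde Y_{n-2(k-1),n}}\to\cdots\xrightarrow{d_1}P_n\to M_n\to 0 ,$$ where $0\le k\le\lfloor n/2\rfloor$ and $|\widetilde Y_{n-2k,n}|=\binom{n-k}{k}$. The component of $d_k$ from the copy of $P_{n-2k}$ with index $\alpha$ to the copy of $P_{n-2(k-1)}$ with index $\beta$ is $a\mapsto(-1)^{j-1}ab$ if $\alpha=b\beta$ for a (necessarily unique) diagram $b$ with no left return and exactly one right return, where this return becomes the $j$-th right return of $\alpha$ from the top; the component is $0$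 if there is no such $b$. The resolution is an object of $\mathcal{C}$ quasi-isomorphic to $M_n$. 3. The class $[M_n]\in K_0(\mathcal{C})\cong K_0(A^c)\cong\mathbb{Z}[x]$ of any finite resolution of $M_n$ by finitely generated projectives (any object $C$ of $\mathcal{C}$ with a quasi-isomorphism $C\to M_n$) is $$[M_n]=\sum_{k=0}^{\lfloor n/2\rfloor}(-1)^k\binom{n-k}{k}[P_{n-2k}]=\sum_{k=0}^{\lfloor n/2\rfloor}(-1)^k\binom{n-k}{k}x^{n-2k}=\mathcal{U}_n(x),$$ where $\mathcal{U}_n(x)=U_n(x/2)$ is the rescaled Chebyshev polynomial of the second kind: $\mathcal{U}_0=1$, $\mathcal{U}_1=x$, $\mathcal{U}_{n+1}=x\,\mathcal{U}_n-\mathcal{U}_{n-1}$. -/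

import Mathlib

open Polynomial CategoryTheory
open scoped TensorProduct

universe u

noncomputable section

namespace ChebyshevDiagrams

/-! ## Crossingless matching diagrams -/

/-- A crossingless diagram in the strip `0 ≤ x ≤ 1` with `n` endpoints on the left line and `m`
endpoints on the right line, both numbered from top to bottom.  Up to isotopy (through arcs have no
critical point, returns have exactly one) a diagram is the same as the pairing `partner` of its
endpoints.  Two through arcs cross iff they reverse the order of their endpoints (`through_mono`);
a return crosses another arc iff exactly one endpoint of that arc lies strictly between the two
endpoints of the return (`left_planar`, `right_planar`). -/
@[ext]
structure Diagram (n m : ℕ) where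
  partner : Fin n ⊕ Fin m → Fin n ⊕ Fin m
  invol : ∀ a, partner (partner a) = a
  ne_self : ∀ a, partner a ≠ a
  through_mono : ∀ i i' j j', partner (Sum.inl i) = Sum.inr j → partner (Sum.inl i') = Sum.inr j' →
    i < i' → j < j'
  left_planar : ∀ i i' a, partner (Sum.inl i) = Sum.inl i' → i < a → a < i' →
    ∃ a', partner (Sum.inl a) = Sum.inl a' ∧ i < a' ∧ a' < i'
  right_planar : ∀ j j' b, partner (Sum.inr j) = Sum.inr j' → j < b → b < j' →
    ∃ b', partner (Sum.inr b) = Sum.inr b' ∧ j < b' ∧ b' < j'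

instance (n m : ℕ) : Finite (Diagram n m) :=
  Finite.of_injective Diagram.partner fun _ _ h => Diagram.ext h

instance (n m : ℕ) : Fintype (Diagram n m) := Fintype.ofFinite _

variable {n m l s : ℕ}

/-- The diagram made of `n` through arcs. -/
def Diagram.one (n : ℕ) : Diagram n n where
  partner := Sum.swap
  invol a := Sum.swap_swap a
  ne_self a := by cases a <;> simp
  through_mono := by simp
  left_planar := by simp
  right_planar := by simp

/-- The horizontal concatenation of `x` and `y` has no connected component with more than one
critical point.  A component with two critical points (a circle or a squiggle) contains a right
return of `x` and a left return of `y` that share a point of the middle line, and conversely. -/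
def Composable (x : Diagram n m) (y : Diagram m l) : Prop :=
  ∀ j j' j'' : Fin m,
    ¬ (x.partner (Sum.inr j) = Sum.inr j' ∧ y.partner (Sum.inl j) = Sum.inl j'')

/-- The other end of the component of the concatenation of `x` and `y` that starts at a given
endpoint (if `x` and `y` are composable, such a component meets the middle line at most twice). -/
def concatPartner (x : Diagram n m) (y : Diagram m l) : Fin n ⊕ Fin l → Fin n ⊕ Fin l
  | Sum.inl i =>
    match x.partner (Sum.inl i) with
    | Sum.inl i' => Sum.inl i'
    | Sum.inr j =>
      match y.partner (Sum.inl j) with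
      | Sum.inr t => Sum.inr t
      | Sum.inl j' =>
        match x.partner (Sum.inr j') with
        | Sum.inl i' => Sum.inl i'
        | Sum.inr _ => Sum.inl i
  | Sum.inr t =>
    match y.partner (Sum.inr t) with
    | Sum.inr t' => Sum.inr t'
    | Sum.inl j =>
      match x.partner (Sum.inr j) with
      | Sum.inl i => Sum.inl i
      | Sum.inr j' =>
        match y.partner (Sum.inl j') with
        | Sum.inr t' => Sum.inr t'
        | Sum.inl _ => Sum.inr t

theorem concatPartner_invol (x : Diagram n m) (y : Diagram m l) (h : Composable x y)
    (a : Fin n ⊕ Fin l) : concatPartner x y (concatPartner x y a) = a := by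
  have hx := x.invol
  have hy := y.invol
  unfold Composable at h
  rcases a with a | a <;> simp only [concatPartner] <;> grind

theorem concatPartner_ne_self (x : Diagram n m) (y : Diagram m l) (h : Composable x y)
    (a : Fin n ⊕ Fin l) : concatPartner x y a ≠ a := by
  have hx := x.invol
  have hy := y.invol
  have hx' := x.ne_self
  have hy' := y.ne_self
  unfold Composable at h
  rcases a with a | a <;> simp only [concatPartner] <;> grind

theorem concatPartner_inl_inl {x : Diagram n m} {y : Diagram m l} (h : Composable x y)
    {i i' : Fin n} : concatPartner x y (Sum.inl i) = Sum.inl i' ↔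
      x.partner (Sum.inl i) = Sum.inl i' ∨ ∃ j j', x.partner (Sum.inl i) = Sum.inr j ∧
        y.partner (Sum.inl j) = Sum.inl j' ∧ x.partner (Sum.inr j') = Sum.inl i' := by
  have hx := x.invol
  have hy := y.invol
  unfold Composable at h
  simp only [concatPartner]; grind

theorem concatPartner_inr_inr {x : Diagram n m} {y : Diagram m l} (h : Composable x y)
    {i i' : Fin l} : concatPartner x y (Sum.inr i) = Sum.inr i' ↔
      y.partner (Sum.inr i) = Sum.inr i' ∨ ∃ j j', y.partner (Sum.inr i) = Sum.inl j ∧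
        x.partner (Sum.inr j) = Sum.inr j' ∧ y.partner (Sum.inl j') = Sum.inr i' := by
  have hx := x.invol
  have hy := y.invol
  unfold Composable at h
  simp only [concatPartner]; grind

theorem concatPartner_inl_inr {x : Diagram n m} {y : Diagram m l}
    {i : Fin n} {t : Fin l} : concatPartner x y (Sum.inl i) = Sum.inr t ↔
      ∃ j, x.partner (Sum.inl i) = Sum.inr j ∧ y.partner (Sum.inl j) = Sum.inr t := by
  simp only [concatPartner]; grind

theorem concatPartner_inr_inl {x : Diagram n m} {y : Diagram m l}
    {i : Fin n} {t : Fin l} : concatPartner x y (Sum.inr t) = Sum.inl i ↔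
      ∃ j, y.partner (Sum.inr t) = Sum.inl j ∧ x.partner (Sum.inr j) = Sum.inl i := by
  simp only [concatPartner]; grind

theorem Diagram.through_mono' (x : Diagram n m) {i i' : Fin n} {j j' : Fin m}
    (h : x.partner (Sum.inr j) = Sum.inl i) (h' : x.partner (Sum.inr j') = Sum.inl i')
    (hj : j < j') : i < i' := by
  have hx := x.invol
  have hm := x.through_mono i' i j' j
  rcases lt_trichotomy i i' with hi | hi | hi
  · exact hi
  · grind
  · grind

theorem concat_left_planar {x : Diagram n m} {y : Diagram m l} (h : Composable x y)
    (i i' a : Fin n) (e : concatPartner x y (Sum.inl i) = Sum.inl i') (h1 : i < a) (h2 : a < i') :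
    ∃ a', concatPartner x y (Sum.inl a) = Sum.inl a' ∧ i < a' ∧ a' < i' := by
  simp only [concatPartner_inl_inl h] at e ⊢
  have hx := x.invol
  have hxl := x.left_planar
  have hyl := y.left_planar
  have hxt := x.through_mono
  have hxt' := @Diagram.through_mono' _ _ x
  rcases e with e | ⟨j, j', e1, e2, e3⟩
  · grind
  · rcases ha : x.partner (Sum.inl a) with a' | b
    · refine ⟨a', Or.inl rfl, ?_⟩
      constructor
      · by_contra hc
        have : a' ≠ i := by grind
        have := hxl a' a i (by grind) (by grind) (by grind)
        grind
      · by_contra hc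
        have : a' ≠ i' := by grind
        have := hxl a a' i' (by grind) (by grind) (by grind)
        grind
    · have hb1 : j < b := hxt _ _ _ _ e1 ha h1
      have hb2 : b < j' := hxt _ _ _ _ ha (by grind) h2
      obtain ⟨b', hb, hb3, hb4⟩ := hyl _ _ _ e2 hb1 hb2
      rcases hb' : x.partner (Sum.inr b') with a' | c
      · exact ⟨a', Or.inr ⟨b, b', rfl, hb, hb'⟩, hxt' (by grind) hb' hb3, hxt' hb' e3 hb4⟩
      · have := y.invol (Sum.inl b)
        rw [hb] at this
        exact absurd ⟨hb', this⟩ (h _ _ _)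

theorem concat_right_planar {x : Diagram n m} {y : Diagram m l} (h : Composable x y)
    (i i' a : Fin l) (e : concatPartner x y (Sum.inr i) = Sum.inr i') (h1 : i < a) (h2 : a < i') :
    ∃ a', concatPartner x y (Sum.inr a) = Sum.inr a' ∧ i < a' ∧ a' < i' := by
  simp only [concatPartner_inr_inr h] at e ⊢
  have hy := y.invol
  have hxl := x.right_planar
  have hyl := y.right_planar
  have hyt := y.through_mono
  have hyt' := @Diagram.through_mono' _ _ y
  rcases e with e | ⟨j, j', e1, e2, e3⟩
  · grind
  · rcases ha : y.partner (Sum.inr a) with b | a'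
    · have hb1 : j < b := hyt' e1 ha h1
      have hb2 : b < j' := hyt' ha (by grind) h2
      obtain ⟨b', hb, hb3, hb4⟩ := hxl _ _ _ e2 hb1 hb2
      rcases hb' : y.partner (Sum.inl b') with c | a'
      · have := x.invol (Sum.inr b)
        rw [hb] at this
        exact absurd ⟨this, hb'⟩ (h _ _ _)
      · exact ⟨a', Or.inr ⟨b, b', rfl, hb, hb'⟩, hyt _ _ _ _ (by grind) hb' hb3,
          hyt _ _ _ _ hb' e3 hb4⟩
    · refine ⟨a', Or.inl rfl, ?_⟩
      constructor
      · by_contra hc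
        have : a' ≠ i := by grind
        have := hyl a' a i (by grind) (by grind) (by grind)
        grind
      · by_contra hc
        have : a' ≠ i' := by grind
        have := hyl a a' i' (by grind) (by grind) (by grind)
        grind

/-- The horizontal concatenation of two composable diagrams. -/
def Diagram.concat (x : Diagram n m) (y : Diagram m l) (h : Composable x y) : Diagram n l where
  partner := concatPartner x y
  invol := concatPartner_invol x y h
  ne_self := concatPartner_ne_self x y h
  through_mono i i' t t' e e' hi := by
    rw [concatPartner_inl_inr] at e e'
    obtain ⟨j, e1, e2⟩ := e
    obtain ⟨j', e1', e2'⟩ := e'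
    exact y.through_mono _ _ _ _ e2 e2' (x.through_mono _ _ _ _ e1 e1' hi)
  left_planar := concat_left_planar h
  right_planar := concat_right_planar h

open Classical in
/-- The product of two diagrams with matching middle line; `none` stands for `0`. -/
def Diagram.comp (x : Diagram n m) (y : Diagram m l) : Option (Diagram n l) :=
  if h : Composable x y then some (x.concat y h) else none

theorem composable_assoc (x : Diagram n m) (y : Diagram m l) (z : Diagram l s) :
    (∃ h : Composable x y, Composable (x.concat y h) z) ↔
      ∃ h : Composable y z, Composable x (y.concat z h) := by
  have hx := x.invol
  have hy := y.invol
  have hz := z.invol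
  constructor
  · rintro ⟨h, h'⟩
    have hyz : Composable y z := by
      rintro t t' t'' ⟨e, e'⟩
      exact h' t t' t'' ⟨(concatPartner_inr_inr h).2 (Or.inl e), e'⟩
    refine ⟨hyz, ?_⟩
    rintro j j' j'' ⟨e, e'⟩
    rcases (concatPartner_inl_inl hyz).1 e' with e' | ⟨t, t', e1, e2, e3⟩
    · exact h _ _ _ ⟨e, e'⟩
    · rcases e4 : y.partner (Sum.inl j') with c | t''
      · exact h j' j c ⟨by grind, e4⟩
      · exact h' t t'' t' ⟨(concatPartner_inr_inr h).2 (Or.inr ⟨j, j', by grind, e, e4⟩), e2⟩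
  · rintro ⟨h, h'⟩
    have hxy : Composable x y := by
      rintro t t' t'' ⟨e, e'⟩
      exact h' t t' t'' ⟨e, (concatPartner_inl_inl h).2 (Or.inl e')⟩
    refine ⟨hxy, ?_⟩
    rintro j j' j'' ⟨e, e'⟩
    rcases (concatPartner_inr_inr hxy).1 e with e | ⟨t, t', e1, e2, e3⟩
    · exact h _ _ _ ⟨e, e'⟩
    · rcases e4 : y.partner (Sum.inr j'') with t'' | c
      · exact h' t t' t'' ⟨e2, (concatPartner_inl_inl h).2 (Or.inr ⟨j, j'', by grind, e', e4⟩)⟩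
      · exact h j'' c j ⟨e4, by grind⟩

theorem concat_assoc (x : Diagram n m) (y : Diagram m l) (z : Diagram l s)
    (h : Composable x y) (h' : Composable (x.concat y h) z)
    (k : Composable y z) (k' : Composable x (y.concat z k)) :
    (x.concat y h).concat z h' = x.concat (y.concat z k) k' := by
  have hx := x.invol
  have hy := y.invol
  have hz := z.invol
  ext1
  funext a
  have key : ∀ a b, concatPartner (x.concat y h) z a = b → concatPartner x (y.concat z k) a = b := by
    rintro (a | a) (b | b) e
    · rw [concatPartner_inl_inl h'] at e
      rw [concatPartner_inl_inl k']
      simp only [Diagram.concat, concatPartner_inl_inl h, concatPartner_inl_inr,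
        concatPartner_inr_inl, concatPartner_inl_inl k] at e ⊢
      grind
    · rw [concatPartner_inl_inr] at e ⊢
      simp only [Diagram.concat, concatPartner_inl_inr] at e ⊢
      grind
    · rw [concatPartner_inr_inl] at e ⊢
      simp only [Diagram.concat, concatPartner_inr_inl] at e ⊢
      grind
    · rw [concatPartner_inr_inr h'] at e
      rw [concatPartner_inr_inr k']
      simp only [Diagram.concat, concatPartner_inr_inr h, concatPartner_inl_inr,
        concatPartner_inr_inl, concatPartner_inr_inr k] at e ⊢
      grind
  exact (key a _ rfl).symm

theorem comp_assoc (x : Diagram n m) (y : Diagram m l) (z : Diagram l s) :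
    ((x.comp y).bind fun w => w.comp z) = (y.comp z).bind fun w => x.comp w := by
  have H := composable_assoc x y z
  unfold Diagram.comp
  split_ifs with h1 h2 h2
  · simp only [Option.bind_some]
    split_ifs with h3 h4 h4
    · rw [concat_assoc]
    · exact absurd (H.1 ⟨h1, h3⟩) (by rintro ⟨_, h⟩; exact h4 h)
    · exact absurd (H.2 ⟨h2, h4⟩) (by rintro ⟨_, h⟩; exact h3 h)
    · rfl
  · simp only [Option.bind_some, Option.bind_none]
    rw [dif_neg]
    exact fun h3 => h2 (H.1 ⟨h1, h3⟩).1
  · simp only [Option.bind_some, Option.bind_none]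
    rw [dif_neg]
    exact fun h3 => h1 (H.2 ⟨h2, h3⟩).1
  · rfl

theorem one_comp (x : Diagram n m) : (Diagram.one n).comp x = some x := by
  have h : Composable (Diagram.one n) x := by simp [Composable, Diagram.one]
  rw [Diagram.comp, dif_pos h]
  congr 1
  ext1
  funext a
  have hx := x.invol
  rcases a with a | a <;> rcases e : x.partner _ with b | b
  all_goals simp [Diagram.concat, concatPartner, Diagram.one, e]

theorem comp_one (x : Diagram n m) : x.comp (Diagram.one m) = some x := by
  have h : Composable x (Diagram.one m) := by simp [Composable, Diagram.one]
  rw [Diagram.comp, dif_pos h]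
  congr 1
  ext1
  funext a
  rcases a with a | a <;> rcases e : x.partner _ with b | b
  all_goals simp [Diagram.concat, concatPartner, Diagram.one, e]

/-- The pairing of the diagram with `x` on top of `y`. -/
def stackPartner {n m n' m' : ℕ} (x : Diagram n m) (y : Diagram n' m') :
    Fin (n + n') ⊕ Fin (m + m') → Fin (n + n') ⊕ Fin (m + m')
  | Sum.inl i => Fin.addCases
      (fun i => (x.partner (Sum.inl i)).map (Fin.castAdd n') (Fin.castAdd m'))
      (fun i => (y.partner (Sum.inl i)).map (Fin.natAdd n) (Fin.natAdd m)) i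
  | Sum.inr j => Fin.addCases
      (fun j => (x.partner (Sum.inr j)).map (Fin.castAdd n') (Fin.castAdd m'))
      (fun j => (y.partner (Sum.inr j)).map (Fin.natAdd n) (Fin.natAdd m)) j

/-- Vertical stacking: `x` is placed on top of `y`. -/
def Diagram.stack {n m n' m' : ℕ} (x : Diagram n m) (y : Diagram n' m') :
    Diagram (n + n') (m + m') where
  partner := stackPartner x y
  invol := by
    have hx := x.invol
    have hy := y.invol
    rintro (a | a) <;> induction a using Fin.addCases with
      | left a =>
        simp only [stackPartner, Fin.addCases_left]
        rcases e : x.partner _ with b | b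
        all_goals
          · have e2 := congrArg x.partner e
            rw [hx] at e2
            simp [← e2]
      | right a =>
        simp only [stackPartner, Fin.addCases_right]
        rcases e : y.partner _ with b | b
        all_goals
          · have e2 := congrArg y.partner e
            rw [hy] at e2
            simp [← e2]
  ne_self := by
    have hx := x.ne_self
    have hy := y.ne_self
    rintro (a | a) <;> induction a using Fin.addCases with
      | left a =>
        simp only [stackPartner, Fin.addCases_left]
        rcases e : x.partner _ with b | b
        all_goals simp
        all_goals grind
      | right a =>
        simp only [stackPartner, Fin.addCases_right]
        rcases e : y.partner _ with b | b
        all_goals simp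
        all_goals grind
  through_mono := by
    have hx := x.through_mono
    have hy := y.through_mono
    intro i i' j j' h h' hi
    induction i using Fin.addCases with
    | left i =>
      induction i' using Fin.addCases with
      | left i' =>
        simp only [stackPartner, Fin.addCases_left] at h h'
        rcases e : x.partner (Sum.inl i) with b | b <;>
          rcases e' : x.partner (Sum.inl i') with b' | b' <;> simp [e, e'] at h h'
        subst h h'
        exact hx _ _ _ _ e e' hi
      | right i' =>
        simp only [stackPartner, Fin.addCases_left, Fin.addCases_right] at h h'
        rcases e : x.partner (Sum.inl i) with b | b <;>
          rcases e' : y.partner (Sum.inl i') with b' | b' <;> simp [e, e'] at h h'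
        subst h h'
        simp [Fin.lt_def]; omega
    | right i =>
      induction i' using Fin.addCases with
      | left i' => simp [Fin.lt_def] at hi; omega
      | right i' =>
        simp only [stackPartner, Fin.addCases_right] at h h'
        rcases e : y.partner (Sum.inl i) with b | b <;>
          rcases e' : y.partner (Sum.inl i') with b' | b' <;> simp [e, e'] at h h'
        subst h h'
        have := hy _ _ _ _ e e' (by simp only [Fin.lt_def, Fin.val_natAdd] at hi ⊢; omega)
        simp only [Fin.lt_def, Fin.val_natAdd] at this ⊢; omega
  left_planar := by
    have hx := x.left_planar
    have hy := y.left_planar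
    intro i i' c h hi hi'
    induction i using Fin.addCases with
    | left i =>
      simp only [stackPartner, Fin.addCases_left] at h
      rcases e : x.partner (Sum.inl i) with b | b <;> simp [e] at h
      subst h
      induction c using Fin.addCases with
      | left c =>
        obtain ⟨c', h1, h2, h3⟩ := hx _ _ c e hi hi'
        exact ⟨Fin.castAdd _ c', by simp [stackPartner, h1], h2, h3⟩
      | right c => simp [Fin.lt_def] at hi'; omega
    | right i =>
      simp only [stackPartner, Fin.addCases_right] at h
      rcases e : y.partner (Sum.inl i) with b | b <;> simp [e] at h
      subst h
      induction c using Fin.addCases with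
      | left c => simp [Fin.lt_def] at hi; omega
      | right c =>
        obtain ⟨c', h1, h2, h3⟩ := hy _ _ c e (by simp only [Fin.lt_def, Fin.val_natAdd] at hi ⊢; omega)
          (by simp only [Fin.lt_def, Fin.val_natAdd] at hi' ⊢; omega)
        exact ⟨Fin.natAdd _ c', by simp [stackPartner, h1], by simp only [Fin.lt_def, Fin.val_natAdd] at h2 ⊢; omega,
          by simp only [Fin.lt_def, Fin.val_natAdd] at h3 ⊢; omega⟩
  right_planar := by
    have hx := x.right_planar
    have hy := y.right_planar
    intro i i' c h hi hi'
    induction i using Fin.addCases with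
    | left i =>
      simp only [stackPartner, Fin.addCases_left] at h
      rcases e : x.partner (Sum.inr i) with b | b <;> simp [e] at h
      subst h
      induction c using Fin.addCases with
      | left c =>
        obtain ⟨c', h1, h2, h3⟩ := hx _ _ c e hi hi'
        exact ⟨Fin.castAdd _ c', by simp [stackPartner, h1], h2, h3⟩
      | right c => simp [Fin.lt_def] at hi'; omega
    | right i =>
      simp only [stackPartner, Fin.addCases_right] at h
      rcases e : y.partner (Sum.inr i) with b | b <;> simp [e] at h
      subst h
      induction c using Fin.addCases with
      | left c => simp [Fin.lt_def] at hi; omega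
      | right c =>
        obtain ⟨c', h1, h2, h3⟩ := hy _ _ c e (by simp only [Fin.lt_def, Fin.val_natAdd] at hi ⊢; omega)
          (by simp only [Fin.lt_def, Fin.val_natAdd] at hi' ⊢; omega)
        exact ⟨Fin.natAdd _ c', by simp [stackPartner, h1], by simp only [Fin.lt_def, Fin.val_natAdd] at h2 ⊢; omega,
          by simp only [Fin.lt_def, Fin.val_natAdd] at h3 ⊢; omega⟩

/-! ## The Chebyshev diagram algebra -/

/-- All diagrams, with arbitrary numbers of left and right endpoints. -/
abbrev AnyDiagram : Type := (n : ℕ) × (m : ℕ) × Diagram n m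

/-- The product of two diagrams; `none` stands for `0`. -/
def mulDiagram (x y : AnyDiagram) : Option AnyDiagram :=
  if h : y.1 = x.2.1 then
    (x.2.2.comp (h ▸ y.2.2 : Diagram x.2.1 y.2.1)).map fun d => ⟨x.1, y.2.1, d⟩
  else none

theorem mulDiagram_assoc (x y z : AnyDiagram) :
    ((mulDiagram x y).bind fun w => mulDiagram w z) =
      (mulDiagram y z).bind fun w => mulDiagram x w := by
  obtain ⟨n, m, x⟩ := x
  obtain ⟨m', l, y⟩ := y
  obtain ⟨l', s, z⟩ := z
  by_cases h : m' = m
  · subst h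
    by_cases h' : l' = l
    · subst h'
      have := congrArg (Option.map fun d => (⟨n, s, d⟩ : AnyDiagram)) (comp_assoc x y z)
      cases h1 : x.comp y <;> cases h2 : y.comp z <;> simp_all [mulDiagram]
    · cases h1 : x.comp y <;> simp [mulDiagram, h', h1]
  · by_cases h' : l' = l
    · subst h'
      cases h1 : y.comp z <;> simp [mulDiagram, h, h1]
    · simp [mulDiagram, h, h']

/-- The algebra `A^c`: the vector space with basis all diagrams, and the product extending the
product of diagrams bilinearly.  It is associative but has no unit. -/
def ChebAlg (k : Type u) [Field k] : Type u := AnyDiagram →₀ k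

namespace ChebAlg

variable (k : Type u) [Field k]

instance : AddCommGroup (ChebAlg k) := inferInstanceAs (AddCommGroup (AnyDiagram →₀ k))
instance : Module k (ChebAlg k) := inferInstanceAs (Module k (AnyDiagram →₀ k))

/-- A diagram, or `0`, as an element of the algebra. -/
def ofOption : Option AnyDiagram → ChebAlg k
  | none => 0
  | some x => Finsupp.single x 1

/-- The multiplication as a bilinear map. -/
def mulHom : ChebAlg k →ₗ[k] ChebAlg k →ₗ[k] ChebAlg k :=
  Finsupp.linearCombination k fun x => Finsupp.linearCombination k fun y =>
    ofOption k (mulDiagram x y)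

variable {k}

instance : Mul (ChebAlg k) := ⟨fun a b => mulHom k a b⟩

theorem mul_def (a b : ChebAlg k) : a * b = mulHom k a b := rfl

theorem mulHom_ofOption (x y : AnyDiagram) :
    mulHom k (ofOption k (some x)) (ofOption k (some y)) = ofOption k (mulDiagram x y) := by
  change (Finsupp.linearCombination k (fun x => (Finsupp.linearCombination k
    (fun y => ofOption k (mulDiagram x y)) : (AnyDiagram →₀ k) →ₗ[k] ChebAlg k))
    (Finsupp.single x (1 : k))) (Finsupp.single y (1 : k)) = _
  rw [Finsupp.linearCombination_single, one_smul, Finsupp.linearCombination_single, one_smul]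

theorem ofOption_mul (x y : Option AnyDiagram) :
    ofOption k x * ofOption k y = ofOption k (x.bind fun x => y.bind fun y => mulDiagram x y) := by
  rw [mul_def]
  rcases x with _ | x
  · simp [ofOption]
  rcases y with _ | y
  · simp [ofOption]
  exact mulHom_ofOption x y

theorem induction_on {p : ChebAlg k → Prop} (a : ChebAlg k) (h0 : p 0)
    (hadd : ∀ a b, p a → p b → p (a + b))
    (hsmul : ∀ (c : k) (x : AnyDiagram), p (c • ofOption k (some x))) : p a := by
  refine Finsupp.induction_linear (motive := p) a h0 hadd fun x c => ?_
  have := hsmul c x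
  unfold ofOption at this
  erw [Finsupp.smul_single] at this
  simpa using this

instance : NonUnitalRing (ChebAlg k) where
  left_distrib a b c := by simp [mul_def]
  right_distrib a b c := by simp [mul_def]
  zero_mul a := by simp [mul_def]
  mul_zero a := by simp [mul_def]
  mul_assoc a b c := by
    induction a using ChebAlg.induction_on with
    | h0 => simp [mul_def]
    | hadd a a' h h' => simp only [mul_def, map_add, LinearMap.add_apply] at *; rw [h, h']
    | hsmul r x =>
    induction b using ChebAlg.induction_on with
    | h0 => simp [mul_def]
    | hadd b b' h h' => simp only [mul_def, map_add, LinearMap.add_apply] at *; rw [h, h']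
    | hsmul r' y =>
    induction c using ChebAlg.induction_on with
    | h0 => simp [mul_def]
    | hadd c c' h h' => simp only [mul_def, map_add] at *; rw [h, h']
    | hsmul r'' z =>
    have key : ofOption k (some x) * ofOption k (some y) * ofOption k (some z) =
        ofOption k (some x) * (ofOption k (some y) * ofOption k (some z)) := by
      simp only [ofOption_mul, Option.bind_some, mulDiagram_assoc]
    simp only [mul_def, map_smul, LinearMap.smul_apply] at key ⊢
    rw [key]

instance : IsScalarTower k (ChebAlg k) (ChebAlg k) :=
  ⟨fun c a b => by simp [mul_def, smul_eq_mul]⟩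

instance : SMulCommClass k (ChebAlg k) (ChebAlg k) :=
  ⟨fun c a b => by simp [mul_def, smul_eq_mul]⟩

end ChebAlg

/-! ## Modules -/

section Modules

variable (k : Type u) [Field k]

/-- `A^c` with a unit adjoined.  A left module over the non-unital algebra `A^c` is the same thing
as a left module over this ring. -/
abbrev UAlg : Type u := Unitization k (ChebAlg k)

variable {k}

/-- A diagram as an element of the ring. -/
def diag (d : Diagram n m) : UAlg k := Unitization.inr (ChebAlg.ofOption k (some ⟨n, m, d⟩))

/-- The idempotent `1_n`. -/
def idem (n : ℕ) : UAlg k := diag (Diagram.one n)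

theorem diag_mul_idem (d : Diagram n m) : diag (k := k) d * idem m = diag d := by
  rw [idem, diag, diag, ← Unitization.inr_mul, ChebAlg.ofOption_mul]
  simp [mulDiagram, comp_one]

theorem idem_mul_diag (d : Diagram n m) : idem n * diag (k := k) d = diag d := by
  rw [idem, diag, diag, ← Unitization.inr_mul, ChebAlg.ofOption_mul]
  simp [mulDiagram, one_comp]

theorem idem_mul_idem (n : ℕ) : (idem n : UAlg k) * idem n = idem n := diag_mul_idem _

/-- A module is unital if it is the sum of the subgroups `1_n V`, `n ≥ 0` (the sum is then direct,
the idempotents being orthogonal). -/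
def IsUnital (V : Type u) [AddCommGroup V] [Module (UAlg k) V] : Prop :=
  ∀ v : V, v ∈ AddSubgroup.closure {w : V | ∃ n : ℕ, (idem n : UAlg k) • w = w}

/-- Finitely generated projective unital modules.  For a unital module, being projective in the
category of unital modules is the same as being projective over the ring with unit adjoined: every
unital module is a quotient of a direct sum of modules `A 1_n`, and these are projective over both;
the two notions of finite generation also agree. -/
structure IsFGProj (V : ModuleCat.{u} (UAlg k)) : Prop where
  unital : IsUnital (k := k) V
  finite : Module.Finite (UAlg k) V
  projective : Module.Projective (UAlg k) V

variable (k)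

/-- The type of finitely generated projective unital modules. -/
abbrev FGProj : Type (u + 1) := {V : ModuleCat.{u} (UAlg k) // IsFGProj V}

/-- The Grothendieck group `K_0(A^c)`: generators `[V]`, for `V` finitely generated projective,
and relations `[V] = [V₁] + [V₂]` whenever `V ≅ V₁ ⊕ V₂`. -/
abbrev K0 : Type (u + 1) :=
  FreeAbelianGroup (FGProj k) ⧸ AddSubgroup.closure
    {z | ∃ V V₁ V₂ : FGProj k, Nonempty (V.1 ≃ₗ[UAlg k] V₁.1 × V₂.1) ∧
      z = FreeAbelianGroup.of V - FreeAbelianGroup.of V₁ - FreeAbelianGroup.of V₂}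

variable {k}

/-- The symbol `[V]` of a finitely generated projective module. -/
def K0.mk (V : FGProj k) : K0 k := QuotientAddGroup.mk (FreeAbelianGroup.of V)

variable (k)

/-- The module `P_n = A^c 1_n`. -/
def P (n : ℕ) : Submodule (UAlg k) (UAlg k) := Submodule.span (UAlg k) {idem n}

variable {k}

theorem mem_P {n : ℕ} {x : UAlg k} : x ∈ P k n ↔ x * idem n = x := by
  rw [P, Submodule.mem_span_singleton]
  constructor
  · rintro ⟨a, rfl⟩
    rw [smul_eq_mul, mul_assoc, idem_mul_idem]
  · exact fun h => ⟨x, h⟩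

theorem isUnital_P (n : ℕ) : IsUnital (k := k) (P k n) := by
  let f : UAlg k →ₗ[UAlg k] P k n :=
    (LinearMap.toSpanSingleton (UAlg k) (UAlg k) (idem n)).codRestrict (P k n) fun x => by
      rw [mem_P, LinearMap.toSpanSingleton_apply, smul_eq_mul, mul_assoc, idem_mul_idem]
  have hf : ∀ y, (f y : UAlg k) = y * idem n := fun y => rfl
  have key : ∀ y, f y ∈ AddSubgroup.closure {w : P k n | ∃ m : ℕ, (idem m : UAlg k) • w = w} := by
    intro y
    induction y using Unitization.ind with
    | inl_add_inr c a =>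
    rw [map_add]
    refine add_mem (AddSubgroup.subset_closure ⟨n, Subtype.ext ?_⟩) ?_
    · have hc : (Unitization.inl c : UAlg k) = algebraMap k (UAlg k) c := rfl
      rw [Submodule.coe_smul, hf, smul_eq_mul, hc, ← Algebra.smul_def, mul_smul_comm,
        idem_mul_idem]
    · induction a using ChebAlg.induction_on with
      | h0 => simp
      | hadd a b ha hb => rw [Unitization.inr_add, map_add]; exact add_mem ha hb
      | hsmul c x =>
        obtain ⟨m, l, d⟩ := x
        refine AddSubgroup.subset_closure ⟨m, Subtype.ext ?_⟩
        have := idem_mul_diag (k := k) d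
        rw [diag] at this
        rw [Submodule.coe_smul, hf, smul_eq_mul, Unitization.inr_smul, smul_mul_assoc,
          mul_smul_comm, ← mul_assoc, this]
  rintro ⟨x, hx⟩
  have := key x
  rwa [show f x = ⟨x, hx⟩ from Subtype.ext (mem_P.1 hx)] at this

theorem isFGProj_P (n : ℕ) : IsFGProj (ModuleCat.of (UAlg k) (P k n)) where
  unital := isUnital_P n
  finite := Module.Finite.span_singleton _ _
  projective := by
    refine Module.Projective.of_split (P k n).subtype
      ((LinearMap.toSpanSingleton (UAlg k) (UAlg k) (idem n)).codRestrict (P k n) fun x => ?_) ?_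
    · rw [mem_P, LinearMap.toSpanSingleton_apply, smul_eq_mul, mul_assoc, idem_mul_idem]
    · refine LinearMap.ext fun x => Subtype.ext ?_
      exact mem_P.1 x.2

variable (k)

/-- The generator `1_n` of `P_n`. -/
def genP (n : ℕ) : P k n := ⟨idem n, Submodule.subset_span rfl⟩

/-- `P_n` as a finitely generated projective module. -/
def projP (n : ℕ) : FGProj k := ⟨ModuleCat.of (UAlg k) (P k n), isFGProj_P n⟩

/-- The submodule `I_n` of `P_n` spanned by the diagrams with `n` right endpoints and at least one
right return. -/
def I (n : ℕ) : Submodule (UAlg k) (P k n) :=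
  Submodule.span (UAlg k) {x | ∃ (m : ℕ) (d : Diagram m n),
    (∃ j j', d.partner (Sum.inr j) = Sum.inr j') ∧ (x : UAlg k) = diag d}

/-- The standard module `M_n = P_n / I_n`. -/
abbrev M (n : ℕ) : Type u := P k n ⧸ I k n

end Modules

/-! ## The tensor product of modules -/

section Tensor

open scoped ModuleCat

variable {k : Type u} [Field k]

/-- The right exact tensor product of modules given by vertical stacking: the quotient of
`A ⊗ V ⊗ W` by the relations `(α stacked on β) ⊗ v ⊗ w = 1 ⊗ α v ⊗ β w` for all diagrams `α`, `β`
and all `v ∈ 1_c V`, `w ∈ 1_d W`, where `c`, `d` are the numbers of right endpoints of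
`α`, `β`. -/
def tensor (V W : ModuleCat.{u} (UAlg k)) : ModuleCat.{u} (UAlg k) :=
  ModuleCat.of (UAlg k) ((UAlg k ⊗[k] (V ⊗[k] W)) ⧸ Submodule.span (UAlg k)
    {z : UAlg k ⊗[k] (V ⊗[k] W) | ∃ (a b c d : ℕ) (α : Diagram a c) (β : Diagram b d) (v : V) (w : W),
      (idem c : UAlg k) • v = v ∧ (idem d : UAlg k) • w = w ∧
      z = diag (α.stack β) ⊗ₜ[k] (v ⊗ₜ[k] w) -
        1 ⊗ₜ[k] (((diag α : UAlg k) • v) ⊗ₜ[k] ((diag β : UAlg k) • w))})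

/-- The class of `x ⊗ v ⊗ w`. -/
def tensorMk {V W : ModuleCat.{u} (UAlg k)} (x : UAlg k) (v : V) (w : W) : tensor V W :=
  Submodule.Quotient.mk (x ⊗ₜ[k] (v ⊗ₜ[k] w))

end Tensor

/-! ## The homotopy category of bounded complexes of finitely generated projectives -/

section Homotopy

variable (k : Type u) [Field k]

/-- Bounded cochain complexes of finitely generated projective modules. -/
structure IsPerf {k : Type u} [Field k] (C : CochainComplex (ModuleCat.{u} (UAlg k)) ℤ) : Prop where
  bounded : ∃ a b : ℤ, ∀ i : ℤ, i < a ∨ b < i → Limits.IsZero (C.X i)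
  fgProj : ∀ i : ℤ, IsFGProj (C.X i)

/-- The objects of the category of bounded complexes of finitely generated projective modules. -/
abbrev PerfCpx : Type (u + 1) :=
  {C : CochainComplex (ModuleCat.{u} (UAlg k)) ℤ // IsPerf C}

/-- A bounded complex of finitely generated projectives as an object of the homotopy category. -/
abbrev PerfCpx.htpy {k : Type u} [Field k] (C : PerfCpx k) :
    HomotopyCategory (ModuleCat.{u} (UAlg k)) (ComplexShape.up ℤ) :=
  (HomotopyCategory.quotient _ _).obj C.1

/-- The Grothendieck group of the triangulated category of bounded complexes of finitely generated
projectives up to homotopy: generators `[C]` and relations `[Y] = [X] + [Z]` for all distinguished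
triangles `X → Y → Z → X[1]`. -/
abbrev K0Htpy : Type (u + 1) :=
  FreeAbelianGroup (PerfCpx k) ⧸ AddSubgroup.closure
    {z | ∃ (X Y Z : PerfCpx k) (f : X.htpy ⟶ Y.htpy) (g : Y.htpy ⟶ Z.htpy)
      (h : Z.htpy ⟶ (shiftFunctor _ (1 : ℤ)).obj X.htpy),
      Pretriangulated.Triangle.mk f g h ∈ Pretriangulated.distinguishedTriangles ∧
      z = FreeAbelianGroup.of Y - FreeAbelianGroup.of X - FreeAbelianGroup.of Z}

variable {k}

/-- The symbol of a bounded complex of finitely generated projectives. -/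
def K0Htpy.mk (C : PerfCpx k) : K0Htpy k := QuotientAddGroup.mk (FreeAbelianGroup.of C)

/-- A module as a complex concentrated in degree `0`. -/
abbrev single (V : ModuleCat.{u} (UAlg k)) : CochainComplex (ModuleCat.{u} (UAlg k)) ℤ :=
  (HomologicalComplex.single _ (ComplexShape.up ℤ) 0).obj V

end Homotopy

/-! ## The resolution of the standard module -/

section Resolution

/-- The set of diagrams in `B^c` with `m` left and `n` right endpoints that have no left returns and
only unnested right returns. -/
def Ytilde (m n : ℕ) : Set (Diagram m n) :=
  {d | (∀ i i', d.partner (Sum.inl i) ≠ Sum.inl i') ∧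
    ∀ p p' q q', d.partner (Sum.inr p) = Sum.inr p' → d.partner (Sum.inr q) = Sum.inr q' →
      ¬ (p < q ∧ q < q' ∧ q' < p')}

/-- The index set of the `i`-th term of the resolution of `M_n`: diagrams in `Ytilde (n - 2i) n`;
it is empty if `2i > n`. -/
abbrev YIdx (n i : ℕ) : Type := {d : Diagram (n - 2 * i) n // 2 * i ≤ n ∧ d ∈ Ytilde (n - 2 * i) n}

instance (n i : ℕ) : Fintype (YIdx n i) := Fintype.ofFinite _

/-- The diagrams with no left return and exactly one right return, which joins two neighbouring
right endpoints. -/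
def IsElementary (b : Diagram m n) : Prop :=
  (∀ i i', b.partner (Sum.inl i) ≠ Sum.inl i') ∧
    ∃ j j' : Fin n, (j' : ℕ) = j + 1 ∧ b.partner (Sum.inr j) = Sum.inr j' ∧
      ∀ t t', b.partner (Sum.inr t) = Sum.inr t' → t = j ∨ t = j'

/-- If `α = b β`, the number of right returns of `α` that lie above the right return of `α` which
comes from the right return of `b` (the latter return being the `j`-th from the top, this is
`j - 1`). -/
def returnsAbove {N : ℕ} (α : Diagram m n) (b : Diagram m N) (β : Diagram N n) : ℕ :=
  Nat.card {q : Fin n // (∃ q', α.partner (Sum.inr q) = Sum.inr q' ∧ q < q') ∧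
    ∃ j j' p, b.partner (Sum.inr j) = Sum.inr j' ∧ j < j' ∧
      β.partner (Sum.inl j) = Sum.inr p ∧ q < p}

variable (k : Type u) [Field k]

/-- Right multiplication by a diagram, a map `P_n → P_m`. -/
def rightMul (d : Diagram n m) : P k n →ₗ[UAlg k] P k m :=
  (LinearMap.toSpanSingleton (UAlg k) (UAlg k) (diag d)).restrict fun x _ => by
    rw [mem_P, LinearMap.toSpanSingleton_apply, smul_eq_mul, mul_assoc, diag_mul_idem]

/-- The `i`-th term of the resolution of `M_n`: copies of `P_{n-2i}` indexed by
`Ytilde (n - 2i) n`. -/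
abbrev ResTerm (n i : ℕ) : Type u := YIdx n i → P k (n - 2 * i)

open Classical in
/-- The component of the differential from the copy of `P_{n-2(i+1)}` with index `α` to the copy of
`P_{n-2i}` with index `β`: it is `a ↦ (-1)^(j-1) a b` if `α = b β` for an elementary diagram `b`
(there is at most one), and `0` if there is no such `b`. -/
def resComponent (n i : ℕ) (β : YIdx n i) (α : YIdx n (i + 1)) :
    P k (n - 2 * (i + 1)) →ₗ[UAlg k] P k (n - 2 * i) :=
  ∑ b : Diagram (n - 2 * (i + 1)) (n - 2 * i),
    if IsElementary b ∧ b.comp β.1 = some α.1 then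
      ((-1 : ℤ) ^ returnsAbove α.1 b β.1) • rightMul k b
    else 0

/-- The differential from the `(i+1)`-st to the `i`-th term. -/
def resD (n i : ℕ) : ResTerm k n (i + 1) →ₗ[UAlg k] ResTerm k n i :=
  LinearMap.pi fun β => ∑ α, resComponent k n i β α ∘ₗ LinearMap.proj α

/-- The augmentation from the `0`-th term to `M_n`.  The only element of `Ytilde n n` is `1_n`. -/
def resAug (n : ℕ) : ResTerm k n 0 →ₗ[UAlg k] M k n :=
  (I k n).mkQ ∘ₗ ∑ α : YIdx n 0, rightMul k α.1 ∘ₗ LinearMap.proj α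

/-- The terms of the resolution other than `M_n`, with the differentials `resD`, as a chain
complex. -/
def resChain (n : ℕ) (hd : ∀ i, resD k n i ∘ₗ resD k n (i + 1) = 0) :
    ChainComplex (ModuleCat.{u} (UAlg k)) ℕ :=
  ChainComplex.of (fun i => ModuleCat.of (UAlg k) (ResTerm k n i))
    (fun i => ModuleCat.ofHom (resD k n i)) fun i => by
      rw [← ModuleCat.ofHom_comp, hd]; rfl

/-- The same as a cochain complex, with the `i`-th term in degree `-i`. -/
def resCochain (n : ℕ) (hd : ∀ i, resD k n i ∘ₗ resD k n (i + 1) = 0) :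
    CochainComplex (ModuleCat.{u} (UAlg k)) ℤ :=
  (resChain k n hd).extend ComplexShape.embeddingDownNat

end Resolution

end ChebyshevDiagrams
end

open ChebyshevDiagrams

/-!
The proof has three independent parts: the computation of `K_0(A^c)`, the comparison with the
homotopy category, and the exactness of the explicit resolution.

**Projectives.**  Concatenation of diagrams adds up the numbers of endpoints on returns
(`Diagram.card_returnPoints_add_le`).  Hence the coefficient of the identity diagram on `n` strands
is a character `eps k n` of the algebra, and the common kernel `rad k` of these characters is a nil
ideal, contained in the Jacobson radical (`rad_le_jacobson`).  By Nakayama's lemma a nonzero finitely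
generated projective unital module maps onto some `P_n`, and it is therefore a finite direct sum of
modules `P_n` (`IsFGProj.induction`).  The multiplicity of `P_n` in `V` is the dimension of
`Hom(V, Simple k n)`, where `Simple k n` is the one-dimensional module given by `eps k n`.  The
multiplicities separate the classes `[P_n]`, which gives `K_0(A^c) ≅ ℤ[x]`
(`K0.equivPolynomial`).  The tensor product preserves direct sums, and `P_a ⊗ P_b ≅ P_{a+b}`
(`tensorPEquiv`) by the interchange law for concatenation and stacking; so it corresponds to the
product of polynomials (`equivPolynomial_mk_tensor`).

**The homotopy category.**  A bounded complex of projectives is a successive extension of its terms,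
by stupid truncation, so that `K_0(A^c) → K_0(𝒞)` is surjective.  The alternating sum `eulerMult` of
the multiplicities of `P_n` in the terms of a complex vanishes on contractible complexes and is
additive on mapping cones, hence is defined on `K_0(𝒞)`; this gives injectivity (`K0.equivHtpy`),
and it computes the inverse (`K0.multHom_equivHtpy_symm`).

**The resolution.**  A diagram `β` without left returns and nested right returns is determined by
the set `β.tops` of the upper endpoints of its right returns, and a diagram `c` can be written as
`a β`, with a unique `a`, if and only if `β.tops ⊆ c.tops`, where `c.tops` belongs to the minimal right
returns of `c` (`Ytilde.exists_comp_eq`).  The `i`-th term of the resolution thus has a basis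
`resVec i c T` indexed by diagrams `c` with `n` right endpoints and sets `T ⊆ c.tops` with `i`
elements, and the differential is the boundary map of the full simplex on `c.tops`
(`resD_resVec`).  The cone over the uppermost element of `c.tops` is a contracting homotopy
(`resD_resHtpy_add`), except for the empty simplex if `c.tops` is empty, that is, if `c` has no right
returns; what remains is `M_n` (`exact_resAug`).

The class of any resolution of `M_n` is the one of the explicit resolution, because quasi-isomorphic
bounded complexes of projectives are homotopy equivalent (`nonempty_htpy_iso_of_quasiIso`).  The
number of index diagrams is the number of ways to choose `i` disjoint pairs of neighbouring points
among `n` points (`card_YIdx`), and the resulting alternating sum of powers of `x` satisfies the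
recursion of the Chebyshev polynomials (`sum_choose_smul_X_pow`).
-/

noncomputable section

namespace ChebyshevDiagrams

variable {n m l s : ℕ}

/-! ### Counting returns -/

namespace Diagram

/-- The endpoints of a diagram that lie on returns. -/
def returnPoints (x : Diagram n m) : Finset (Fin n ⊕ Fin m) :=
  Finset.univ.filter fun a => (x.partner a).isLeft = a.isLeft

theorem mem_returnPoints {x : Diagram n m} {a : Fin n ⊕ Fin m} :
    a ∈ x.returnPoints ↔ (x.partner a).isLeft = a.isLeft := by
  simp [returnPoints]

/-- An endpoint of a concatenation lying on a return is traced back to an endpoint of a return of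
one of the two factors, and every such endpoint is reached. -/
theorem card_returnPoints_add_le {x : Diagram n m} {y : Diagram m l} {z : Diagram n l}
    (h : x.comp y = some z) :
    x.returnPoints.card + y.returnPoints.card ≤ z.returnPoints.card := by
  classical
  unfold comp at h
  split_ifs at h with hc
  obtain rfl := Option.some.inj h
  -- `G` fixes an endpoint of the concatenation that lies on a return of its factor, and sends any
  -- other endpoint to the point of the other factor reached by its through arc
  let G : Fin n ⊕ Fin l → (Fin n ⊕ Fin m) ⊕ (Fin m ⊕ Fin l)
    | Sum.inl i => match x.partner (Sum.inl i) with
      | Sum.inl _ => Sum.inl (Sum.inl i)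
      | Sum.inr j => Sum.inr (Sum.inl j)
    | Sum.inr t => match y.partner (Sum.inr t) with
      | Sum.inr _ => Sum.inr (Sum.inr t)
      | Sum.inl j => Sum.inl (Sum.inr j)
  rw [← Finset.card_disjSum]
  refine (Finset.card_le_card (t := (x.concat y hc).returnPoints.image G) ?_).trans
    Finset.card_image_le
  have hx := x.invol
  have hy := y.invol
  intro a ha
  rw [Finset.mem_image]
  rcases a with (i | j) | (j | t)
  · rw [Finset.inl_mem_disjSum, mem_returnPoints] at ha
    rcases e : x.partner (Sum.inl i) with i' | j
    · exact ⟨Sum.inl i, by simp [mem_returnPoints, concat, concatPartner, e], by simp [G, e]⟩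
    · simp [e] at ha
  · rw [Finset.inl_mem_disjSum, mem_returnPoints] at ha
    rcases e : x.partner (Sum.inr j) with i' | j'
    · simp [e] at ha
    · rcases e1 : y.partner (Sum.inl j) with j1 | t
      · exact absurd ⟨e, e1⟩ (hc _ _ _)
      rcases e2 : y.partner (Sum.inl j') with j1 | t'
      · have := hx (Sum.inr j)
        rw [e] at this
        exact absurd ⟨this, e2⟩ (hc _ _ _)
      have e3 := hy (Sum.inl j)
      rw [e1] at e3
      exact ⟨Sum.inr t, by simp [mem_returnPoints, concat, concatPartner, e3, e, e2],
        by simp [G, e3]⟩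
  · rw [Finset.inr_mem_disjSum, mem_returnPoints] at ha
    rcases e : y.partner (Sum.inl j) with j' | t
    · rcases e1 : x.partner (Sum.inr j) with i | j1
      · rcases e2 : x.partner (Sum.inr j') with i' | j1
        · have e3 := hx (Sum.inr j)
          rw [e1] at e3
          exact ⟨Sum.inl i, by simp [mem_returnPoints, concat, concatPartner, e3, e, e2],
            by simp [G, e3]⟩
        · have := hy (Sum.inl j)
          rw [e] at this
          exact absurd ⟨e2, this⟩ (hc _ _ _)
      · exact absurd ⟨e1, e⟩ (hc _ _ _)
    · simp [e] at ha
  · rw [Finset.inr_mem_disjSum, mem_returnPoints] at ha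
    rcases e : y.partner (Sum.inr t) with i' | j
    · simp [e] at ha
    · exact ⟨Sum.inr t, by simp [mem_returnPoints, concat, concatPartner, e], by simp [G, e]⟩

/-- A diagram without returns is an identity diagram. -/
theorem eq_one_of_returnPoints_eq_empty (x : Diagram n m) (h : x.returnPoints = ∅) :
    (⟨n, m, x⟩ : AnyDiagram) = ⟨n, n, one n⟩ := by
  have hl : ∀ i, ∃ j, x.partner (Sum.inl i) = Sum.inr j := by
    intro i
    have : Sum.inl i ∉ x.returnPoints := by simp [h]
    rw [mem_returnPoints] at this
    rcases e : x.partner (Sum.inl i) with a | a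
    · simp [e] at this
    · exact ⟨a, rfl⟩
  have hr : ∀ j, ∃ i, x.partner (Sum.inr j) = Sum.inl i := by
    intro i
    have : Sum.inr i ∉ x.returnPoints := by simp [h]
    rw [mem_returnPoints] at this
    rcases e : x.partner (Sum.inr i) with a | a
    · exact ⟨a, rfl⟩
    · simp [e] at this
  choose f hf using hl
  choose g hg using hr
  have hgf : ∀ i, g (f i) = i := fun i => by
    have := x.invol (Sum.inl i)
    rw [hf, hg] at this
    exact Sum.inl.inj this
  have hfg : ∀ i, f (g i) = i := fun i => by
    have := x.invol (Sum.inr i)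
    rw [hg, hf] at this
    exact Sum.inr.inj this
  have hnm : n = m := by simpa using Fintype.card_congr (⟨f, g, hgf, hfg⟩ : Fin n ≃ Fin m)
  subst hnm
  have hmono : StrictMono f := fun i i' hi => x.through_mono _ _ _ _ (hf i) (hf i') hi
  have hid : f = id := by
    refine StrictMono.range_inj hmono strictMono_id |>.1 ?_
    rw [Set.range_id, Set.range_eq_univ]
    exact fun i => ⟨_, hfg i⟩
  have hgid : ∀ i, g i = i := fun i => by
    have := hgf i; rwa [hid] at this
  congr 2
  ext1
  funext a
  rcases a with a | a
  · rw [hf, hid]; rfl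
  · rw [hg, hgid]; rfl

theorem returnPoints_one : (one n).returnPoints = ∅ := by
  ext a; rcases a with a | a <;> simp [mem_returnPoints, one]

end Diagram

theorem mulDiagram_mk (x : Diagram n m) (y : Diagram m l) :
    mulDiagram ⟨n, m, x⟩ ⟨m, l, y⟩ = (x.comp y).map fun d => ⟨n, l, d⟩ := by
  simp [mulDiagram]

theorem mulDiagram_eq_some {x y z : AnyDiagram} (h : mulDiagram x y = some z) :
    ∃ (n m l : ℕ) (a : Diagram n m) (b : Diagram m l) (c : Diagram n l), x = ⟨n, m, a⟩ ∧
      y = ⟨m, l, b⟩ ∧ z = ⟨n, l, c⟩ ∧ a.comp b = some c := by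
  obtain ⟨n, m, x⟩ := x
  obtain ⟨m', l, y⟩ := y
  by_cases hm : m' = m
  · subst hm
    rw [mulDiagram_mk, Option.map_eq_some_iff] at h
    obtain ⟨c, hc, rfl⟩ := h
    exact ⟨_, _, _, x, y, c, rfl, rfl, rfl, hc⟩
  · simp [mulDiagram, hm] at h

/-- The identity diagram on `n` strands among all diagrams. -/
def anyOne (n : ℕ) : AnyDiagram := ⟨n, n, Diagram.one n⟩

theorem anyOne_injective : Function.Injective anyOne := fun _ _ h => congrArg Sigma.fst h

/-- Concatenation never removes a return, so that only identity diagrams multiply to an identity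
diagram. -/
theorem mulDiagram_eq_anyOne {x y : AnyDiagram} :
    mulDiagram x y = some (anyOne n) ↔ x = anyOne n ∧ y = anyOne n := by
  constructor
  · intro h
    obtain ⟨n', m, l, a, b, c, rfl, rfl, hz, hc⟩ := mulDiagram_eq_some h
    obtain rfl : n = n' := congrArg Sigma.fst hz
    have hz2 := eq_of_heq (Sigma.mk.inj hz).2
    obtain rfl : n = l := congrArg Sigma.fst hz2
    obtain rfl := eq_of_heq (Sigma.mk.inj hz2).2
    have := Diagram.card_returnPoints_add_le hc
    rw [Diagram.returnPoints_one, Finset.card_empty] at this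
    have ha := a.eq_one_of_returnPoints_eq_empty (Finset.card_eq_zero.1 (by omega))
    have hb := b.eq_one_of_returnPoints_eq_empty (Finset.card_eq_zero.1 (by omega))
    refine ⟨ha, hb.trans ?_⟩
    obtain rfl : m = n := congrArg (fun z : AnyDiagram => z.2.1) ha
    rfl
  · rintro ⟨rfl, rfl⟩
    rw [anyOne, mulDiagram_mk, one_comp]; rfl

/-! ### The one-dimensional modules and the radical -/

section Radical

variable (k : Type u) [Field k]

open Classical in
/-- The coefficient of the identity diagram on `n` strands. -/
def coeffOne (n : ℕ) : ChebAlg k →ₗ[k] k :=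
  Finsupp.linearCombination k fun d : AnyDiagram => if d = anyOne n then (1 : k) else 0

variable {k}

open Classical in
theorem coeffOne_ofOption (n : ℕ) (d : Option AnyDiagram) :
    coeffOne k n (ChebAlg.ofOption k d) = if d = some (anyOne n) then 1 else 0 := by
  rcases d with _ | d
  · simp [ChebAlg.ofOption]
  · rw [coeffOne]
    refine (Finsupp.linearCombination_single _ _ _).trans ?_
    simp

theorem coeffOne_mul (n : ℕ) (a b : ChebAlg k) :
    coeffOne k n (a * b) = coeffOne k n a * coeffOne k n b := by
  induction a using ChebAlg.induction_on with
  | h0 => simp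
  | hadd a a' h h' => simp only [add_mul, map_add, h, h']
  | hsmul r x =>
  induction b using ChebAlg.induction_on with
  | h0 => simp
  | hadd b b' h h' => simp only [mul_add, map_add, h, h']
  | hsmul r' y =>
  rw [smul_mul_assoc, mul_smul_comm, ChebAlg.ofOption_mul]
  have hxy := mulDiagram_eq_anyOne (n := n) (x := x) (y := y)
  simp only [map_smul, coeffOne_ofOption, Option.bind_some, smul_eq_mul, Option.some.injEq]
  by_cases hx : x = anyOne n
  · by_cases hy : y = anyOne n
    · rw [if_pos (hxy.2 ⟨hx, hy⟩), if_pos (congrArg some hx), if_pos (congrArg some hy)]; ring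
    · rw [if_neg (fun h => hy (hxy.1 h).2), if_neg (mt Option.some.inj hy)]; ring
  · rw [if_neg (fun h => hx (hxy.1 h).1), if_neg (mt Option.some.inj hx)]; ring

variable (k)

/-- The character of the algebra that sends the identity diagram on `n` strands to `1` and every
other diagram to `0`. -/
def eps (n : ℕ) : UAlg k →ₐ[k] k :=
  Unitization.lift
    { coeffOne k n with
      map_zero' := map_zero (coeffOne k n)
      map_mul' := coeffOne_mul n }

variable {k}

theorem eps_inr (n : ℕ) (a : ChebAlg k) : eps k n (Unitization.inr a) = coeffOne k n a := by
  simp [eps]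

theorem eps_apply (n : ℕ) (a : UAlg k) : eps k n a = a.fst + coeffOne k n a.snd := by
  rfl

open Classical in
theorem eps_diag (n : ℕ) {a b : ℕ} (d : Diagram a b) :
    eps k n (diag d) = if (⟨a, b, d⟩ : AnyDiagram) = anyOne n then 1 else 0 := by
  rw [diag, eps_inr, coeffOne_ofOption]; simp

theorem eps_idem (n m : ℕ) : eps k n (idem m) = if m = n then 1 else 0 := by
  classical
  rw [idem, eps_diag]
  exact if_congr (anyOne_injective.eq_iff (a := m) (b := n)) rfl rfl

/-- The ideal spanned by the diagrams with at least one return, described as the common kernel of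
the characters `eps`. -/
def rad (k : Type u) [Field k] : Ideal (UAlg k) := ⨅ n, RingHom.ker (eps k n)

theorem mem_rad {a : UAlg k} : a ∈ rad k ↔ ∀ n, eps k n a = 0 := by
  simp [rad, Submodule.mem_iInf, RingHom.mem_ker]

/-- The span of the diagrams with at most `N` endpoints on either side and at least `w` endpoints
on returns. -/
def retFiltration (k : Type u) [Field k] (N w : ℕ) : Submodule k (UAlg k) :=
  Submodule.span k {a | ∃ (n m : ℕ) (d : Diagram n m), n ≤ N ∧ m ≤ N ∧ w ≤ d.returnPoints.card ∧
    a = diag d}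

theorem diag_mul_diag (x : Diagram n m) (y : Diagram m l) :
    (diag x * diag y : UAlg k) =
      Unitization.inr (ChebAlg.ofOption k ((x.comp y).map fun d => ⟨n, l, d⟩)) := by
  rw [diag, diag, ← Unitization.inr_mul, ChebAlg.ofOption_mul]
  simp [mulDiagram_mk]

theorem diag_mul_of_some {x : Diagram n m} {y : Diagram m l} {z : Diagram n l}
    (h : x.comp y = some z) : (diag x * diag y : UAlg k) = diag z := by
  rw [diag_mul_diag, h]; rfl

theorem diag_mul_of_none {x : Diagram n m} {y : Diagram m l}
    (h : x.comp y = none) : (diag x * diag y : UAlg k) = 0 := by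
  rw [diag_mul_diag, h]; rfl

theorem diag_mul_of_ne {m' : ℕ} (x : Diagram n m) (y : Diagram m' l) (h : m' ≠ m) :
    (diag x * diag y : UAlg k) = 0 := by
  rw [diag, diag, ← Unitization.inr_mul, ChebAlg.ofOption_mul]
  simp [mulDiagram, h, ChebAlg.ofOption]

theorem retFiltration_mul {N w w' : ℕ} {a b : UAlg k} (ha : a ∈ retFiltration k N w)
    (hb : b ∈ retFiltration k N w') : a * b ∈ retFiltration k N (w + w') := by
  have : retFiltration k N w * retFiltration k N w' ≤ retFiltration k N (w + w') := by
    rw [retFiltration, retFiltration, Submodule.span_mul_span, Submodule.span_le]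
    rintro _ ⟨_, ⟨n, m, x, hn, hm, hx, rfl⟩, _, ⟨m', l, y, hm', hl, hy, rfl⟩, rfl⟩
    change diag x * diag y ∈ retFiltration k N (w + w')
    by_cases h : m' = m
    · subst h
      rcases e : x.comp y with _ | z
      · rw [diag_mul_of_none e]; exact zero_mem _
      · rw [diag_mul_of_some e]
        exact Submodule.subset_span ⟨_, _, z, hn, hl,
          (add_le_add hx hy).trans (Diagram.card_returnPoints_add_le e), rfl⟩
    · rw [diag_mul_of_ne x y h]; exact zero_mem _
  exact this (Submodule.mul_mem_mul ha hb)

theorem retFiltration_eq_bot (N : ℕ) : retFiltration k N (2 * N + 1) = ⊥ := by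
  rw [retFiltration, Submodule.span_eq_bot]
  rintro _ ⟨n, m, d, hn, hm, hd, rfl⟩
  have := (Finset.card_le_univ d.returnPoints)
  simp only [Fintype.card_sum, Fintype.card_fin] at this
  omega

/-- An element of the common kernel is a combination of diagrams with returns: its scalar part is
read off from an identity diagram that does not occur in it. -/
theorem exists_mem_retFiltration {a : UAlg k} (ha : a ∈ rad k) :
    ∃ N, a ∈ retFiltration k N 1 := by
  classical
  rw [mem_rad] at ha
  induction a using Unitization.ind with
  | inl_add_inr c x =>
  let y : AnyDiagram →₀ k := x
  have hcoef : ∀ n, coeffOne k n x = y (anyOne n) := by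
    intro n
    change Finsupp.linearCombination k _ y = _
    rw [Finsupp.linearCombination_apply, Finsupp.sum]
    simp
    intro h; rw [h]
  have hc : c = 0 := by
    obtain ⟨n, hn⟩ := Set.Infinite.exists_notMem_finset
      (Set.infinite_range_of_injective anyOne_injective) y.support
    obtain ⟨⟨n, rfl⟩, hn⟩ := hn
    have := ha n
    rw [eps_apply] at this
    simpa [hcoef, Finsupp.notMem_support_iff.1 hn] using this
  subst hc
  have hy : ∀ n, y (anyOne n) = 0 := by
    intro n
    have := ha n
    rw [eps_apply] at this
    simpa [hcoef] using this
  refine ⟨y.support.sup fun d => d.1 + d.2.1, ?_⟩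
  have hx : (Unitization.inr x : UAlg k) = ∑ d ∈ y.support, y d • diag d.2.2 := by
    have : x = ∑ d ∈ y.support, y d • ChebAlg.ofOption k (some d) := by
      have h := (Finsupp.sum_single y).symm
      refine h.trans ?_
      rw [Finsupp.sum]
      refine Finset.sum_congr rfl fun d _ => ?_
      change _ = y d • (Finsupp.single d (1 : k) : AnyDiagram →₀ k)
      rw [Finsupp.smul_single, smul_eq_mul, mul_one]
    conv_lhs => rw [this]
    rw [← Unitization.inrHom_apply k, map_sum]
    exact Finset.sum_congr rfl fun d _ => map_smul (Unitization.inrHom k k (ChebAlg k)) _ _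
  rw [Unitization.inl_zero, zero_add, hx]
  refine Submodule.sum_mem _ fun d hd => Submodule.smul_mem _ _ (Submodule.subset_span
    ⟨d.1, d.2.1, d.2.2, ?_, ?_, ?_, rfl⟩)
  · exact (Nat.le_add_right _ _).trans (Finset.le_sup (f := fun d : AnyDiagram => d.1 + d.2.1) hd)
  · exact (Nat.le_add_left _ _).trans (Finset.le_sup (f := fun d : AnyDiagram => d.1 + d.2.1) hd)
  · by_contra h
    have := d.2.2.eq_one_of_returnPoints_eq_empty (Finset.card_eq_zero.1 (by omega))
    rw [Finsupp.mem_support_iff] at hd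
    refine hd ?_
    have h2 : d = anyOne d.1 := this
    rw [h2]; exact hy _

/-- Multiplying diagrams adds up their returns, and a diagram has no more returns than endpoints. -/
theorem isNilpotent_of_mem_rad {a : UAlg k} (ha : a ∈ rad k) : IsNilpotent a := by
  obtain ⟨N, hN⟩ := exists_mem_retFiltration ha
  have : ∀ j, a ^ (j + 1) ∈ retFiltration k N (j + 1) := by
    intro j
    induction j with
    | zero => simpa using hN
    | succ j ih => rw [pow_succ]; exact retFiltration_mul ih hN
  refine ⟨2 * N + 1, ?_⟩
  have h := this (2 * N)
  rwa [retFiltration_eq_bot, Submodule.mem_bot] at h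

theorem rad_le_jacobson : rad k ≤ Ring.jacobson (UAlg k) := by
  rw [Ring.jacobson_eq_sInf_isMaximal]
  refine le_sInf fun I hI a ha => ?_
  have hI : I.IsMaximal := hI
  by_contra h
  obtain ⟨r, i, hi, e⟩ := hI.exists_inv h
  have hu : IsUnit (1 - r * a) :=
    (isNilpotent_of_mem_rad ((rad k).mul_mem_left r ha)).isUnit_one_sub
  rw [← e, add_sub_cancel_left] at hu
  exact hI.ne_top (Ideal.eq_top_of_isUnit_mem _ hi hu)

end Radical

end ChebyshevDiagrams

end

noncomputable section

namespace ChebyshevDiagrams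

variable {k : Type u} [Field k]

/-! ### Unital and finitely generated projective modules -/

section Closure

variable {V W : Type u} [AddCommGroup V] [Module (UAlg k) V] [AddCommGroup W] [Module (UAlg k) W]

theorem IsUnital.of_surjective (f : V →ₗ[UAlg k] W) (hf : Function.Surjective f)
    (h : IsUnital (k := k) V) : IsUnital (k := k) W := by
  intro w
  obtain ⟨v, rfl⟩ := hf w
  have := AddSubgroup.mem_map_of_mem f.toAddMonoidHom (h v)
  rw [AddMonoidHom.map_closure] at this
  refine AddSubgroup.closure_mono ?_ this
  rintro _ ⟨v, ⟨n, hn⟩, rfl⟩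
  exact ⟨n, by change idem n • f v = f v; rw [← map_smul, hn]⟩

theorem IsUnital.induction {p : V → Prop} (h : IsUnital (k := k) V) (v : V) (h0 : p 0)
    (hadd : ∀ v w, p v → p w → p (v + w))
    (hidem : ∀ v (n : ℕ), (idem n : UAlg k) • v = v → p v) : p v := by
  refine AddSubgroup.closure_induction (p := fun v _ => p v ∧ p (-v)) ?_ ?_ ?_ ?_ (h v) |>.1
  · rintro v ⟨n, hn⟩
    exact ⟨hidem v n hn, hidem (-v) n (by rw [smul_neg, hn])⟩
  · simpa using h0
  · rintro v w _ _ ⟨h1, h2⟩ ⟨h3, h4⟩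
    exact ⟨hadd _ _ h1 h3, by rw [neg_add]; exact hadd _ _ h2 h4⟩
  · rintro v _ ⟨h1, h2⟩
    exact ⟨h2, by rwa [neg_neg]⟩

theorem IsUnital.pi {ι : Type*} [Finite ι] {V : ι → Type u} [∀ i, AddCommGroup (V i)]
    [∀ i, Module (UAlg k) (V i)] {W : Type u} [AddCommGroup W] [Module (UAlg k) W]
    (e : W ≃ₗ[UAlg k] Π i, V i) (h : ∀ i, IsUnital (k := k) (V i)) : IsUnital (k := k) W := by
  classical
  cases nonempty_fintype ι
  intro w
  have : w = ∑ i, e.symm (Pi.single i (e w i)) := by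
    rw [← map_sum, Finset.univ_sum_single, e.symm_apply_apply]
  rw [this]
  refine sum_mem fun i _ => ?_
  refine (h i).induction (p := fun v => e.symm (Pi.single i v) ∈ _) (e w i) ?_ ?_ ?_
  · simp
  · intro v w hv hw
    rw [Pi.single_add, map_add]; exact add_mem hv hw
  · intro v n hn
    refine AddSubgroup.subset_closure ⟨n, ?_⟩
    rw [← map_smul, ← Pi.single_smul, hn]

theorem IsUnital.prod (hV : IsUnital (k := k) V) (hW : IsUnital (k := k) W) :
    IsUnital (k := k) (V × W) := by
  rintro ⟨v, w⟩
  have : (v, w) = (v, 0) + (0, w) := by simp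
  rw [this]
  refine add_mem ?_ ?_
  · refine hV.induction (p := fun v => (v, (0 : W)) ∈ _) v (zero_mem _) ?_ ?_
    · intro v v' h h'; simpa using add_mem h h'
    · intro v n hn
      exact AddSubgroup.subset_closure ⟨n, by simp [Prod.smul_mk, hn]⟩
  · refine hW.induction (p := fun w => ((0 : V), w) ∈ _) w (zero_mem _) ?_ ?_
    · intro v v' h h'; simpa using add_mem h h'
    · intro v n hn
      exact AddSubgroup.subset_closure ⟨n, by simp [Prod.smul_mk, hn]⟩

end Closure

/-- Direct summands of finitely generated projective modules are finitely generated projective. -/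
theorem IsFGProj.of_retract {V W : ModuleCat.{u} (UAlg k)} (hV : IsFGProj V)
    (i : W →ₗ[UAlg k] V) (p : V →ₗ[UAlg k] W) (h : p ∘ₗ i = LinearMap.id) : IsFGProj W := by
  have hs : Function.Surjective p := fun w => ⟨i w, LinearMap.congr_fun h w⟩
  have := hV.finite
  have := hV.projective
  exact ⟨hV.unital.of_surjective p hs, Module.Finite.of_surjective p hs,
    Module.Projective.of_split i p h⟩

theorem IsFGProj.of_equiv {V W : ModuleCat.{u} (UAlg k)} (hV : IsFGProj V)
    (e : V ≃ₗ[UAlg k] W) : IsFGProj W :=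
  hV.of_retract e.symm e (by ext; simp)

theorem IsFGProj.of_iso {V W : ModuleCat.{u} (UAlg k)} (hV : IsFGProj V) (e : V ≅ W) :
    IsFGProj W :=
  hV.of_equiv e.toLinearEquiv

theorem IsFGProj.prod {V W : ModuleCat.{u} (UAlg k)} (hV : IsFGProj V) (hW : IsFGProj W) :
    IsFGProj (ModuleCat.of (UAlg k) (V × W)) := by
  have := hV.finite
  have := hV.projective
  have := hW.finite
  have := hW.projective
  exact ⟨hV.unital.prod hW.unital, Module.Finite.prod,
    inferInstanceAs (Module.Projective (UAlg k) (V × W))⟩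

theorem isFGProj_of_subsingleton (V : ModuleCat.{u} (UAlg k)) [Subsingleton V] : IsFGProj V where
  unital v := by rw [Subsingleton.elim v 0]; exact zero_mem _
  finite := inferInstance
  projective := inferInstance

theorem IsFGProj.pi {ι : Type} [Finite ι] {V : ι → Type u} [∀ i, AddCommGroup (V i)]
    [∀ i, Module (UAlg k) (V i)] (h : ∀ i, IsFGProj (ModuleCat.of (UAlg k) (V i))) :
    IsFGProj (ModuleCat.of (UAlg k) (Π i, V i)) := by
  classical
  cases nonempty_fintype ι
  have := fun i => (h i).finite
  have := fun i => (h i).projective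
  exact ⟨IsUnital.pi (LinearEquiv.refl _ _) fun i => (h i).unital, Module.Finite.pi,
    Module.Projective.of_equiv (DFinsupp.linearEquivFunOnFintype (R := UAlg k) (M := V))⟩

/-! ### Multiplicities -/

/-- The one-dimensional module on which a ring element acts through the character `eps k n`; it is
the simple quotient of `P_n`. -/
def Simple (k : Type u) [Field k] (_n : ℕ) : Type u := k

namespace Simple

variable (n : ℕ)

instance : AddCommGroup (Simple k n) := inferInstanceAs (AddCommGroup k)
instance : Module k (Simple k n) := inferInstanceAs (Module k k)
instance : Module.Finite k (Simple k n) := inferInstanceAs (Module.Finite k k)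
instance : Module (UAlg k) (Simple k n) := Module.compHom k (eps k n).toRingHom

theorem smul_def (a : UAlg k) (x : Simple k n) : a • x = (eps k n a • x : k) := rfl

instance : SMulCommClass (UAlg k) k (Simple k n) :=
  ⟨fun a c x => mul_left_comm (eps k n a) c x⟩

end Simple

/-- The multiplicity of `P_n` in a finitely generated projective module `V`, defined as the
dimension of the space of homomorphisms from `V` to the simple quotient of `P_n`. -/
def mult (n : ℕ) (V : Type u) [AddCommGroup V] [Module (UAlg k) V] : ℕ :=
  Module.finrank k (V →ₗ[UAlg k] Simple k n)

section Mult

variable {V W : Type u} [AddCommGroup V] [Module (UAlg k) V] [AddCommGroup W] [Module (UAlg k) W]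

instance finite_hom_simple (n : ℕ) [Module.Finite (UAlg k) V] :
    Module.Finite k (V →ₗ[UAlg k] Simple k n) := by
  obtain ⟨s, hs⟩ := (Module.Finite.fg_top : (⊤ : Submodule (UAlg k) V).FG)
  let ev : (V →ₗ[UAlg k] Simple k n) →ₗ[k] (s → Simple k n) :=
    { toFun := fun θ v => θ v
      map_add' := fun _ _ => rfl
      map_smul' := fun _ _ => rfl }
  refine Module.Finite.of_injective ev fun θ θ' h => ?_
  refine LinearMap.ext_on hs fun v hv => ?_
  exact congrFun h ⟨v, hv⟩

theorem mult_congr (n : ℕ) (e : V ≃ₗ[UAlg k] W) : mult (k := k) n V = mult (k := k) n W :=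
  (LinearEquiv.congrLeft (Simple k n) k e).finrank_eq

theorem mult_prod (n : ℕ) [Module.Finite (UAlg k) V] [Module.Finite (UAlg k) W] :
    mult (k := k) n (V × W) = mult (k := k) n V + mult (k := k) n W := by
  rw [mult, ← (LinearMap.coprodEquiv (M₃ := Simple k n) (R := UAlg k) (M := V) (M₂ := W) k).finrank_eq,
    Module.finrank_prod]
  rfl

theorem mult_subsingleton (n : ℕ) [Subsingleton V] : mult (k := k) n V = 0 :=
  Module.finrank_zero_of_subsingleton

theorem mult_pi {ι : Type} [Fintype ι] (n : ℕ) (V : Type u) [AddCommGroup V]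
    [Module (UAlg k) V] [Module.Finite (UAlg k) V] :
    mult (k := k) n (ι → V) = Fintype.card ι * mult (k := k) n V := by
  classical
  have e : (ι → V →ₗ[UAlg k] Simple k n) ≃ₗ[k] ((ι → V) →ₗ[UAlg k] Simple k n) :=
    LinearMap.lsum (UAlg k) (fun _ : ι => V) k
  rw [mult, ← e.finrank_eq, Module.finrank_pi_fintype]
  simp [mult]

/-- A homomorphism out of `P_m` is determined by the image of the generator `1_m`. -/
theorem hom_P_ext {m : ℕ} {f g : P k m →ₗ[UAlg k] V} (h : f (genP k m) = g (genP k m)) :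
    f = g := by
  ext x
  have : x = (x : UAlg k) • genP k m := Subtype.ext (mem_P.1 x.2).symm
  rw [this, map_smul, map_smul, h]

theorem idem_smul_genP (m : ℕ) : (idem m : UAlg k) • genP k m = genP k m :=
  Subtype.ext (idem_mul_idem m)

/-- The homomorphism `P_m → V` that sends the generator `1_m` to `1_m v`. -/
def homP (m : ℕ) (v : V) : P k m →ₗ[UAlg k] V :=
  LinearMap.toSpanSingleton (UAlg k) V v ∘ₗ (P k m).subtype

theorem homP_genP {m : ℕ} (v : V) : homP m v (genP k m) = (idem m : UAlg k) • v := rfl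

theorem mult_P (n m : ℕ) : mult (k := k) n (P k m) = if m = n then 1 else 0 := by
  split_ifs with h
  · subst h
    let e : (P k m →ₗ[UAlg k] Simple k m) ≃ₗ[k] k :=
      { toFun := fun θ => θ (genP k m)
        invFun := fun c => homP m (c : Simple k m)
        map_add' := fun _ _ => rfl
        map_smul' := fun _ _ => rfl
        left_inv := fun θ => hom_P_ext (by
          rw [homP_genP, ← map_smul, idem_smul_genP])
        right_inv := fun c => by
          change (eps k m (idem m) • c : k) = c
          rw [eps_idem, if_pos rfl, one_smul] }
    rw [mult, e.finrank_eq, Module.finrank_self]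
  · have : Subsingleton (P k m →ₗ[UAlg k] Simple k n) := ⟨fun f g => hom_P_ext (by
      rw [← idem_smul_genP, map_smul, map_smul, Simple.smul_def, Simple.smul_def, eps_idem,
        if_neg h, zero_smul, zero_smul])⟩
    exact Module.finrank_zero_of_subsingleton

/-! ### Decomposition of finitely generated projective modules -/

theorem mul_idem_sub_mem_rad (a : UAlg k) (n : ℕ) :
    a * idem n - algebraMap k (UAlg k) (eps k n a) * idem n ∈ rad k := by
  rw [mem_rad]
  intro m
  rw [map_sub, map_mul, map_mul, eps_idem, AlgHom.commutes]
  split_ifs with h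
  · subst h; simp
  · simp

/-- A nonzero finitely generated unital module has a nonzero map to one of the modules
`Simple k n`: by Nakayama's lemma it differs from its product with the radical. -/
theorem exists_hom_simple_ne_zero [Nontrivial V] [Module.Finite (UAlg k) V]
    (hV : IsUnital (k := k) V) : ∃ (n : ℕ) (θ : V →ₗ[UAlg k] Simple k n), θ ≠ 0 := by
  have hlt : rad k • (⊤ : Submodule (UAlg k) V) ≠ ⊤ := by
    intro h
    have := Submodule.FG.eq_bot_of_le_jacobson_smul (Module.Finite.fg_top (R := UAlg k) (M := V))
      (h.ge.trans (Submodule.smul_mono_left rad_le_jacobson))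
    exact bot_ne_top this.symm
  have hex : ∃ (n : ℕ) (v : V), (idem n : UAlg k) • v ∉ rad k • (⊤ : Submodule (UAlg k) V) := by
    by_contra! hc
    refine hlt (eq_top_iff.2 fun v _ => ?_)
    refine hV.induction (p := fun v => v ∈ rad k • (⊤ : Submodule (UAlg k) V)) v (zero_mem _)
      (fun _ _ => add_mem) ?_
    intro v n hn
    rw [← hn]; exact hc n v
  obtain ⟨n, v, hv⟩ := hex
  let : Module k V := Module.compHom V (algebraMap k (UAlg k))
  have hk : ∀ (c : k) (v : V), c • v = algebraMap k (UAlg k) c • v := fun _ _ => rfl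
  let R : Submodule k V :=
    { carrier := (rad k • (⊤ : Submodule (UAlg k) V) : Submodule (UAlg k) V)
      add_mem' := add_mem
      zero_mem' := zero_mem _
      smul_mem' := fun c v hv => by rw [hk]; exact Submodule.smul_mem _ _ hv }
  -- a functional that vanishes on `rad V` but not at `1_n v` becomes a module map after `1_n`
  obtain ⟨g, hg, hgR⟩ := Submodule.exists_le_ker_of_notMem (p := R) hv
  have hg0 : ∀ w ∈ rad k • (⊤ : Submodule (UAlg k) V), g w = 0 := fun w hw => hgR hw
  let θ : V →ₗ[UAlg k] Simple k n :=
    { toFun := fun w => g ((idem n : UAlg k) • w)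
      map_add' := fun a b => by rw [smul_add, map_add]; rfl
      map_smul' := fun a w => by
        change g ((idem n : UAlg k) • a • w) = eps k n a • g ((idem n : UAlg k) • w)
        have h1 : (idem n * a - algebraMap k (UAlg k) (eps k n a) * idem n : UAlg k) ∈ rad k := by
          rw [mem_rad]
          intro m
          rw [map_sub, map_mul, map_mul, eps_idem, AlgHom.commutes]
          split_ifs with h
          · subst h; simp
          · simp
        have h2 := hg0 _ (Submodule.smul_mem_smul h1 (Submodule.mem_top (x := w)))
        rw [sub_smul, map_sub, sub_eq_zero, mul_smul, mul_smul, ← hk,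
          map_smul g (eps k n a)] at h2
        exact h2 }
  refine ⟨n, θ, fun h => hg ?_⟩
  exact LinearMap.congr_fun h v

/-- A map to `P_n` whose composition with the projection to the simple quotient is nonzero is
surjective, the radical being superfluous. -/
theorem surjective_of_eps_ne_zero {n : ℕ} (f : V →ₗ[UAlg k] P k n) (v : V)
    (hv : eps k n (f v : UAlg k) ≠ 0) : Function.Surjective f := by
  rw [← LinearMap.range_eq_top]
  let N := LinearMap.range f
  let W := P k n ⧸ N
  have hfin : Module.Finite (UAlg k) (P k n) := Module.Finite.span_singleton _ _
  have hle : (⊤ : Submodule (UAlg k) W) ≤ Ring.jacobson (UAlg k) • (⊤ : Submodule (UAlg k) W) := by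
    refine le_trans ?_ (Submodule.smul_mono_left rad_le_jacobson)
    have hgen : N.mkQ (genP k n) ∈ rad k • (⊤ : Submodule (UAlg k) W) := by
      let c := eps k n (f v : UAlg k)
      have h1 := mul_idem_sub_mem_rad (f v : UAlg k) n
      have h2 : (f v : UAlg k) * idem n = (f v : UAlg k) := mem_P.1 (f v).2
      rw [h2] at h1
      -- `f v` equals `c` times the generator modulo the radical, with `c` invertible
      have h3 : genP k n = algebraMap k (UAlg k) c⁻¹ • f v - algebraMap k (UAlg k) c⁻¹ •
          (((f v : UAlg k) - algebraMap k (UAlg k) c * idem n) • genP k n) := by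
        apply Subtype.ext
        change idem n = algebraMap k (UAlg k) c⁻¹ * (f v : UAlg k) - algebraMap k (UAlg k) c⁻¹ *
          (((f v : UAlg k) - algebraMap k (UAlg k) c * idem n) * idem n)
        rw [sub_mul, h2, mul_sub, sub_sub_cancel, mul_assoc, idem_mul_idem, ← mul_assoc, ← map_mul,
          inv_mul_cancel₀ hv, map_one, one_mul]
      rw [h3, map_sub, map_smul, map_smul, map_smul]
      have h4 : N.mkQ (f v) = 0 := by
        rw [Submodule.mkQ_apply, Submodule.Quotient.mk_eq_zero]
        exact ⟨v, rfl⟩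
      rw [h4, smul_zero, zero_sub]
      exact neg_mem (Submodule.smul_mem _ _ (Submodule.smul_mem_smul h1 Submodule.mem_top))
    intro w _
    obtain ⟨x, rfl⟩ := N.mkQ_surjective w
    have : x = (x : UAlg k) • genP k n := Subtype.ext (mem_P.1 x.2).symm
    rw [this, map_smul]
    exact Submodule.smul_mem _ _ hgen
  have := Submodule.FG.eq_bot_of_le_jacobson_smul
    (Module.Finite.fg_top (R := UAlg k) (M := W)) hle
  have hs : Subsingleton W := (Submodule.subsingleton_iff (UAlg k)).1
    (subsingleton_of_bot_eq_top this.symm)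
  exact Submodule.Quotient.subsingleton_iff.1 hs

/-- Splitting off a projective quotient. -/
def equivKerProd {U : Type u} [AddCommGroup U] [Module (UAlg k) U]
    (f : V →ₗ[UAlg k] U) (g : U →ₗ[UAlg k] V) (h : f ∘ₗ g = LinearMap.id) :
    V ≃ₗ[UAlg k] U × LinearMap.ker f where
  toFun v := (f v, ⟨v - g (f v), by
    have := LinearMap.congr_fun h (f v)
    rw [LinearMap.mem_ker, map_sub, sub_eq_zero]
    exact this.symm⟩)
  invFun x := x.2 + g x.1
  map_add' v w := by
    refine Prod.ext (map_add _ _ _) (Subtype.ext ?_)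
    simp only [map_add, Prod.snd_add, Submodule.coe_add]; abel
  map_smul' a v := by
    refine Prod.ext (map_smul _ _ _) (Subtype.ext ?_)
    simp [smul_sub]
  left_inv v := by simp
  right_inv x := by
    obtain ⟨u, v, hv⟩ := x
    have h1 : f (g u) = u := LinearMap.congr_fun h u
    have h2 : f v = 0 := hv
    refine Prod.ext ?_ (Subtype.ext ?_) <;> simp [h1, h2]

end Mult

/-- Each of the finitely many generators is killed by almost all idempotents `1_n`, so that only
finitely many multiplicities are nonzero. -/
theorem exists_forall_hom_simple_eq_zero {V : Type u} [AddCommGroup V] [Module (UAlg k) V]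
    [Module.Finite (UAlg k) V] (hV : IsUnital (k := k) V) :
    ∃ N : ℕ, ∀ n, N ≤ n → ∀ θ : V →ₗ[UAlg k] Simple k n, θ = 0 := by
  have h1 : ∀ v : V, ∃ N : ℕ, ∀ n, N ≤ n → (idem n : UAlg k) • v = 0 := by
    intro v
    refine hV.induction (p := fun v => ∃ N : ℕ, ∀ n, N ≤ n → (idem n : UAlg k) • v = 0) v
      ⟨0, fun _ _ => smul_zero _⟩ ?_ ?_
    · rintro v w ⟨N, hN⟩ ⟨N', hN'⟩
      exact ⟨max N N', fun n hn => by
        rw [smul_add, hN n ((le_max_left _ _).trans hn), hN' n ((le_max_right _ _).trans hn),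
          add_zero]⟩
    · intro v m hm
      refine ⟨m + 1, fun n hn => ?_⟩
      rw [← hm, ← mul_smul, idem, idem, diag_mul_of_ne _ _ (by omega), zero_smul]
  choose N hN using h1
  obtain ⟨s, hs⟩ := (Module.Finite.fg_top : (⊤ : Submodule (UAlg k) V).FG)
  refine ⟨s.sup N, fun n hn θ => LinearMap.ext_on hs fun v hv => ?_⟩
  have h2 := hN v n ((Finset.le_sup hv).trans hn)
  have h3 : (idem n : UAlg k) • θ v = θ v := by
    rw [Simple.smul_def, eps_idem, if_pos rfl, one_smul]
  rw [← h3, ← map_smul, h2, map_zero]; rfl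

/-- Every nonzero finitely generated projective module has some `P_n` as a direct summand, and
splitting off such summands ends after finitely many steps. -/
theorem IsFGProj.induction {motive : ModuleCat.{u} (UAlg k) → Prop}
    (h0 : ∀ V : ModuleCat.{u} (UAlg k), Subsingleton V → motive V)
    (h1 : ∀ (V W : ModuleCat.{u} (UAlg k)) (n : ℕ), IsFGProj W → (V ≃ₗ[UAlg k] P k n × W) →
      motive W → motive V) {V : ModuleCat.{u} (UAlg k)} (hV : IsFGProj V) : motive V := by
  have := hV.finite
  obtain ⟨N, hN⟩ := exists_forall_hom_simple_eq_zero hV.unital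
  induction hd : ∑ n ∈ Finset.range N, mult (k := k) n V using Nat.strong_induction_on
    generalizing V with
  | _ d ih =>
  rcases subsingleton_or_nontrivial V with hs | hs
  · exact h0 V hs
  obtain ⟨n, θ, hθ⟩ := exists_hom_simple_ne_zero hV.unital
  have hn : n < N := by
    by_contra h
    exact hθ (hN n (by omega) θ)
  obtain ⟨v, hv⟩ : ∃ v, θ v ≠ 0 := by
    by_contra! h
    exact hθ (LinearMap.ext h)
  have hproj := hV.projective
  let π : P k n →ₗ[UAlg k] Simple k n := homP n ((1 : k) : Simple k n)
  have hπ : ∀ x : P k n, π x = eps k n (x : UAlg k) := fun x => mul_one (eps k n (x : UAlg k))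
  have hπs : Function.Surjective π := by
    intro c
    refine ⟨algebraMap k (UAlg k) c • genP k n, ?_⟩
    rw [hπ]
    have h : ∀ c : k, eps k n (algebraMap k (UAlg k) c * idem n) = c := fun c => by
      rw [map_mul, AlgHom.commutes, eps_idem, if_pos rfl, mul_one]; rfl
    exact h c
  -- the lift of `θ` along `P_n → Simple k n` is surjective, hence split
  obtain ⟨f, hf⟩ := Module.projective_lifting_property π θ hπs
  have hfs : Function.Surjective f := surjective_of_eps_ne_zero f v (by
    rw [← hπ]; exact (LinearMap.congr_fun hf v).trans_ne hv)
  have := (isFGProj_P (k := k) n).projective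
  have := (isFGProj_P (k := k) n).finite
  obtain ⟨g, hg⟩ := LinearMap.exists_rightInverse_of_surjective (P := P k n) f
    (LinearMap.range_eq_top.2 hfs)
  let e := equivKerProd f g hg
  let W : ModuleCat.{u} (UAlg k) := ModuleCat.of (UAlg k) (LinearMap.ker f)
  have hW : IsFGProj W := hV.of_retract (W := W) (LinearMap.ker f).subtype
    (LinearMap.snd _ _ _ ∘ₗ e.toLinearMap) (by
      ext x
      have : f x = 0 := x.2
      change (x : V) - g (f x) = x
      rw [this, map_zero, sub_zero])
  have hWfin : Module.Finite (UAlg k) (LinearMap.ker f) := hW.finite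
  refine h1 V W n hW e (ih _ ?_ hW hW.finite ?_ rfl)
  · rw [← hd]
    have hm : ∀ m, mult (k := k) m V = mult (k := k) m (P k n) + mult (k := k) m W := fun m => by
      rw [mult_congr m e, mult_prod]
    refine Finset.sum_lt_sum (fun m _ => by rw [hm]; omega) ⟨n, Finset.mem_range.2 hn, ?_⟩
    rw [hm, mult_P, if_pos rfl]; omega
  · intro m hmN θ
    have h2 := hN m hmN (θ ∘ₗ LinearMap.snd _ _ _ ∘ₗ e.toLinearMap)
    ext x
    have h3 := LinearMap.congr_fun h2 (e.symm (0, x))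
    simpa using h3

/-! ### The Grothendieck group of projectives -/

namespace K0

theorem mk_eq_add {V V₁ V₂ : FGProj k} (e : V.1 ≃ₗ[UAlg k] V₁.1 × V₂.1) :
    mk V = mk V₁ + mk V₂ := by
  have : (QuotientAddGroup.mk (FreeAbelianGroup.of V - FreeAbelianGroup.of V₁ -
      FreeAbelianGroup.of V₂) : K0 k) = 0 :=
    (QuotientAddGroup.eq_zero_iff _).2 (AddSubgroup.subset_closure ⟨V, V₁, V₂, ⟨e⟩, rfl⟩)
  have h2 : mk V - mk V₁ - mk V₂ = 0 := this
  rw [sub_sub, sub_eq_zero] at h2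
  exact h2

theorem mk_eq_zero (V : FGProj k) [Subsingleton V.1] : mk V = 0 := by
  have e : V.1 ≃ₗ[UAlg k] V.1 × V.1 :=
    { (0 : V.1 →ₗ[UAlg k] V.1 × V.1) with
      invFun := 0
      left_inv := fun _ => Subsingleton.elim _ _
      right_inv := fun _ => Subsingleton.elim _ _ }
  simpa using mk_eq_add e

/-- The universal property of the Grothendieck group. -/
def lift {A : Type*} [AddCommGroup A] (f : FGProj k → A)
    (hf : ∀ V V₁ V₂ : FGProj k, (V.1 ≃ₗ[UAlg k] V₁.1 × V₂.1) → f V = f V₁ + f V₂) : K0 k →+ A :=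
  QuotientAddGroup.lift _ (FreeAbelianGroup.lift f) <| by
    rw [AddSubgroup.closure_le]
    rintro _ ⟨V, V₁, V₂, ⟨e⟩, rfl⟩
    simp [hf V V₁ V₂ e]

theorem lift_mk {A : Type*} [AddCommGroup A] (f : FGProj k → A)
    (hf : ∀ V V₁ V₂ : FGProj k, (V.1 ≃ₗ[UAlg k] V₁.1 × V₂.1) → f V = f V₁ + f V₂) (V : FGProj k) :
    lift f hf (mk V) = f V :=
  FreeAbelianGroup.lift_apply_of _ _

theorem induction {p : K0 k → Prop} (z : K0 k) (hmk : ∀ V, p (mk V)) (h0 : p 0)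
    (hneg : ∀ a, p a → p (-a)) (hadd : ∀ a b, p a → p b → p (a + b)) : p z := by
  induction z using QuotientAddGroup.induction_on with
  | H z =>
  induction z using FreeAbelianGroup.induction_on with
  | zero => exact h0
  | of V => exact hmk V
  | neg V h => exact hneg _ h
  | add x y hx hy => exact hadd _ _ hx hy

variable (k)

/-- The multiplicity of `P_n` as a functional on the Grothendieck group. -/
def multHom (n : ℕ) : K0 k →+ ℤ :=
  lift (fun V => (mult (k := k) n V.1 : ℤ)) fun V V₁ V₂ e => by
    have := V₁.2.finite
    have := V₂.2.finite
    rw [mult_congr n e, mult_prod, Nat.cast_add]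

variable {k}

theorem multHom_mk (n : ℕ) (V : FGProj k) : multHom k n (mk V) = mult (k := k) n V.1 :=
  lift_mk _ _ _

variable (k)

/-- The homomorphism `ℤ[x] → K_0` with `x^n ↦ [P_n]`. -/
def ofPolynomial : ℤ[X] →+ K0 k where
  toFun p := p.sum fun n c => c • mk (projP k n)
  map_zero' := Polynomial.sum_zero_index _
  map_add' p q := Polynomial.sum_add_index p q _ (fun _ => zero_smul _ _) fun _ _ _ => add_smul _ _ _

theorem ofPolynomial_monomial (n : ℕ) (c : ℤ) :
    ofPolynomial k (monomial n c) = c • mk (projP k n) :=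
  Polynomial.sum_monomial_index c (fun n c => c • mk (projP k n)) (zero_smul _ _)

theorem multHom_ofPolynomial (n : ℕ) (p : ℤ[X]) : multHom k n (ofPolynomial k p) = p.coeff n := by
  induction p using Polynomial.induction_on' with
  | add p q hp hq => rw [map_add, map_add, hp, hq, coeff_add]
  | monomial m c =>
    have h : mult (k := k) n (projP k m).1 = if m = n then 1 else 0 := mult_P n m
    rw [ofPolynomial_monomial, map_zsmul, multHom_mk, h, coeff_monomial]
    split_ifs <;> simp

theorem ofPolynomial_surjective : Function.Surjective (ofPolynomial k) := by
  intro z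
  have hr : ∀ V : FGProj k, mk V ∈ (ofPolynomial k).range := by
    rintro ⟨V, hV⟩
    suffices h : ∀ hV, mk ⟨V, hV⟩ ∈ (ofPolynomial k).range from h hV
    refine hV.induction (motive := fun V => ∀ hV, mk ⟨V, hV⟩ ∈ (ofPolynomial k).range) ?_ ?_
    · intro V hs hV
      have : Subsingleton (⟨V, hV⟩ : FGProj k).1 := hs
      rw [mk_eq_zero]; exact zero_mem _
    · intro V W n hW e ih hV
      rw [mk_eq_add (V := ⟨V, hV⟩) (V₁ := projP k n) (V₂ := ⟨W, hW⟩) e]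
      refine add_mem ⟨monomial n 1, ?_⟩ (ih hW)
      rw [ofPolynomial_monomial, one_smul]
  refine z.induction (p := fun z => z ∈ (ofPolynomial k).range) hr (zero_mem _)
    (fun _ => neg_mem) fun _ _ => add_mem

/-- The isomorphism `K_0 ≅ ℤ[x]`: the classes `[P_n]` generate, and they are independent because
the multiplicities separate them. -/
def equivPolynomial : K0 k ≃+ ℤ[X] :=
  (AddEquiv.ofBijective (ofPolynomial k) ⟨fun p q h => Polynomial.ext fun n => by
    rw [← multHom_ofPolynomial k, h, multHom_ofPolynomial], ofPolynomial_surjective k⟩).symm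

theorem equivPolynomial_mk_projP (n : ℕ) : equivPolynomial k (mk (projP k n)) = X ^ n := by
  rw [equivPolynomial, AddEquiv.symm_apply_eq, ← monomial_one_right_eq_X_pow]
  exact ((ofPolynomial_monomial k n 1).trans (one_smul _ _)).symm

variable {k}

theorem coeff_equivPolynomial (z : K0 k) (n : ℕ) :
    (equivPolynomial k z).coeff n = multHom k n z := by
  obtain ⟨p, rfl⟩ := ofPolynomial_surjective k z
  rw [multHom_ofPolynomial]
  congr 1
  exact (equivPolynomial k).apply_symm_apply p

theorem ext_multHom {z w : K0 k} (h : ∀ n, multHom k n z = multHom k n w) : z = w :=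
  (equivPolynomial k).injective <| Polynomial.ext fun n => by
    rw [coeff_equivPolynomial, coeff_equivPolynomial, h]

end K0

end ChebyshevDiagrams

end

noncomputable section

namespace ChebyshevDiagrams

variable {n m l s : ℕ}

/-! ### Stacking of diagrams -/

section Stack

theorem Diagram.one_stack_one (n m : ℕ) : (one n).stack (one m) = one (n + m) := by
  ext1
  funext a
  rcases a with a | a <;> induction a using Fin.addCases <;>
    simp [stack, stackPartner, one]

variable {n' m' l' : ℕ}

theorem composable_stack (x : Diagram n m) (y : Diagram m l) (x' : Diagram n' m')
    (y' : Diagram m' l') : Composable (x.stack x') (y.stack y') ↔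
      Composable x y ∧ Composable x' y' := by
  constructor
  · intro h
    refine ⟨fun j j' j'' ⟨e, e'⟩ => ?_, fun j j' j'' ⟨e, e'⟩ => ?_⟩
    · exact h (Fin.castAdd _ j) (Fin.castAdd _ j') (Fin.castAdd _ j'')
        ⟨by simp [Diagram.stack, stackPartner, e], by simp [Diagram.stack, stackPartner, e']⟩
    · exact h (Fin.natAdd _ j) (Fin.natAdd _ j') (Fin.natAdd _ j'')
        ⟨by simp [Diagram.stack, stackPartner, e], by simp [Diagram.stack, stackPartner, e']⟩
  · rintro ⟨h, h'⟩ j j' j'' ⟨e, e'⟩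
    induction j using Fin.addCases with
    | left j =>
      simp only [Diagram.stack, stackPartner, Fin.addCases_left] at e e'
      rcases e1 : x.partner (Sum.inr j) with a | a <;>
        rcases e2 : y.partner (Sum.inl j) with b | b <;> simp [e1, e2] at e e'
      exact h _ _ _ ⟨e1, e2⟩
    | right j =>
      simp only [Diagram.stack, stackPartner, Fin.addCases_right] at e e'
      rcases e1 : x'.partner (Sum.inr j) with a | a <;>
        rcases e2 : y'.partner (Sum.inl j) with b | b <;> simp [e1, e2] at e e'
      exact h' _ _ _ ⟨e1, e2⟩

theorem concat_stack (x : Diagram n m) (y : Diagram m l) (x' : Diagram n' m')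
    (y' : Diagram m' l') (h : Composable x y) (h' : Composable x' y')
    (hs : Composable (x.stack x') (y.stack y')) :
    (x.stack x').concat (y.stack y') hs = (x.concat y h).stack (x'.concat y' h') := by
  ext1
  funext a
  rcases a with a | a <;> induction a using Fin.addCases with
  | left a =>
    simp only [Diagram.stack, Diagram.concat, stackPartner, concatPartner, Fin.addCases_left]
    grind [Sum.map]
  | right a =>
    simp only [Diagram.stack, Diagram.concat, stackPartner, concatPartner, Fin.addCases_right]
    grind [Sum.map]

/-- The interchange law for concatenation and stacking. -/
theorem stack_comp_stack (x : Diagram n m) (y : Diagram m l) (x' : Diagram n' m')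
    (y' : Diagram m' l') : (x.stack x').comp (y.stack y') =
      (x.comp y).bind fun u => (x'.comp y').map fun v => u.stack v := by
  have H := composable_stack x y x' y'
  unfold Diagram.comp
  by_cases h : Composable x y
  · by_cases h' : Composable x' y'
    · rw [dif_pos (H.2 ⟨h, h'⟩), dif_pos h, dif_pos h', concat_stack x y x' y' h h']
      rfl
    · rw [dif_neg (fun hs => h' (H.1 hs).2), dif_neg h', dif_pos h]; rfl
  · rw [dif_neg (fun hs => h (H.1 hs).1), dif_neg h]; rfl

end Stack

section Tensor

open scoped ModuleCat

variable {k : Type u} [Field k]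

/-- `P_m` is spanned over the field by the diagrams with `m` right endpoints. -/
theorem mem_span_of_mem_P {x : UAlg k} (hx : x ∈ P k m) :
    x ∈ Submodule.span k {a : UAlg k | ∃ (c : ℕ) (d : Diagram c m), a = diag d} := by
  rw [mem_P] at hx
  rw [← hx]
  induction x using Unitization.ind with
  | inl_add_inr c a =>
  rw [add_mul]
  refine add_mem ?_ ?_
  · have hc : (Unitization.inl c : UAlg k) = algebraMap k (UAlg k) c := rfl
    rw [hc, ← Algebra.smul_def]
    exact Submodule.smul_mem _ _ (Submodule.subset_span ⟨m, Diagram.one m, rfl⟩)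
  · clear hx
    induction a using ChebAlg.induction_on with
    | h0 => simp
    | hadd a b ha hb => rw [Unitization.inr_add, add_mul]; exact add_mem ha hb
    | hsmul c d =>
      obtain ⟨p, q, d⟩ := d
      rw [Unitization.inr_smul, smul_mul_assoc]
      refine Submodule.smul_mem _ _ ?_
      change diag d * diag (Diagram.one m) ∈ _
      by_cases h : m = q
      · subst h
        refine Submodule.subset_span ⟨p, d, ?_⟩
        exact diag_mul_idem d
      · rw [diag_mul_of_ne _ _ h]; exact zero_mem _

/-- `1_c P_m` is spanned over the field by the diagrams with `c` left and `m` right endpoints. -/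
theorem mem_span_of_mem_P_of_idem_mul {c : ℕ} {x : UAlg k} (hx : x ∈ P k m)
    (hc : idem c * x = x) : x ∈ Submodule.span k (Set.range (diag (k := k) (n := c) (m := m))) := by
  rw [← hc]
  refine Submodule.span_induction (p := fun x _ => idem c * x ∈ Submodule.span k
    (Set.range (diag (k := k) (n := c) (m := m)))) ?_ ?_ ?_ ?_ (mem_span_of_mem_P hx)
  · rintro _ ⟨p, d, rfl⟩
    by_cases h : p = c
    · subst h
      rw [idem_mul_diag]; exact Submodule.subset_span ⟨d, rfl⟩
    · rw [idem, diag_mul_of_ne _ _ h]; exact zero_mem _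
  · rw [mul_zero]; exact zero_mem _
  · intro x y _ _ hx hy; rw [mul_add]; exact add_mem hx hy
  · intro r x _ hx; rw [mul_smul_comm]; exact Submodule.smul_mem _ _ hx

/-- The linear map on the algebra with given values on the diagrams that kills the adjoined
unit. -/
def liftDiag {X : Type*} [AddCommGroup X] [Module k X] (f : AnyDiagram → X) : UAlg k →ₗ[k] X :=
  LinearMap.comp (Finsupp.linearCombination k f : ChebAlg k →ₗ[k] X)
    (Unitization.sndHom k k (ChebAlg k))

theorem liftDiag_diag {X : Type*} [AddCommGroup X] [Module k X] (f : AnyDiagram → X)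
    (d : Diagram n m) : liftDiag f (diag d : UAlg k) = f ⟨n, m, d⟩ :=
  (Finsupp.linearCombination_single k _ _).trans (one_smul _ _)

variable (k)

/-- The vertical stacking of diagrams, extended bilinearly. -/
def stackHom : UAlg k →ₗ[k] UAlg k →ₗ[k] UAlg k :=
  liftDiag fun x => liftDiag fun y => diag (x.2.2.stack y.2.2)

variable {k}

theorem stackHom_diag {n' m' : ℕ} (x : Diagram n m) (y : Diagram n' m') :
    stackHom k (diag x) (diag y) = diag (x.stack y) := by
  rw [stackHom, liftDiag_diag, liftDiag_diag]

theorem diag_stack_mul {a b c d p q : ℕ} (α : Diagram a c) (β : Diagram b d) (x : Diagram c p)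
    (y : Diagram d q) : (diag (α.stack β) * diag (x.stack y) : UAlg k) =
      stackHom k (diag α * diag x) (diag β * diag y) := by
  have h := stack_comp_stack α x β y
  rcases e : α.comp x with _ | u
  · rw [e] at h
    rw [diag_mul_of_none h, diag_mul_of_none e, map_zero, LinearMap.zero_apply]
  · rcases e' : β.comp y with _ | v
    · rw [e, e'] at h
      rw [diag_mul_of_none h, diag_mul_of_none e', map_zero]
    · rw [e, e'] at h
      rw [diag_mul_of_some h, diag_mul_of_some e, diag_mul_of_some e', stackHom_diag]

theorem stackHom_mem_P {a b : ℕ} {v w : UAlg k} (hv : v ∈ P k a) (hw : w ∈ P k b) :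
    stackHom k v w ∈ P k (a + b) := by
  refine Submodule.span_induction (p := fun v _ => stackHom k v w ∈ P k (a + b)) ?_ ?_ ?_ ?_
    (mem_span_of_mem_P hv)
  · rintro _ ⟨c, α, rfl⟩
    refine Submodule.span_induction (p := fun w _ => stackHom k (diag α) w ∈ P k (a + b)) ?_ ?_ ?_ ?_
      (mem_span_of_mem_P hw)
    · rintro _ ⟨d, β, rfl⟩
      rw [stackHom_diag, mem_P, diag_mul_idem]
    · rw [map_zero]; exact zero_mem _
    · intro x y _ _ hx hy; rw [map_add]; exact add_mem hx hy
    · intro r x _ hx; rw [map_smul]; exact (P k (a + b)).smul_of_tower_mem r hx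
  · rw [map_zero]; exact zero_mem _
  · intro x y _ _ hx hy; rw [map_add]; exact add_mem hx hy
  · intro r x _ hx; rw [map_smul]; exact (P k (a + b)).smul_of_tower_mem r hx

theorem diag_stack_mul_stackHom {a b c d p q : ℕ} (α : Diagram a c) (β : Diagram b d)
    {v w : UAlg k} (hv : v ∈ P k p) (hw : w ∈ P k q) (hcv : idem c * v = v)
    (hdw : idem d * w = w) :
    diag (α.stack β) * stackHom k v w = stackHom k (diag α * v) (diag β * w) := by
  refine Submodule.span_induction (p := fun v _ => diag (α.stack β) * stackHom k v w =
    stackHom k (diag α * v) (diag β * w)) ?_ ?_ ?_ ?_ (mem_span_of_mem_P_of_idem_mul hv hcv)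
  · rintro _ ⟨x, rfl⟩
    refine Submodule.span_induction (p := fun w _ => diag (α.stack β) * stackHom k (diag x) w =
      stackHom k (diag α * diag x) (diag β * w)) ?_ ?_ ?_ ?_ (mem_span_of_mem_P_of_idem_mul hw hdw)
    · rintro _ ⟨y, rfl⟩
      rw [stackHom_diag, diag_stack_mul]
    · simp
    · intro x y _ _ hx hy; simp only [map_add, mul_add, hx, hy]
    · intro r x _ hx; simp only [map_smul, mul_smul_comm, hx]
  · simp
  · intro x y _ _ hx hy; simp only [map_add, mul_add, hx, hy, LinearMap.add_apply]
  · intro r x _ hx; simp only [map_smul, mul_smul_comm, hx, LinearMap.smul_apply]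

/-! ### The tensor product of modules -/

variable {V V' W W' U : ModuleCat.{u} (UAlg k)}

theorem tensorMk_eq_smul (x : UAlg k) (v : V) (w : W) :
    tensorMk x v w = x • tensorMk (V := V) (W := W) 1 v w := by
  have : x ⊗ₜ[k] (v ⊗ₜ[k] w) = x • ((1 : UAlg k) ⊗ₜ[k] (v ⊗ₜ[k] w)) := by
    rw [TensorProduct.smul_tmul', smul_eq_mul, mul_one]
  rw [tensorMk, this]; rfl

/-- The defining relation of the tensor product. -/
theorem diag_stack_smul_tensorMk {a b c d : ℕ} (α : Diagram a c) (β : Diagram b d) (v : V) (w : W)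
    (hv : (idem c : UAlg k) • v = v) (hw : (idem d : UAlg k) • w = w) :
    (diag (α.stack β) : UAlg k) • tensorMk (V := V) (W := W) 1 v w =
      tensorMk 1 ((diag α : UAlg k) • v) ((diag β : UAlg k) • w) := by
  rw [← tensorMk_eq_smul]
  exact (Submodule.Quotient.eq _).2 (Submodule.subset_span ⟨a, b, c, d, α, β, v, w, hv, hw, rfl⟩)

variable (V W) in
/-- The universal bilinear map. -/
def tensorMkHom : V →ₗ[k] W →ₗ[k] tensor V W :=
  LinearMap.mk₂ k (fun v w => tensorMk 1 v w)
    (fun v v' w => by rw [tensorMk, TensorProduct.add_tmul, TensorProduct.tmul_add]; rfl)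
    (fun c v w => by
      rw [tensorMk, ← TensorProduct.smul_tmul', TensorProduct.tmul_smul, TensorProduct.smul_tmul',
        Algebra.smul_def, mul_one]
      exact tensorMk_eq_smul _ v w)
    (fun v w w' => by rw [tensorMk, TensorProduct.tmul_add, TensorProduct.tmul_add]; rfl)
    (fun c v w => by
      rw [tensorMk, TensorProduct.tmul_smul, TensorProduct.tmul_smul, TensorProduct.smul_tmul',
        Algebra.smul_def, mul_one]
      exact tensorMk_eq_smul _ v w)

theorem tensorMkHom_apply (v : V) (w : W) : tensorMkHom V W v w = tensorMk 1 v w := rfl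

theorem tensor_induction {p : tensor V W → Prop} (z : tensor V W) (h0 : p 0)
    (hadd : ∀ z z', p z → p z' → p (z + z')) (hsmul : ∀ (x : UAlg k) z, p z → p (x • z))
    (hmk : ∀ v w, p (tensorMk 1 v w)) : p z := by
  obtain ⟨z, rfl⟩ := Submodule.Quotient.mk_surjective _ z
  induction z using TensorProduct.induction_on with
  | zero => exact h0
  | add x y hx hy => exact hadd _ _ hx hy
  | tmul x t =>
    induction t using TensorProduct.induction_on with
    | zero => rw [TensorProduct.tmul_zero]; exact h0
    | add y z hy hz => rw [TensorProduct.tmul_add]; exact hadd _ _ hy hz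
    | tmul v w =>
      have := hsmul x _ (hmk v w)
      rw [← tensorMk_eq_smul] at this
      exact this

theorem tensor_hom_ext {f g : tensor V W →ₗ[UAlg k] U}
    (h : ∀ v w, f (tensorMk 1 v w) = g (tensorMk 1 v w)) : f = g := by
  refine LinearMap.ext fun z => ?_
  induction z using tensor_induction with
  | h0 => rw [map_zero, map_zero]
  | hadd z z' hz hz' => rw [map_add, map_add, hz, hz']
  | hsmul x z hz => rw [map_smul, map_smul, hz]
  | hmk v w => exact h v w

/-- The universal property of the tensor product. -/
def tensorLift (φ : V →ₗ[k] W →ₗ[k] U)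
    (hφ : ∀ (a b c d : ℕ) (α : Diagram a c) (β : Diagram b d) (v : V) (w : W),
      (idem c : UAlg k) • v = v → (idem d : UAlg k) • w = w →
      (diag (α.stack β) : UAlg k) • φ v w = φ ((diag α : UAlg k) • v) ((diag β : UAlg k) • w)) :
    tensor V W →ₗ[UAlg k] U :=
  Submodule.liftQ _ (TensorProduct.AlgebraTensorModule.lift
      (LinearMap.toSpanSingleton (UAlg k) (V ⊗[k] W →ₗ[k] U) (TensorProduct.lift φ))) <| by
    rw [Submodule.span_le]
    rintro _ ⟨a, b, c, d, α, β, v, w, hv, hw, rfl⟩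
    simp [hφ a b c d α β v w hv hw]

theorem tensorLift_mk (φ : V →ₗ[k] W →ₗ[k] U)
    (hφ : ∀ (a b c d : ℕ) (α : Diagram a c) (β : Diagram b d) (v : V) (w : W),
      (idem c : UAlg k) • v = v → (idem d : UAlg k) • w = w →
      (diag (α.stack β) : UAlg k) • φ v w = φ ((diag α : UAlg k) • v) ((diag β : UAlg k) • w))
    (v : V) (w : W) :
    tensorLift φ hφ (tensorMk 1 v w) = φ v w := by
  change TensorProduct.AlgebraTensorModule.lift (LinearMap.toSpanSingleton (UAlg k)
    (V ⊗[k] W →ₗ[k] U) (TensorProduct.lift φ)) ((1 : UAlg k) ⊗ₜ[k] (v ⊗ₜ[k] w)) = φ v w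
  simp

/-- The functoriality of the tensor product. -/
def tensorMap (f : V →ₗ[UAlg k] V') (g : W →ₗ[UAlg k] W') : tensor V W →ₗ[UAlg k] tensor V' W' :=
  tensorLift ((tensorMkHom V' W').compl₁₂ (f.restrictScalars k) (g.restrictScalars k))
    fun a b c d α β v w hv hw => by
      simp only [LinearMap.compl₁₂_apply, LinearMap.restrictScalars_apply, tensorMkHom_apply,
        map_smul]
      exact diag_stack_smul_tensorMk α β (f v) (g w) (by rw [← map_smul, hv])
        (by rw [← map_smul, hw])

theorem tensorMap_mk (f : V →ₗ[UAlg k] V') (g : W →ₗ[UAlg k] W') (v : V) (w : W) :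
    tensorMap f g (tensorMk 1 v w) = tensorMk 1 (f v) (g w) :=
  tensorLift_mk _ _ _ _

theorem tensorMk_zero_left (w : W) : tensorMk (V := V) (1 : UAlg k) 0 w = 0 := by
  rw [← tensorMkHom_apply, map_zero, LinearMap.zero_apply]

theorem tensorMk_zero_right (v : V) : tensorMk (W := W) (1 : UAlg k) v 0 = 0 := by
  rw [← tensorMkHom_apply, map_zero]

theorem tensorMk_add_left (v v' : V) (w : W) : tensorMk (1 : UAlg k) v w + tensorMk 1 v' w =
    tensorMk 1 (v + v') w := by
  simp only [← tensorMkHom_apply, map_add, LinearMap.add_apply]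

theorem tensorMk_add_right (v : V) (w w' : W) : tensorMk (1 : UAlg k) v w + tensorMk 1 v w' =
    tensorMk 1 v (w + w') := by
  simp only [← tensorMkHom_apply, map_add]

/-- A direct sum decomposition given by injections and projections. -/
def equivProd {T T₁ T₂ : Type*} [AddCommGroup T] [Module (UAlg k) T] [AddCommGroup T₁]
    [Module (UAlg k) T₁] [AddCommGroup T₂] [Module (UAlg k) T₂] (p₁ : T →ₗ[UAlg k] T₁)
    (p₂ : T →ₗ[UAlg k] T₂) (i₁ : T₁ →ₗ[UAlg k] T) (i₂ : T₂ →ₗ[UAlg k] T)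
    (h₁₁ : p₁ ∘ₗ i₁ = LinearMap.id) (h₁₂ : p₁ ∘ₗ i₂ = 0) (h₂₁ : p₂ ∘ₗ i₁ = 0)
    (h₂₂ : p₂ ∘ₗ i₂ = LinearMap.id) (h : i₁ ∘ₗ p₁ + i₂ ∘ₗ p₂ = LinearMap.id) :
    T ≃ₗ[UAlg k] T₁ × T₂ :=
  LinearEquiv.ofLinearMap (p₁.prod p₂) (i₁.coprod i₂)
    (by
      ext x
      · simpa using LinearMap.congr_fun h₁₁ x
      · simpa using LinearMap.congr_fun h₂₁ x
      · simpa using LinearMap.congr_fun h₁₂ x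
      · simpa using LinearMap.congr_fun h₂₂ x)
    (LinearMap.ext fun x => LinearMap.congr_fun h x)

/-- The tensor product preserves direct sums in the first variable. -/
def tensorProdLeft {V₁ V₂ : ModuleCat.{u} (UAlg k)} (e : V ≃ₗ[UAlg k] V₁ × V₂) :
    tensor V W ≃ₗ[UAlg k] tensor V₁ W × tensor V₂ W := by
  refine equivProd (tensorMap (LinearMap.fst _ _ _ ∘ₗ e.toLinearMap) LinearMap.id)
      (tensorMap (LinearMap.snd _ _ _ ∘ₗ e.toLinearMap) LinearMap.id)
      (tensorMap (e.symm.toLinearMap ∘ₗ LinearMap.inl _ _ _) LinearMap.id)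
      (tensorMap (e.symm.toLinearMap ∘ₗ LinearMap.inr _ _ _) LinearMap.id) ?_ ?_ ?_ ?_ ?_
  all_goals
    refine tensor_hom_ext fun v w => ?_
    simp [tensorMap_mk, tensorMk_zero_left, tensorMk_add_left, ← map_add]

/-- The tensor product preserves direct sums in the second variable. -/
def tensorProdRight {W₁ W₂ : ModuleCat.{u} (UAlg k)} (e : W ≃ₗ[UAlg k] W₁ × W₂) :
    tensor V W ≃ₗ[UAlg k] tensor V W₁ × tensor V W₂ := by
  refine equivProd (tensorMap LinearMap.id (LinearMap.fst _ _ _ ∘ₗ e.toLinearMap))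
      (tensorMap LinearMap.id (LinearMap.snd _ _ _ ∘ₗ e.toLinearMap))
      (tensorMap LinearMap.id (e.symm.toLinearMap ∘ₗ LinearMap.inl _ _ _))
      (tensorMap LinearMap.id (e.symm.toLinearMap ∘ₗ LinearMap.inr _ _ _)) ?_ ?_ ?_ ?_ ?_
  all_goals
    refine tensor_hom_ext fun v w => ?_
    simp [tensorMap_mk, tensorMk_zero_right, tensorMk_add_right, ← map_add]

theorem tensor_subsingleton_left [Subsingleton V] : Subsingleton (tensor V W) := by
  refine subsingleton_of_forall_eq 0 fun z => ?_
  induction z using tensor_induction with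
  | h0 => rfl
  | hadd z z' hz hz' => rw [hz, hz', add_zero]
  | hsmul x z hz => rw [hz, smul_zero]
  | hmk v w => rw [Subsingleton.elim v 0, tensorMk_zero_left]

theorem tensor_subsingleton_right [Subsingleton W] : Subsingleton (tensor V W) := by
  refine subsingleton_of_forall_eq 0 fun z => ?_
  induction z using tensor_induction with
  | h0 => rfl
  | hadd z z' hz hz' => rw [hz, hz', add_zero]
  | hsmul x z hz => rw [hz, smul_zero]
  | hmk v w => rw [Subsingleton.elim w 0, tensorMk_zero_right]

/-! ### Tensor products of projectives -/

/-- The inclusion of `P_a`, as an object of the category of modules, into the algebra. -/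
def inclP (a : ℕ) : (projP k a).1 →ₗ[k] UAlg k where
  toFun v := (v : P k a).1
  map_add' _ _ := rfl
  map_smul' c v := (Algebra.smul_def c (v : P k a).1).symm

theorem inclP_mem (a : ℕ) (v : (projP k a).1) : inclP a v ∈ P k a := (v : P k a).2

theorem inclP_injective (a : ℕ) : Function.Injective (inclP (k := k) a) := Subtype.val_injective

/-- The bilinear map `P_a × P_b → P_{a+b}` given by stacking. -/
def stackP (a b : ℕ) : (projP k a).1 →ₗ[k] (projP k b).1 →ₗ[k] (projP k (a + b)).1 :=
  LinearMap.mk₂ k (fun v w => (⟨stackHom k (inclP a v) (inclP b w),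
      stackHom_mem_P (inclP_mem a v) (inclP_mem b w)⟩ : P k (a + b)))
    (fun v v' w => inclP_injective _ (by
      change stackHom k (inclP a (v + v')) (inclP b w) =
        stackHom k (inclP a v) (inclP b w) + stackHom k (inclP a v') (inclP b w)
      rw [map_add, map_add, LinearMap.add_apply]))
    (fun c v w => inclP_injective _ (by
      refine Eq.trans ?_ (map_smul (inclP (a + b)) c _).symm
      change stackHom k (inclP a (c • v)) (inclP b w) = c • stackHom k (inclP a v) (inclP b w)
      rw [map_smul, map_smul, LinearMap.smul_apply]))
    (fun v w w' => inclP_injective _ (by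
      change stackHom k (inclP a v) (inclP b (w + w')) =
        stackHom k (inclP a v) (inclP b w) + stackHom k (inclP a v) (inclP b w')
      rw [map_add, map_add]))
    (fun c v w => inclP_injective _ (by
      refine Eq.trans ?_ (map_smul (inclP (a + b)) c _).symm
      change stackHom k (inclP a v) (inclP b (c • w)) = c • stackHom k (inclP a v) (inclP b w)
      rw [map_smul, map_smul]))

theorem inclP_stackP (a b : ℕ) (v : (projP k a).1) (w : (projP k b).1) :
    inclP (a + b) (stackP a b v w) = stackHom k (inclP a v) (inclP b w) := rfl

variable (k)

/-- The map `P_a ⊗ P_b → P_{a+b}` given by stacking. -/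
def tensorPHom (a b : ℕ) : tensor (projP k a).1 (projP k b).1 →ₗ[UAlg k] (projP k (a + b)).1 :=
  tensorLift (stackP a b) fun _ _ _ _ α β v w hv hw => inclP_injective _ <|
    diag_stack_mul_stackHom α β (inclP_mem a v) (inclP_mem b w)
      (congrArg (inclP a) hv) (congrArg (inclP b) hw)

/-- The generator of `P_a`, typed as an element of the object `projP k a`: the scalar action of the
field on it is then the one of an object of the category of modules. -/
def gen (a : ℕ) : (projP k a).1 := genP k a

variable {k}

theorem inclP_gen (a : ℕ) : inclP a (gen k a) = idem a := rfl

theorem eq_inclP_smul_gen {a : ℕ} (v : (projP k a).1) : v = inclP a v • gen k a :=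
  inclP_injective _ (mem_P.1 (inclP_mem a v)).symm

theorem idem_smul_gen (a : ℕ) : (idem a : UAlg k) • gen k a = gen k a := idem_smul_genP a

/-- The homomorphism `P_a → V` that sends the generator `1_a` to `1_a v`. -/
def homGen (a : ℕ) (v : V) : (projP k a).1 →ₗ[UAlg k] V := homP a v

theorem homGen_apply {a : ℕ} (v : V) (x : (projP k a).1) : homGen a v x = inclP a x • v := rfl

theorem hom_gen_ext {a : ℕ} {f g : (projP k a).1 →ₗ[UAlg k] V} (h : f (gen k a) = g (gen k a)) :
    f = g :=
  hom_P_ext h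

theorem tensorPHom_mk (a b : ℕ) (v : (projP k a).1) (w : (projP k b).1) :
    tensorPHom k a b (tensorMk 1 v w) = stackP a b v w :=
  tensorLift_mk _ _ v w

theorem tensorPHom_mk_gen (a b : ℕ) :
    tensorPHom k a b (tensorMk 1 (gen k a) (gen k b)) = gen k (a + b) := by
  rw [tensorPHom_mk]
  refine inclP_injective _ ?_
  rw [inclP_stackP, inclP_gen, inclP_gen, inclP_gen, idem, idem, idem, stackHom_diag,
    Diagram.one_stack_one]

/-- On `P_a ⊗ P_b` every pure tensor is a multiple of the tensor product of the generators. -/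
theorem stackHom_smul_tensorMk_gen (a b : ℕ) {x y : UAlg k} (hx : x ∈ P k a) (hy : y ∈ P k b) :
    stackHom k x y • tensorMk 1 (gen k a) (gen k b) =
      tensorMkHom _ _ (x • gen k a) (y • gen k b) := by
  have hs : ∀ {V : ModuleCat.{u} (UAlg k)} (r : k) (x : UAlg k) (v : V),
      (r • x) • v = r • (x • v) := fun r x v => smul_assoc r x v
  refine Submodule.span_induction (p := fun x _ => stackHom k x y • tensorMk 1 (gen k a) (gen k b) =
      tensorMkHom _ _ (x • gen k a) (y • gen k b)) ?_ ?_ ?_ ?_ (mem_span_of_mem_P hx)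
  · rintro _ ⟨c, α, rfl⟩
    refine Submodule.span_induction (p := fun y _ => stackHom k (diag α) y •
        tensorMk 1 (gen k a) (gen k b) = tensorMkHom _ _ ((diag α : UAlg k) • gen k a)
          (y • gen k b)) ?_ ?_ ?_ ?_ (mem_span_of_mem_P hy)
    · rintro _ ⟨d, β, rfl⟩
      rw [stackHom_diag, diag_stack_smul_tensorMk α β _ _ (idem_smul_gen a) (idem_smul_gen b)]
      rfl
    · rw [map_zero, zero_smul, zero_smul, map_zero]
    · intro x y _ _ hx hy; rw [map_add, add_smul, hx, hy, add_smul, map_add]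
    · intro r x _ hx; rw [map_smul, hs, hs, map_smul, hx]
  · rw [map_zero, LinearMap.zero_apply, zero_smul, zero_smul, map_zero, LinearMap.zero_apply]
  · intro x y _ _ hx hy
    rw [map_add, LinearMap.add_apply, add_smul, hx, hy, add_smul, map_add, LinearMap.add_apply]
  · intro r x _ hx
    rw [map_smul, LinearMap.smul_apply, hs, hs,
      LinearMap.map_smul (tensorMkHom (projP k a).1 (projP k b).1) r, hx, LinearMap.smul_apply]

variable (k)

/-- The isomorphism `P_a ⊗ P_b ≅ P_{a+b}` that sends the tensor product of the generators to the
generator. -/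
def tensorPEquiv (a b : ℕ) : tensor (projP k a).1 (projP k b).1 ≃ₗ[UAlg k] (projP k (a + b)).1 :=
  LinearEquiv.ofLinearMap (tensorPHom k a b)
    (homGen (a + b) (tensorMk 1 (gen k a) (gen k b)))
    (hom_gen_ext (by
      rw [LinearMap.comp_apply, homGen_apply, map_smul, tensorPHom_mk_gen]
      exact idem_smul_gen _))
    (tensor_hom_ext fun v w => by
      rw [LinearMap.comp_apply, tensorPHom_mk]
      refine (stackHom_smul_tensorMk_gen a b (inclP_mem a v) (inclP_mem b w)).trans ?_
      rw [← eq_inclP_smul_gen, ← eq_inclP_smul_gen]; rfl)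

theorem tensorPEquiv_mk (a b : ℕ) :
    tensorPEquiv k a b (tensorMk 1 (gen k a) (gen k b)) = gen k (a + b) :=
  tensorPHom_mk_gen a b

variable {k}

/-- The tensor product of finitely generated projective modules is finitely generated projective,
and it corresponds to the product of polynomials. -/
theorem equivPolynomial_mk_tensor (V W : FGProj k) : ∃ h : IsFGProj (tensor V.1 W.1),
    K0.equivPolynomial k (K0.mk ⟨tensor V.1 W.1, h⟩) =
      K0.equivPolynomial k (K0.mk V) * K0.equivPolynomial k (K0.mk W) := by
  -- both factors are built from the modules `P_n`; the first induction is on the second factor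
  have key : ∀ (a : ℕ) (W : ModuleCat.{u} (UAlg k)) (hW : IsFGProj W),
      ∃ h : IsFGProj (tensor (projP k a).1 W), K0.equivPolynomial k (K0.mk ⟨_, h⟩) =
        X ^ a * K0.equivPolynomial k (K0.mk ⟨W, hW⟩) := by
    intro a W hW
    refine hW.induction (motive := fun W => ∀ hW : IsFGProj W,
      ∃ h : IsFGProj (tensor (projP k a).1 W), K0.equivPolynomial k (K0.mk ⟨_, h⟩) =
        X ^ a * K0.equivPolynomial k (K0.mk ⟨W, hW⟩)) ?_ ?_ hW
    · intro W hs hW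
      have := tensor_subsingleton_right (V := (projP k a).1) (W := W)
      have h := isFGProj_of_subsingleton (tensor (projP k a).1 W)
      have h1 : Subsingleton (⟨_, h⟩ : FGProj k).1 := this
      have h2 : Subsingleton (⟨W, hW⟩ : FGProj k).1 := hs
      exact ⟨h, by rw [K0.mk_eq_zero, K0.mk_eq_zero, map_zero, mul_zero]⟩
    · intro W W' b hW' e ih hW
      obtain ⟨h', ih⟩ := ih hW'
      let e' : tensor (projP k a).1 W ≃ₗ[UAlg k]
          (projP k (a + b)).1 × tensor (projP k a).1 W' :=
        (tensorProdRight (V := (projP k a).1) (W₁ := (projP k b).1) (W₂ := W') e).trans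
          ((tensorPEquiv k a b).prodCongr (LinearEquiv.refl _ _))
      have h : IsFGProj (tensor (projP k a).1 W) :=
        ((projP k (a + b)).2.prod h').of_equiv e'.symm
      refine ⟨h, ?_⟩
      rw [K0.mk_eq_add (V := ⟨_, h⟩) (V₁ := projP k (a + b)) (V₂ := ⟨_, h'⟩) e',
        K0.mk_eq_add (V := ⟨W, hW⟩) (V₁ := projP k b) (V₂ := ⟨W', hW'⟩) e, map_add, map_add, ih,
        K0.equivPolynomial_mk_projP, K0.equivPolynomial_mk_projP, mul_add, pow_add]
  obtain ⟨V, hV⟩ := V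
  refine hV.induction (motive := fun V => ∀ hV : IsFGProj V, ∃ h : IsFGProj (tensor V W.1),
    K0.equivPolynomial k (K0.mk ⟨tensor V W.1, h⟩) =
      K0.equivPolynomial k (K0.mk ⟨V, hV⟩) * K0.equivPolynomial k (K0.mk W)) ?_ ?_ hV
  · intro V hs hV
    have := tensor_subsingleton_left (V := V) (W := W.1)
    have h := isFGProj_of_subsingleton (tensor V W.1)
    have h1 : Subsingleton (⟨_, h⟩ : FGProj k).1 := this
    have h2 : Subsingleton (⟨V, hV⟩ : FGProj k).1 := hs
    exact ⟨h, by rw [K0.mk_eq_zero, K0.mk_eq_zero, map_zero, zero_mul]⟩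
  · intro V V' a hV' e ih hV
    obtain ⟨h', ih⟩ := ih hV'
    obtain ⟨ha, ha'⟩ := key a W.1 W.2
    let e' : tensor V W.1 ≃ₗ[UAlg k] tensor (projP k a).1 W.1 × tensor V' W.1 :=
      tensorProdLeft (V₁ := (projP k a).1) (V₂ := V') e
    have h : IsFGProj (tensor V W.1) := (ha.prod h').of_equiv e'.symm
    refine ⟨h, ?_⟩
    rw [K0.mk_eq_add (V := ⟨_, h⟩) (V₁ := ⟨_, ha⟩) (V₂ := ⟨_, h'⟩) e',
      K0.mk_eq_add (V := ⟨V, hV⟩) (V₁ := projP k a) (V₂ := ⟨V', hV'⟩) e, map_add, map_add, ih, ha',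
      K0.equivPolynomial_mk_projP, add_mul]

end Tensor

end ChebyshevDiagrams
end

noncomputable section

namespace ChebyshevDiagrams

open Limits Pretriangulated

variable {k : Type u} [Field k]

/-! ### Bounded complexes of finitely generated projectives -/

theorem isFGProj_of_isZero {V : ModuleCat.{u} (UAlg k)} (h : IsZero V) : IsFGProj V :=
  have := ModuleCat.subsingleton_of_isZero h
  isFGProj_of_subsingleton V

theorem isPerf_single {V : ModuleCat.{u} (UAlg k)} (hV : IsFGProj V) (a : ℤ) :
    IsPerf ((HomologicalComplex.single _ (ComplexShape.up ℤ) a).obj V) where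
  bounded := ⟨a, a, fun i hi =>
    HomologicalComplex.isZero_single_obj_X (ComplexShape.up ℤ) a V i (by omega)⟩
  fgProj i := by
    by_cases h : i = a
    · subst h
      exact hV.of_iso (HomologicalComplex.singleObjXSelf (ComplexShape.up ℤ) i V).symm
    · exact isFGProj_of_isZero (HomologicalComplex.isZero_single_obj_X _ _ _ _ h)

/-- The degree-`i` part of a mapping cone. -/
def mappingConeXEquiv {X Y : CochainComplex (ModuleCat.{u} (UAlg k)) ℤ} (f : X ⟶ Y) (i : ℤ) :
    (CochainComplex.mappingCone f).X i ≃ₗ[UAlg k] X.X (i + 1) × Y.X i :=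
  (HomologicalComplex.homotopyCofiber.XIsoBiprod f i (i + 1) rfl ≪≫
    ModuleCat.biprodIsoProd _ _).toLinearEquiv

theorem IsPerf.mappingCone {X Y : CochainComplex (ModuleCat.{u} (UAlg k)) ℤ} (hX : IsPerf X)
    (hY : IsPerf Y) (f : X ⟶ Y) : IsPerf (CochainComplex.mappingCone f) where
  bounded := by
    obtain ⟨a, b, h⟩ := hX.bounded
    obtain ⟨a', b', h'⟩ := hY.bounded
    refine ⟨min (a - 1) a', max b b', fun i hi => ?_⟩
    have := ModuleCat.subsingleton_of_isZero (h (i + 1) (by omega))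
    have := ModuleCat.subsingleton_of_isZero (h' i (by omega))
    have : Subsingleton ((CochainComplex.mappingCone f).X i) := (mappingConeXEquiv f i).subsingleton
    exact ModuleCat.isZero_of_subsingleton _
  fgProj i := ((hX.fgProj (i + 1)).prod (hY.fgProj i)).of_equiv (mappingConeXEquiv f i).symm

/-! ### Euler characteristics -/

/-- The Euler characteristic of the multiplicities of `P_n` in the terms of a complex. -/
def eulerMult (n : ℕ) (C : CochainComplex (ModuleCat.{u} (UAlg k)) ℤ) : ℤ :=
  ∑ᶠ i : ℤ, (i.negOnePow : ℤ) * mult (k := k) n (C.X i)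

theorem IsPerf.finite_support {C : CochainComplex (ModuleCat.{u} (UAlg k)) ℤ} (hC : IsPerf C)
    (f : ℤ → ℤ) (hf : ∀ i, IsZero (C.X i) → f i = 0) : (Function.support f).Finite := by
  obtain ⟨a, b, h⟩ := hC.bounded
  refine (Set.finite_Icc a b).subset fun i hi => ?_
  by_contra hi'
  refine hi (hf i (h i ?_))
  rw [Set.mem_Icc] at hi'
  omega

theorem mult_of_isZero (n : ℕ) {V : ModuleCat.{u} (UAlg k)} (h : IsZero V) :
    mult (k := k) n V = 0 :=
  have := ModuleCat.subsingleton_of_isZero h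
  mult_subsingleton n

theorem finsum_negOnePow_mul_add_one (f : ℤ → ℤ) :
    ∑ᶠ i : ℤ, (i.negOnePow : ℤ) * f (i + 1) = - ∑ᶠ i : ℤ, (i.negOnePow : ℤ) * f i := by
  rw [← finsum_neg_distrib]
  refine finsum_eq_of_bijective (fun i => i + 1) (Equiv.addRight (1 : ℤ)).bijective fun i => ?_
  simp [Int.negOnePow_succ]

theorem eulerMult_mappingCone (n : ℕ) {X Y : CochainComplex (ModuleCat.{u} (UAlg k)) ℤ}
    (hX : IsPerf X) (hY : IsPerf Y) (f : X ⟶ Y) :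
    eulerMult n (CochainComplex.mappingCone f) = eulerMult n Y - eulerMult n X := by
  have h : ∀ i : ℤ, (i.negOnePow : ℤ) * mult (k := k) n ((CochainComplex.mappingCone f).X i) =
      (i.negOnePow : ℤ) * mult (k := k) n (X.X (i + 1)) +
        (i.negOnePow : ℤ) * mult (k := k) n (Y.X i) := fun i => by
    have := (hX.fgProj (i + 1)).finite
    have := (hY.fgProj i).finite
    rw [mult_congr n (mappingConeXEquiv f i), mult_prod]; push_cast; ring
  have hXs : (Function.support fun i : ℤ => (i.negOnePow : ℤ) * mult (k := k) n (X.X i)).Finite :=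
    hX.finite_support _ fun i hi => by rw [mult_of_isZero n hi]; simp
  have hXs' : (Function.support fun i : ℤ =>
      (i.negOnePow : ℤ) * mult (k := k) n (X.X (i + 1))).Finite := by
    refine (hXs.preimage (f := fun i : ℤ => i + 1) (add_left_injective 1).injOn).subset ?_
    intro i hi
    simpa [Int.negOnePow_succ] using hi
  rw [eulerMult, finsum_congr h, finsum_add_distrib hXs'
    (hY.finite_support _ fun i hi => by rw [mult_of_isZero n hi]; simp),
    finsum_negOnePow_mul_add_one (fun i => (mult (k := k) n (X.X i) : ℤ)), eulerMult, eulerMult]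
  ring

/-- Applying `Hom(-, Simple k n)` to a contractible complex gives an exact complex of
finite-dimensional vector spaces, and its Euler characteristic telescopes. -/
theorem eulerMult_eq_zero (n : ℕ) {C : CochainComplex (ModuleCat.{u} (UAlg k)) ℤ} (hC : IsPerf C)
    (h : Homotopy (𝟙 C) 0) : eulerMult n C = 0 := by
  have hfin := fun i => (hC.fgProj i).finite
  let δ : ∀ i : ℤ, (C.X (i + 1) →ₗ[UAlg k] Simple k n) →ₗ[k] (C.X i →ₗ[UAlg k] Simple k n) :=
    fun i =>
    { toFun := fun θ => θ ∘ₗ (C.d i (i + 1)).hom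
      map_add' := fun _ _ => rfl
      map_smul' := fun _ _ => rfl }
  let r : ℤ → ℤ := fun i => Module.finrank k (LinearMap.range (δ i))
  have hex : ∀ i, LinearMap.ker (δ i) = LinearMap.range (δ (i + 1)) := by
    intro i
    apply le_antisymm
    · intro θ hθ
      refine ⟨θ ∘ₗ (h.hom (i + 1 + 1) (i + 1)).hom, ?_⟩
      have h1 := h.comm (i + 1)
      rw [dNext_eq h.hom (show (ComplexShape.up ℤ).Rel (i + 1) (i + 1 + 1) from rfl),
        prevD_eq h.hom (show (ComplexShape.up ℤ).Rel i (i + 1) from rfl)] at h1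
      have hθ' : θ ∘ₗ (C.d i (i + 1)).hom = 0 := hθ
      ext x
      have h2 := congrArg (fun f => θ (f.hom x)) h1
      have h3 := LinearMap.congr_fun hθ' ((h.hom (i + 1) i).hom x)
      simp only [LinearMap.comp_apply, LinearMap.zero_apply] at h3
      simp at h2
      rw [h3, add_zero] at h2
      exact h2.symm
    · rintro _ ⟨θ, rfl⟩
      rw [LinearMap.mem_ker]
      ext x
      have h1 : (C.d (i + 1) (i + 1 + 1)).hom ((C.d i (i + 1)).hom x) = 0 :=
        LinearMap.congr_fun (congrArg ModuleCat.Hom.hom (C.d_comp_d i (i + 1) (i + 1 + 1))) x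
      change θ ((C.d (i + 1) (i + 1 + 1)).hom ((C.d i (i + 1)).hom x)) = 0
      rw [h1, map_zero]
  have hr : ∀ i, (mult (k := k) n (C.X i) : ℤ) = r i + r (i - 1) := by
    intro i
    obtain ⟨j, rfl⟩ : ∃ j, i = j + 1 := ⟨i - 1, by ring⟩
    have h1 := LinearMap.finrank_range_add_finrank_ker (δ j)
    rw [hex] at h1
    rw [add_sub_cancel_right, mult, ← h1]
    push_cast
    ring
  have hr0 : ∀ i, IsZero (C.X i) → r i = 0 := by
    intro i hi
    have h1 := hr i
    have h2 : 0 ≤ r (i - 1) := Nat.cast_nonneg _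
    have h3 : 0 ≤ r i := Nat.cast_nonneg _
    rw [mult_of_isZero n hi] at h1
    push_cast at h1
    omega
  have hs1 : (Function.support fun i : ℤ => (i.negOnePow : ℤ) * r i).Finite :=
    hC.finite_support _ fun i hi => by rw [hr0 i hi, mul_zero]
  have hs2 : (Function.support fun i : ℤ => (i.negOnePow : ℤ) * r (i - 1)).Finite := by
    refine (hs1.preimage (f := fun i : ℤ => i - 1) (sub_left_injective (b := (1 : ℤ))).injOn).subset ?_
    intro i hi
    simpa using hi
  have h2 := finsum_negOnePow_mul_add_one fun i => r (i - 1)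
  simp only [add_sub_cancel_right] at h2
  rw [eulerMult, finsum_congr fun i => by rw [hr i, mul_add], finsum_add_distrib hs1 hs2, h2]
  ring

/-- The Euler characteristic is a homotopy invariant: the cone of a homotopy equivalence is
contractible. -/
theorem eulerMult_eq_of_iso (n : ℕ) {X Y : PerfCpx k} (e : X.htpy ≅ Y.htpy) :
    eulerMult n X.1 = eulerMult n Y.1 := by
  obtain ⟨f, hf⟩ := (HomotopyCategory.quotient _ _).map_surjective e.hom
  have h1 := HomotopyCategory.mappingCone_triangleh_distinguished f
  have h2 : IsIso (CochainComplex.mappingCone.triangleh f).mor₁ := by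
    change IsIso ((HomotopyCategory.quotient _ _).map f)
    rw [hf]; infer_instance
  have h3 : IsZero ((HomotopyCategory.quotient _ _).obj (CochainComplex.mappingCone f)) :=
    (Triangle.isZero₃_iff_isIso₁ _ h1).2 h2
  obtain ⟨h⟩ := (HomotopyCategory.isZero_quotient_obj_iff _).1 h3
  have h4 := eulerMult_eq_zero n (X.2.mappingCone Y.2 f) h
  rw [eulerMult_mappingCone n X.2 Y.2] at h4
  omega

theorem eulerMult_eq_add_of_distinguished (n : ℕ) {X Y Z : PerfCpx k} (f : X.htpy ⟶ Y.htpy)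
    (g : Y.htpy ⟶ Z.htpy) (h : Z.htpy ⟶ (shiftFunctor _ (1 : ℤ)).obj X.htpy)
    (hT : Triangle.mk f g h ∈ distinguishedTriangles) :
    eulerMult n Y.1 = eulerMult n X.1 + eulerMult n Z.1 := by
  obtain ⟨f, rfl⟩ := (HomotopyCategory.quotient _ _).map_surjective f
  have h1 := HomotopyCategory.mappingCone_triangleh_distinguished f
  let e := Triangle.π₃.mapIso (isoTriangleOfIso₁₂ _ _ hT h1 (Iso.refl _) (Iso.refl _)
    ((Category.comp_id _).trans (Category.id_comp _).symm))
  have h2 := eulerMult_eq_of_iso n (X := Z) (Y := ⟨_, X.2.mappingCone Y.2 f⟩) e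
  rw [eulerMult_mappingCone n X.2 Y.2] at h2
  omega

theorem eulerMult_single (n : ℕ) (V : ModuleCat.{u} (UAlg k)) :
    eulerMult n (single V) = mult (k := k) n V := by
  rw [eulerMult, finsum_eq_single _ 0]
  · rw [mult_congr n (HomologicalComplex.singleObjXSelf (ComplexShape.up ℤ) 0 V).toLinearEquiv]
    simp
  · intro i hi
    rw [mult_of_isZero n (HomologicalComplex.isZero_single_obj_X _ _ _ _ hi)]
    simp

/-! ### The Grothendieck group of the homotopy category -/

namespace K0Htpy

theorem mk_eq_add {X Y Z : PerfCpx k} (f : X.htpy ⟶ Y.htpy) (g : Y.htpy ⟶ Z.htpy)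
    (h : Z.htpy ⟶ (shiftFunctor _ (1 : ℤ)).obj X.htpy)
    (hT : Triangle.mk f g h ∈ distinguishedTriangles) : mk Y = mk X + mk Z := by
  have : (QuotientAddGroup.mk (FreeAbelianGroup.of Y - FreeAbelianGroup.of X -
      FreeAbelianGroup.of Z) : K0Htpy k) = 0 :=
    (QuotientAddGroup.eq_zero_iff _).2 (AddSubgroup.subset_closure ⟨X, Y, Z, f, g, h, hT, rfl⟩)
  have h2 : mk Y - mk X - mk Z = 0 := this
  rw [sub_sub, sub_eq_zero] at h2
  exact h2

theorem mk_eq_add_of_iso_of_isZero {X Y Z : PerfCpx k} (e : X.htpy ≅ Y.htpy)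
    (hZ : IsZero Z.htpy) : mk Y = mk X + mk Z := by
  refine mk_eq_add e.hom (0 : Y.htpy ⟶ Z.htpy) 0 (isomorphic_distinguished _
    (contractible_distinguished X.htpy) _ ?_)
  exact Triangle.isoMk _ _ (Iso.refl _) e.symm (hZ.iso (isZero_zero _))
    (e.hom_inv_id.trans (Category.id_comp _).symm) (zero_comp.trans comp_zero.symm)
    (zero_comp.trans comp_zero.symm)

theorem mk_eq_zero {Z : PerfCpx k} (hZ : IsZero Z.htpy) : mk Z = 0 := by
  simpa using mk_eq_add_of_iso_of_isZero (Iso.refl Z.htpy) hZ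

theorem mk_eq_of_iso {X Y : PerfCpx k} (e : X.htpy ≅ Y.htpy) : mk Y = mk X := by
  let Z : PerfCpx k := ⟨(HomologicalComplex.single _ (ComplexShape.up ℤ) 0).obj
    (ModuleCat.of (UAlg k) PUnit), isPerf_single (isFGProj_of_subsingleton _) 0⟩
  have hZ' : IsZero Z.1 := Functor.map_isZero (HomologicalComplex.single _ (ComplexShape.up ℤ) 0)
    (ModuleCat.isZero_of_subsingleton (ModuleCat.of (UAlg k) PUnit))
  have hZ : IsZero Z.htpy := Functor.map_isZero (HomotopyCategory.quotient _ _) hZ'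
  rw [mk_eq_add_of_iso_of_isZero e hZ, mk_eq_zero hZ, add_zero]

theorem mk_mappingCone (X Y : PerfCpx k) (f : X.1 ⟶ Y.1) :
    mk ⟨CochainComplex.mappingCone f, X.2.mappingCone Y.2 f⟩ = mk Y - mk X := by
  rw [eq_sub_iff_add_eq', eq_comm]
  exact mk_eq_add (Z := ⟨CochainComplex.mappingCone f, X.2.mappingCone Y.2 f⟩)
    _ _ _ (HomotopyCategory.mappingCone_triangleh_distinguished f)

/-- Short exact sequences of bounded complexes of projectives split degreewise. -/
theorem mk_eq_add_of_shortExact (S : ShortComplex (CochainComplex (ModuleCat.{u} (UAlg k)) ℤ))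
    (h₁ : IsPerf S.X₁) (h₂ : IsPerf S.X₂) (h₃ : IsPerf S.X₃)
    (hS : ∀ i, (S.map (HomologicalComplex.eval _ _ i)).ShortExact) :
    mk ⟨S.X₂, h₂⟩ = mk ⟨S.X₁, h₁⟩ + mk ⟨S.X₃, h₃⟩ := by
  have hp : ∀ i, Projective (S.map (HomologicalComplex.eval _ _ i)).X₃ := fun i => by
    have := (h₃.fgProj i).projective
    exact (IsProjective.iff_projective (S.X₃.X i)).1 this
  let σ : ∀ i, (S.map (HomologicalComplex.eval _ _ i)).Splitting := fun i =>
    (hS i).splittingOfProjective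
  exact mk_eq_add (X := ⟨S.X₁, h₁⟩) (Y := ⟨S.X₂, h₂⟩) (Z := ⟨S.X₃, h₃⟩) _ _ _
    ((HomotopyCategory.distinguished_iff_iso_trianglehOfDegreewiseSplit _).2
      ⟨S, σ, ⟨Iso.refl _⟩⟩)

variable (k)

/-- The Euler characteristic of multiplicities as a functional on the Grothendieck group. -/
def eulerHom (n : ℕ) : K0Htpy k →+ ℤ :=
  QuotientAddGroup.lift _ (FreeAbelianGroup.lift fun C : PerfCpx k => eulerMult n C.1) <| by
    rw [AddSubgroup.closure_le]
    rintro _ ⟨X, Y, Z, f, g, h, hT, rfl⟩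
    simp [eulerMult_eq_add_of_distinguished n f g h hT]

variable {k}

theorem eulerHom_mk (n : ℕ) (C : PerfCpx k) : eulerHom k n (mk C) = eulerMult n C.1 :=
  FreeAbelianGroup.lift_apply_of _ _

end K0Htpy

/-! ### Stupid truncations -/

section Truncation

variable (C : CochainComplex (ModuleCat.{u} (UAlg k)) ℤ) (a : ℤ)

open Classical in
/-- The terms of the subcomplex of a complex that consists of its terms of degree `> a`. -/
def truncSubmodule (i : ℤ) : Submodule (UAlg k) (C.X i) := if i ≤ a then ⊥ else ⊤

theorem truncSubmodule_of_le {i : ℤ} (h : i ≤ a) : truncSubmodule C a i = ⊥ := if_pos h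

theorem truncSubmodule_of_lt {i : ℤ} (h : a < i) : truncSubmodule C a i = ⊤ := if_neg h.not_ge

theorem d_mem_truncSubmodule (i j : ℤ) (x : C.X i) (hx : x ∈ truncSubmodule C a i) :
    (C.d i j).hom x ∈ truncSubmodule C a j := by
  by_cases hj : j ≤ a
  · by_cases hij : i + 1 = j
    · rw [truncSubmodule_of_le C a (by omega), Submodule.mem_bot] at hx
      rw [hx, map_zero]; exact zero_mem _
    · rw [C.shape i j hij]; exact zero_mem _
  · rw [truncSubmodule_of_lt C a (by omega)]; exact Submodule.mem_top

/-- The subcomplex of terms of degree `> a`. -/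
def truncSub : CochainComplex (ModuleCat.{u} (UAlg k)) ℤ where
  X i := ModuleCat.of (UAlg k) (truncSubmodule C a i)
  d i j := ModuleCat.ofHom ((C.d i j).hom.restrict (d_mem_truncSubmodule C a i j))
  shape i j h := by
    ext x
    change (C.d i j).hom x.1 = 0
    rw [C.shape i j h]; rfl
  d_comp_d' i j l _ _ := by
    ext x
    exact LinearMap.congr_fun (congrArg ModuleCat.Hom.hom (C.d_comp_d i j l)) x.1

/-- The quotient complex of terms of degree `≤ a`. -/
def truncQuot : CochainComplex (ModuleCat.{u} (UAlg k)) ℤ where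
  X i := ModuleCat.of (UAlg k) (C.X i ⧸ truncSubmodule C a i)
  d i j := ModuleCat.ofHom (Submodule.mapQ _ _ (C.d i j).hom (d_mem_truncSubmodule C a i j))
  shape i j h := by
    ext x
    change Submodule.mkQ _ ((C.d i j).hom x) = 0
    rw [C.shape i j h]; exact map_zero _
  d_comp_d' i j l _ _ := by
    ext x
    change Submodule.mkQ _ ((C.d j l).hom ((C.d i j).hom x)) = 0
    have : (C.d j l).hom ((C.d i j).hom x) = 0 :=
      LinearMap.congr_fun (congrArg ModuleCat.Hom.hom (C.d_comp_d i j l)) x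
    rw [this]; exact map_zero _

/-- The short exact sequence of the stupid truncations. -/
def truncShortComplex : ShortComplex (CochainComplex (ModuleCat.{u} (UAlg k)) ℤ) where
  X₁ := truncSub C a
  X₂ := C
  X₃ := truncQuot C a
  f := { f := fun i => ModuleCat.ofHom (truncSubmodule C a i).subtype }
  g := { f := fun i => ModuleCat.ofHom (truncSubmodule C a i).mkQ }
  zero := by
    ext i x
    exact (Submodule.Quotient.mk_eq_zero _).2 x.2

theorem truncShortComplex_shortExact (i : ℤ) :
    ((truncShortComplex C a).map (HomologicalComplex.eval _ _ i)).ShortExact where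
  exact := by
    rw [ShortComplex.moduleCat_exact_iff_range_eq_ker]
    exact (Submodule.range_subtype _).trans (Submodule.ker_mkQ _).symm
  mono_f := (ModuleCat.mono_iff_injective _).2 Subtype.val_injective
  epi_g := (ModuleCat.epi_iff_surjective _).2 (Submodule.mkQ_surjective _)

variable {C}

theorem isZero_truncSub_X {i : ℤ} (h : i ≤ a ∨ IsZero (C.X i)) : IsZero ((truncSub C a).X i) := by
  have : Subsingleton (truncSubmodule C a i) := by
    rcases h with h | h
    · rw [truncSubmodule_of_le C a h]; infer_instance
    · have := ModuleCat.subsingleton_of_isZero h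
      infer_instance
  exact ModuleCat.isZero_of_subsingleton (ModuleCat.of (UAlg k) (truncSubmodule C a i))

theorem isZero_truncQuot_X {i : ℤ} (h : a < i ∨ IsZero (C.X i)) :
    IsZero ((truncQuot C a).X i) := by
  have : Subsingleton (C.X i ⧸ truncSubmodule C a i) := by
    rcases h with h | h
    · rw [truncSubmodule_of_lt C a h]; infer_instance
    · have := ModuleCat.subsingleton_of_isZero h
      infer_instance
  exact ModuleCat.isZero_of_subsingleton (ModuleCat.of (UAlg k) (C.X i ⧸ truncSubmodule C a i))

theorem IsPerf.truncSub (hC : IsPerf C) : IsPerf (truncSub C a) where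
  bounded := by
    obtain ⟨b, c, h⟩ := hC.bounded
    exact ⟨b, c, fun i hi => isZero_truncSub_X a (Or.inr (h i hi))⟩
  fgProj i := by
    by_cases h : i ≤ a
    · exact isFGProj_of_isZero (isZero_truncSub_X a (Or.inl h))
    · exact (hC.fgProj i).of_equiv
        (LinearEquiv.ofTop _ (truncSubmodule_of_lt C a (not_le.1 h))).symm

theorem IsPerf.truncQuot (hC : IsPerf C) : IsPerf (truncQuot C a) where
  bounded := by
    obtain ⟨b, c, h⟩ := hC.bounded
    exact ⟨b, c, fun i hi => isZero_truncQuot_X a (Or.inr (h i hi))⟩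
  fgProj i := by
    by_cases h : i ≤ a
    · exact (hC.fgProj i).of_equiv
        (Submodule.quotEquivOfEqBot _ (truncSubmodule_of_le C a h)).symm
    · exact isFGProj_of_isZero (isZero_truncQuot_X a (Or.inl (not_le.1 h)))

end Truncation

/-! ### Comparison of the two Grothendieck groups -/

variable (k)

/-- The homomorphism `K_0(A^c) → K_0(𝒞)` induced by the inclusion of projectives in degree `0`. -/
def K0.toHtpy : K0 k →+ K0Htpy k :=
  K0.lift (fun V => K0Htpy.mk ⟨single V.1, isPerf_single V.2 0⟩) fun V V₁ V₂ e => by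
    let T : ShortComplex (ModuleCat.{u} (UAlg k)) :=
      { X₁ := V₁.1
        X₂ := V.1
        X₃ := V₂.1
        f := ModuleCat.ofHom (e.symm.toLinearMap ∘ₗ LinearMap.inl _ _ _)
        g := ModuleCat.ofHom (LinearMap.snd _ _ _ ∘ₗ e.toLinearMap)
        zero := by ext x; simp }
    let σ : T.Splitting :=
      { r := ModuleCat.ofHom (LinearMap.fst _ _ _ ∘ₗ e.toLinearMap)
        s := ModuleCat.ofHom (e.symm.toLinearMap ∘ₗ LinearMap.inr _ _ _)
        f_r := by ext x; simp [T]
        s_g := by ext x; simp [T]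
        id := by ext x; simp [T, ← map_add] }
    exact K0Htpy.mk_eq_add_of_shortExact
      (T.map (HomologicalComplex.single _ (ComplexShape.up ℤ) 0)) (isPerf_single V₁.2 0)
      (isPerf_single V.2 0) (isPerf_single V₂.2 0) fun i =>
        (σ.map (HomologicalComplex.single _ (ComplexShape.up ℤ) 0 ⋙
          HomologicalComplex.eval _ _ i)).shortExact

variable {k}

theorem K0.toHtpy_mk (V : FGProj k) :
    K0.toHtpy k (K0.mk V) = K0Htpy.mk ⟨single V.1, isPerf_single V.2 0⟩ :=
  K0.lift_mk _ _ V

theorem K0.eulerHom_toHtpy (n : ℕ) (z : K0 k) :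
    K0Htpy.eulerHom k n (K0.toHtpy k z) = K0.multHom k n z := by
  refine z.induction (p := fun z => K0Htpy.eulerHom k n (K0.toHtpy k z) = K0.multHom k n z)
    ?_ ?_ ?_ ?_
  · intro V
    rw [K0.toHtpy_mk, K0Htpy.eulerHom_mk, eulerMult_single, K0.multHom_mk]
  · simp only [map_zero]
  · intro a h; simp only [map_neg, h]
  · intro a b ha hb; simp only [map_add, ha, hb]

theorem exists_iso_single_of_isZero (C : CochainComplex (ModuleCat.{u} (UAlg k)) ℤ) (a : ℤ)
    (h : ∀ i, i ≠ a → IsZero (C.X i)) : ∃ V : ModuleCat.{u} (UAlg k),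
      Nonempty (C ≅ (HomologicalComplex.single _ (ComplexShape.up ℤ) a).obj V) := by
  have : C.IsStrictlyGE a := (CochainComplex.isStrictlyGE_iff C a).2 fun i hi => h i (by omega)
  have : C.IsStrictlyLE a := (CochainComplex.isStrictlyLE_iff C a).2 fun i hi => h i (by omega)
  exact CochainComplex.exists_iso_single C a

/-- Shifting a module by one degree changes the sign of its class. -/
theorem K0Htpy.mk_single_sub_one (V : FGProj k) (a : ℤ) :
    K0Htpy.mk ⟨_, isPerf_single V.2 (a - 1)⟩ = -K0Htpy.mk ⟨_, isPerf_single V.2 a⟩ := by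
  -- the cone of `V[-a] → 0` is concentrated in degree `a - 1`
  let Z : PerfCpx k := ⟨(HomologicalComplex.single _ (ComplexShape.up ℤ) 0).obj
    (ModuleCat.of (UAlg k) PUnit), isPerf_single (isFGProj_of_subsingleton _) 0⟩
  have hZ' : IsZero Z.1 := Functor.map_isZero (HomologicalComplex.single _ (ComplexShape.up ℤ) 0)
    (ModuleCat.isZero_of_subsingleton (ModuleCat.of (UAlg k) PUnit))
  have hZ : IsZero Z.htpy := Functor.map_isZero (HomotopyCategory.quotient _ _) hZ'
  let X : PerfCpx k := ⟨_, isPerf_single V.2 a⟩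
  have h := mk_mappingCone X Z 0
  rw [mk_eq_zero hZ, zero_sub] at h
  refine Eq.trans ?_ h
  let f : X.1 ⟶ Z.1 := 0
  have hZX : ∀ i, Subsingleton (Z.1.X i) := fun i => ModuleCat.subsingleton_of_isZero
    (Functor.map_isZero (HomologicalComplex.eval _ _ i) hZ')
  obtain ⟨W, ⟨e⟩⟩ := exists_iso_single_of_isZero (CochainComplex.mappingCone f) (a - 1)
    fun i hi => by
      have := hZX i
      have : Subsingleton (X.1.X (i + 1)) := ModuleCat.subsingleton_of_isZero
        (HomologicalComplex.isZero_single_obj_X _ _ _ _ (by omega))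
      have : Subsingleton ((CochainComplex.mappingCone f).X i) :=
        (mappingConeXEquiv f i).subsingleton
      exact ModuleCat.isZero_of_subsingleton _
  have e1 : W ≅ V.1 := by
    refine (HomologicalComplex.singleObjXSelf (ComplexShape.up ℤ) (a - 1) W).symm ≪≫
      (HomologicalComplex.eval _ _ (a - 1)).mapIso e.symm ≪≫ LinearEquiv.toModuleIso ?_ ≪≫
      HomologicalComplex.singleObjXSelf (ComplexShape.up ℤ) a V.1
    have := hZX (a - 1)
    have hXa : X.1.X (a - 1 + 1) ≃ₗ[UAlg k] X.1.X a :=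
      (HomologicalComplex.XIsoOfEq X.1 (sub_add_cancel a 1)).toLinearEquiv
    exact ((mappingConeXEquiv f (a - 1)).trans
      { toFun := Prod.fst
        map_add' := fun _ _ => rfl
        map_smul' := fun _ _ => rfl
        invFun := fun x => (x, 0)
        left_inv := fun x => Prod.ext rfl (Subsingleton.elim _ _)
        right_inv := fun _ => rfl }).trans hXa
  exact mk_eq_of_iso ((HomotopyCategory.quotient _ _).mapIso
    (e ≪≫ (HomologicalComplex.single _ (ComplexShape.up ℤ) (a - 1)).mapIso e1))

theorem K0Htpy.mk_single_mem_range (V : FGProj k) (a : ℤ) :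
    K0Htpy.mk ⟨_, isPerf_single V.2 a⟩ ∈ (K0.toHtpy k).range := by
  induction a using Int.induction_on with
  | zero => exact ⟨K0.mk V, K0.toHtpy_mk V⟩
  | succ i ih =>
    have h := mk_single_sub_one V (i + 1)
    have h' : ∀ b : ℤ, b = i → K0Htpy.mk ⟨_, isPerf_single V.2 b⟩ ∈ (K0.toHtpy k).range := by
      rintro _ rfl; exact ih
    rw [← neg_neg (K0Htpy.mk ⟨_, isPerf_single V.2 ((i : ℤ) + 1)⟩), ← h]
    exact neg_mem (h' _ (by ring))
  | pred i ih =>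
    rw [mk_single_sub_one]
    exact neg_mem ih

/-- A bounded complex is an extension of complexes concentrated in a single degree, by induction on
the length `N` of an interval outside of which its terms vanish. -/
theorem K0.toHtpy_surjective : Function.Surjective (K0.toHtpy k) := by
  have key : ∀ (N : ℕ) (C : PerfCpx k) (a : ℤ),
      (∀ i : ℤ, i < a ∨ a + N ≤ i → IsZero (C.1.X i)) → K0Htpy.mk C ∈ (K0.toHtpy k).range := by
    intro N
    induction N with
    | zero =>
      intro C a h
      have hC : IsZero C.1 := by
        rw [IsZero.iff_id_eq_zero]
        ext i : 1
        exact (h i (by omega)).eq_of_src _ _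
      rw [K0Htpy.mk_eq_zero (Functor.map_isZero (HomotopyCategory.quotient _ _) hC)]
      exact zero_mem _
    | succ N ih =>
      intro C a h
      have hadd : K0Htpy.mk C = K0Htpy.mk ⟨_, C.2.truncSub a⟩ + K0Htpy.mk ⟨_, C.2.truncQuot a⟩ :=
        K0Htpy.mk_eq_add_of_shortExact (truncShortComplex C.1 a) (C.2.truncSub a) C.2
          (C.2.truncQuot a) (truncShortComplex_shortExact C.1 a)
      rw [hadd]
      refine add_mem (ih ⟨_, C.2.truncSub a⟩ (a + 1) fun i hi => isZero_truncSub_X a ?_) ?_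
      · by_cases hia : i ≤ a
        · exact Or.inl hia
        · exact Or.inr (h i (by push_cast; omega))
      · obtain ⟨V, ⟨e⟩⟩ := exists_iso_single_of_isZero (truncQuot C.1 a) a fun i hi =>
          isZero_truncQuot_X a (by
            by_cases hia : a < i
            · exact Or.inl hia
            · exact Or.inr (h i (by omega)))
        have hV : IsFGProj V := ((C.2.truncQuot a).fgProj a).of_iso
          ((HomologicalComplex.eval _ _ a).mapIso e ≪≫
            HomologicalComplex.singleObjXSelf (ComplexShape.up ℤ) a V)
        have := K0Htpy.mk_single_mem_range ⟨V, hV⟩ a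
        rw [← K0Htpy.mk_eq_of_iso (X := ⟨_, isPerf_single hV a⟩) (Y := ⟨_, C.2.truncQuot a⟩)
          ((HomotopyCategory.quotient _ _).mapIso e.symm)] at this
        exact this
  intro z
  have hz : z ∈ (K0.toHtpy k).range := by
    induction z using QuotientAddGroup.induction_on with
    | H z =>
    have hmk : ∀ C : PerfCpx k, K0Htpy.mk C ∈ (K0.toHtpy k).range := fun C => by
      obtain ⟨a, b, h⟩ := C.2.bounded
      exact key (b + 1 - a).toNat C a fun i hi => h i (by omega)
    induction z using FreeAbelianGroup.induction_on with
    | zero => exact zero_mem _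
    | of C => exact hmk C
    | neg C h => exact neg_mem h
    | add x y hx hy => exact add_mem hx hy
  exact hz

variable (k)

/-- The isomorphism `K_0(A^c) ≅ K_0(𝒞)`: it is injective because Euler characteristics of
multiplicities are invariants of the homotopy category, and surjective because a bounded complex
is a successive extension of its terms. -/
def K0.equivHtpy : K0 k ≃+ K0Htpy k :=
  AddEquiv.ofBijective (K0.toHtpy k) ⟨fun z w h => K0.ext_multHom fun n => by
    rw [← K0.eulerHom_toHtpy, h, K0.eulerHom_toHtpy], K0.toHtpy_surjective⟩

variable {k}

theorem K0.multHom_equivHtpy_symm (n : ℕ) (C : PerfCpx k) :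
    K0.multHom k n ((K0.equivHtpy k).symm (K0Htpy.mk C)) = eulerMult n C.1 := by
  obtain ⟨z, hz⟩ := (K0.equivHtpy k).surjective (K0Htpy.mk C)
  rw [← hz, AddEquiv.symm_apply_apply, ← K0Htpy.eulerHom_mk, ← hz]
  exact (K0.eulerHom_toHtpy n z).symm

/-! ### Uniqueness of resolutions -/

theorem IsPerf.isKProjective {C : CochainComplex (ModuleCat.{u} (UAlg k)) ℤ} (hC : IsPerf C) :
    C.IsKProjective := by
  obtain ⟨a, b, h⟩ := hC.bounded
  have : C.IsStrictlyLE b := (CochainComplex.isStrictlyLE_iff C b).2 fun i hi => h i (Or.inr hi)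
  have : ∀ i, Projective (C.X i) := fun i => by
    have := (hC.fgProj i).projective
    exact (IsProjective.iff_projective (C.X i)).1 this
  exact CochainComplex.isKProjective_of_projective C b

/-- Bounded complexes of projectives with quasi-isomorphisms to the same complex are homotopy
equivalent: they become isomorphic in the derived category, and they are K-projective. -/
theorem nonempty_htpy_iso_of_quasiIso {C D : PerfCpx k}
    {N : CochainComplex (ModuleCat.{u} (UAlg k)) ℤ} (f : C.1 ⟶ N) (g : D.1 ⟶ N) (hf : QuasiIso f)
    (hg : QuasiIso g) : Nonempty (C.htpy ≅ D.htpy) := by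
  let _ : HasDerivedCategory (ModuleCat.{u} (UAlg k)) := HasDerivedCategory.standard _
  have := C.2.isKProjective
  have := D.2.isKProjective
  have hf' : IsIso (DerivedCategory.Q.map f) := inferInstance
  have hg' : IsIso (DerivedCategory.Q.map g) := inferInstance
  let e : DerivedCategory.Qh.obj C.htpy ≅ DerivedCategory.Qh.obj D.htpy :=
    (DerivedCategory.quotientCompQhIso _).app C.1 ≪≫ asIso (DerivedCategory.Q.map f) ≪≫
      (asIso (DerivedCategory.Q.map g)).symm ≪≫ (DerivedCategory.quotientCompQhIso _).symm.app D.1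
  have hCD := fun L => CochainComplex.IsKProjective.Qh_map_bijective C.1 L
  have hDC := fun L => CochainComplex.IsKProjective.Qh_map_bijective D.1 L
  obtain ⟨p, hp⟩ := (hCD D.htpy).2 e.hom
  obtain ⟨q, hq⟩ := (hDC C.htpy).2 e.inv
  exact ⟨⟨p, q, (hCD _).1 (by rw [Functor.map_comp, hp, hq, e.hom_inv_id, CategoryTheory.Functor.map_id]),
    (hDC _).1 (by rw [Functor.map_comp, hp, hq, e.inv_hom_id, CategoryTheory.Functor.map_id])⟩⟩

end ChebyshevDiagrams

end

noncomputable section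

namespace ChebyshevDiagrams

variable {n m l s N : ℕ}

/-! ### Minimal right returns -/

namespace Diagram

open Classical in
/-- The upper endpoints of the minimal right returns, that is, of the right returns that join two
neighbouring endpoints. -/
def tops (c : Diagram m n) : Finset (Fin n) :=
  Finset.univ.filter fun p => ∃ p' : Fin n, (p' : ℕ) = p + 1 ∧ c.partner (Sum.inr p) = Sum.inr p'

theorem mem_tops {c : Diagram m n} {p : Fin n} : p ∈ c.tops ↔
    ∃ p' : Fin n, (p' : ℕ) = p + 1 ∧ c.partner (Sum.inr p) = Sum.inr p' := by
  simp [tops]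

theorem partner_eq_comm (c : Diagram m n) {x y : Fin m ⊕ Fin n} (h : c.partner x = y) :
    c.partner y = x := by
  rw [← h, c.invol]

/-- A diagram with a right return has an innermost one. -/
theorem tops_nonempty (c : Diagram m n) {j j' : Fin n}
    (h : c.partner (Sum.inr j) = Sum.inr j') : c.tops.Nonempty := by
  have key : ∀ (d : ℕ) (j j' : Fin n), c.partner (Sum.inr j) = Sum.inr j' → j < j' →
      (j' : ℕ) - j = d → c.tops.Nonempty := by
    intro d
    induction d using Nat.strong_induction_on with
    | _ d ih =>
    intro j j' h hj hd
    by_cases hs : (j' : ℕ) = j + 1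
    · exact ⟨j, mem_tops.2 ⟨j', hs, h⟩⟩
    · have hb : (j : ℕ) + 1 < n := by have := j'.2; rw [Fin.lt_def] at hj; omega
      obtain ⟨b', h1, h2, h3⟩ := c.right_planar j j' ⟨j + 1, hb⟩ h
        (by rw [Fin.lt_def]; simp) (by rw [Fin.lt_def] at hj ⊢; simp; omega)
      have hne : b' ≠ ⟨j + 1, hb⟩ := fun e => c.ne_self (Sum.inr ⟨j + 1, hb⟩) (by rw [h1, e])
      refine ih ((b' : ℕ) - (j + 1)) ?_ ⟨j + 1, hb⟩ b' h1 ?_ rfl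
      · rw [Fin.lt_def] at h2 h3; omega
      · rw [Fin.lt_def] at h2 ⊢
        have : (b' : ℕ) ≠ j + 1 := fun e => hne (Fin.ext e)
        simp; omega
  rcases lt_trichotomy j j' with hj | hj | hj
  · exact key _ j j' h hj rfl
  · exact absurd h (by rw [← hj]; exact c.ne_self _)
  · exact key _ j' j (c.partner_eq_comm h) hj rfl

end Diagram

/-- A set of upper endpoints of pairwise disjoint pairs of neighbouring points. -/
def IsSparse (T : Finset (Fin n)) : Prop :=
  ∀ p ∈ T, ∃ p' : Fin n, (p' : ℕ) = p + 1 ∧ p' ∉ T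

theorem isSparse_tops (c : Diagram m n) : IsSparse c.tops := by
  intro p hp
  obtain ⟨p', h, e⟩ := Diagram.mem_tops.1 hp
  refine ⟨p', h, fun hp' => ?_⟩
  obtain ⟨q, hq, e'⟩ := Diagram.mem_tops.1 hp'
  rw [c.partner_eq_comm e] at e'
  have := Sum.inr.inj e'
  subst this
  omega

theorem IsSparse.mono {T U : Finset (Fin n)} (hU : IsSparse U) (h : T ⊆ U) : IsSparse T := by
  intro p hp
  obtain ⟨p', h1, h2⟩ := hU p (h hp)
  exact ⟨p', h1, fun h' => h2 (h h')⟩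

open Classical in
/-- The points that do not belong to the pairs with upper endpoints in `T`. -/
def freePoints (T : Finset (Fin n)) : Finset (Fin n) :=
  Finset.univ.filter fun p => p ∉ T ∧ ∀ q ∈ T, (p : ℕ) ≠ q + 1

theorem mem_freePoints {T : Finset (Fin n)} {p : Fin n} :
    p ∈ freePoints T ↔ p ∉ T ∧ ∀ q ∈ T, (p : ℕ) ≠ q + 1 := by
  simp [freePoints]

/-- Each element of `T` accounts for two points that are not free. -/
theorem IsSparse.card_freePoints {T : Finset (Fin n)} (hT : IsSparse T) :
    (freePoints T).card + 2 * T.card = n := by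
  classical
  choose f hf using fun p : T => hT p.1 p.2
  let B : Finset (Fin n) := T.attach.image f
  have hB : B.card = T.card := by
    rw [Finset.card_image_of_injective, Finset.card_attach]
    intro p q h
    have h1 := (hf p).1
    have h2 := (hf q).1
    rw [h] at h1
    exact Subtype.ext (Fin.ext (by omega))
  have hmem : ∀ p, p ∈ B ↔ ∃ q ∈ T, (p : ℕ) = q + 1 := by
    intro p
    simp only [B, Finset.mem_image, Finset.mem_attach, true_and]
    constructor
    · rintro ⟨q, rfl⟩
      exact ⟨q.1, q.2, (hf q).1⟩
    · rintro ⟨q, hq, h⟩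
      exact ⟨⟨q, hq⟩, Fin.ext (by rw [(hf ⟨q, hq⟩).1, h])⟩
  have hd : Disjoint T B := by
    rw [Finset.disjoint_left]
    intro p hp hpB
    obtain ⟨q, hq, h⟩ := (hmem p).1 hpB
    have h1 := hf ⟨q, hq⟩
    exact h1.2 (by rwa [show f ⟨q, hq⟩ = p from Fin.ext (by rw [h1.1, h])])
  have hfree : freePoints T = (T ∪ B)ᶜ := by
    ext p
    rw [mem_freePoints, Finset.mem_compl, Finset.mem_union, hmem]
    push Not
    rfl
  have h1 := Finset.card_union_of_disjoint hd
  have h2 := Finset.card_compl_add_card (T ∪ B)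
  rw [Fintype.card_fin] at h2
  rw [hfree]
  omega

/-! ### Diagrams without left returns and nested right returns -/

namespace Ytilde

variable {α : Diagram N n}

theorem exists_partner_inl (hα : α ∈ Ytilde N n) (q : Fin N) :
    ∃ p, α.partner (Sum.inl q) = Sum.inr p := by
  rcases e : α.partner (Sum.inl q) with i | p
  · exact absurd e (hα.1 q i)
  · exact ⟨p, rfl⟩

/-- Unnested right returns join neighbouring points. -/
theorem eq_add_one (hα : α ∈ Ytilde N n) {p p' : Fin n}
    (h : α.partner (Sum.inr p) = Sum.inr p') (hp : p < p') : (p' : ℕ) = p + 1 := by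
  by_contra hne
  have hb : (p : ℕ) + 1 < n := by have := p'.2; rw [Fin.lt_def] at hp; omega
  obtain ⟨b', h1, h2, h3⟩ := α.right_planar p p' ⟨p + 1, hb⟩ h
    (by rw [Fin.lt_def]; simp) (by rw [Fin.lt_def] at hp ⊢; simp; omega)
  have hbne : b' ≠ ⟨p + 1, hb⟩ := fun e => α.ne_self (Sum.inr ⟨p + 1, hb⟩) (by rw [h1, e])
  have h4 : (b' : ℕ) ≠ p + 1 := fun e => hbne (Fin.ext e)
  refine hα.2 p p' ⟨p + 1, hb⟩ b' h h1 ⟨by rw [Fin.lt_def]; simp, ?_, h3⟩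
  rw [Fin.lt_def] at h2 ⊢
  simp; omega

theorem mem_tops_iff (hα : α ∈ Ytilde N n) {p : Fin n} :
    p ∈ α.tops ↔ ∃ p', α.partner (Sum.inr p) = Sum.inr p' ∧ p < p' := by
  rw [Diagram.mem_tops]
  constructor
  · rintro ⟨p', h, e⟩
    exact ⟨p', e, by rw [Fin.lt_def]; omega⟩
  · rintro ⟨p', e, h⟩
    exact ⟨p', eq_add_one hα e h, e⟩

theorem mem_freePoints_tops (hα : α ∈ Ytilde N n) {p : Fin n} :
    p ∈ freePoints α.tops ↔ ∃ q, α.partner (Sum.inr p) = Sum.inl q := by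
  rw [mem_freePoints]
  constructor
  · rintro ⟨h1, h2⟩
    rcases e : α.partner (Sum.inr p) with q | p'
    · exact ⟨q, rfl⟩
    · rcases lt_trichotomy p p' with h | h | h
      · exact absurd ((mem_tops_iff hα).2 ⟨p', e, h⟩) h1
      · exact absurd e (by rw [← h]; exact α.ne_self _)
      · have e' := α.partner_eq_comm e
        exact absurd (eq_add_one hα e' h) (h2 p' ((mem_tops_iff hα).2 ⟨p, e', h⟩))
  · rintro ⟨q, e⟩
    constructor
    · intro h
      obtain ⟨p', h1, h2⟩ := Diagram.mem_tops.1 h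
      rw [e] at h2; cases h2
    · intro p' hp' h
      obtain ⟨p'', h1, h2⟩ := Diagram.mem_tops.1 hp'
      have : p'' = p := Fin.ext (by omega)
      subst this
      rw [α.partner_eq_comm h2] at e; cases e

theorem strictMono_of_partner {f : Fin N → Fin n}
    (hf : ∀ q, α.partner (Sum.inl q) = Sum.inr (f q)) : StrictMono f := fun q q' h =>
  α.through_mono q q' _ _ (hf q) (hf q') h

theorem card_freePoints_tops (hα : α ∈ Ytilde N n) : (freePoints α.tops).card = N := by
  choose f hf using exists_partner_inl hα
  have : freePoints α.tops = Finset.univ.image f := by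
    ext p
    rw [mem_freePoints_tops hα, Finset.mem_image]
    constructor
    · rintro ⟨q, e⟩
      refine ⟨q, Finset.mem_univ _, ?_⟩
      have := hf q
      rw [α.partner_eq_comm e] at this
      exact (Sum.inr.inj this).symm
    · rintro ⟨q, -, rfl⟩
      exact ⟨q, α.partner_eq_comm (hf q)⟩
  rw [this, Finset.card_image_of_injective _ (strictMono_of_partner hf).injective,
    Finset.card_univ, Fintype.card_fin]

/-- Such a diagram is determined by its right returns. -/
theorem eq_of_tops_eq {β : Diagram N n} (hα : α ∈ Ytilde N n) (hβ : β ∈ Ytilde N n)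
    (h : α.tops = β.tops) : α = β := by
  choose f hf using exists_partner_inl hα
  choose g hg using exists_partner_inl hβ
  have hfg : f = g := by
    refine (StrictMono.range_inj (strictMono_of_partner hf) (strictMono_of_partner hg)).1 ?_
    have hr : ∀ {γ : Diagram N n} {f : Fin N → Fin n} (_ : γ ∈ Ytilde N n)
        (_ : ∀ q, γ.partner (Sum.inl q) = Sum.inr (f q)), Set.range f = freePoints γ.tops := by
      intro γ f hγ hf
      ext p
      rw [Finset.mem_coe, mem_freePoints_tops hγ]
      constructor
      · rintro ⟨q, rfl⟩
        exact ⟨q, γ.partner_eq_comm (hf q)⟩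
      · rintro ⟨q, e⟩
        have := hf q
        rw [γ.partner_eq_comm e] at this
        exact ⟨q, (Sum.inr.inj this).symm⟩
    rw [hr hα hf, hr hβ hg, h]
  subst hfg
  ext1
  funext x
  rcases x with q | p
  · rw [hf, hg]
  · rcases e : α.partner (Sum.inr p) with q | p'
    · have h1 := hf q
      rw [α.partner_eq_comm e] at h1
      rw [Sum.inr.inj h1]
      exact (β.partner_eq_comm (hg q)).symm
    · have key : ∀ {p p' : Fin n}, α.partner (Sum.inr p) = Sum.inr p' → p < p' →
          β.partner (Sum.inr p) = Sum.inr p' := by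
        intro p p' e hlt
        have hp : p ∈ β.tops := h ▸ (mem_tops_iff hα).2 ⟨p', e, hlt⟩
        obtain ⟨p'', h1, h2⟩ := Diagram.mem_tops.1 hp
        rw [h2]
        congr 1
        exact Fin.ext (by rw [h1, eq_add_one hα e hlt])
      rcases lt_trichotomy p p' with hlt | heq | hlt
      · exact (key e hlt).symm
      · exact absurd e (by rw [← heq]; exact α.ne_self _)
      · exact (β.partner_eq_comm (key (α.partner_eq_comm e) hlt)).symm

end Ytilde

open Classical in
/-- The other point of the pair of a point that belongs to a pair with upper endpoint in `T`. -/
def pairMate (T : Finset (Fin n)) (hT : IsSparse T) (p : Fin n) : Fin n :=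
  if h : p ∈ T then (hT p h).choose else ⟨p - 1, by omega⟩

theorem pairMate_of_mem {T : Finset (Fin n)} (hT : IsSparse T) {p : Fin n} (h : p ∈ T) :
    (pairMate T hT p : ℕ) = p + 1 ∧ pairMate T hT p ∉ T := by
  rw [pairMate, dif_pos h]
  exact (hT p h).choose_spec

theorem pairMate_of_notMem {T : Finset (Fin n)} (hT : IsSparse T) {p : Fin n} (h : p ∉ T) :
    (pairMate T hT p : ℕ) = p - 1 := by
  rw [pairMate, dif_neg h]

theorem pairMate_cases {T : Finset (Fin n)} (hT : IsSparse T) {p : Fin n}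
    (h : p ∉ freePoints T) :
    (p ∈ T ∧ pairMate T hT p ∉ T ∧ (pairMate T hT p : ℕ) = p + 1) ∨
      (p ∉ T ∧ pairMate T hT p ∈ T ∧ (p : ℕ) = pairMate T hT p + 1) := by
  by_cases hp : p ∈ T
  · exact Or.inl ⟨hp, (pairMate_of_mem hT hp).2, (pairMate_of_mem hT hp).1⟩
  · rw [mem_freePoints] at h
    push Not at h
    obtain ⟨q, hq, e⟩ := h hp
    have h1 := pairMate_of_notMem hT hp
    have h2 : pairMate T hT p = q := Fin.ext (by omega)
    exact Or.inr ⟨hp, h2 ▸ hq, by omega⟩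

theorem pairMate_notMem_freePoints {T : Finset (Fin n)} (hT : IsSparse T) {p : Fin n}
    (h : p ∉ freePoints T) : pairMate T hT p ∉ freePoints T := by
  rw [mem_freePoints]
  push Not
  rcases pairMate_cases hT h with ⟨h1, h2, h3⟩ | ⟨h1, h2, h3⟩
  · exact fun _ => ⟨p, h1, h3⟩
  · exact fun h' => absurd h2 h'

theorem pairMate_pairMate {T : Finset (Fin n)} (hT : IsSparse T) {p : Fin n}
    (h : p ∉ freePoints T) : pairMate T hT (pairMate T hT p) = p := by
  have h' := pairMate_cases hT (pairMate_notMem_freePoints hT h)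
  apply Fin.ext
  rcases pairMate_cases hT h with ⟨h1, h2, h3⟩ | ⟨h1, h2, h3⟩ <;>
    rcases h' with ⟨h4, h5, h6⟩ | ⟨h4, h5, h6⟩
  · exact absurd h4 h2
  · omega
  · omega
  · exact absurd h2 h4

/-- The diagram without left returns whose right returns are the pairs of neighbouring points with
upper endpoints in `T`; the remaining right points are joined to the left points in order. -/
def diagramOfTops (T : Finset (Fin n)) (hT : IsSparse T) (hN : (freePoints T).card = N) :
    Diagram N n := by
  classical
  exact
  { partner := fun x => match x with
      | Sum.inl q => Sum.inr ((freePoints T).orderIsoOfFin hN q)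
      | Sum.inr p => if h : p ∈ freePoints T then
          Sum.inl (((freePoints T).orderIsoOfFin hN).symm ⟨p, h⟩) else Sum.inr (pairMate T hT p)
    invol := by
      rintro (q | p)
      · have h : ((freePoints T).orderIsoOfFin hN q : Fin n) ∈ freePoints T :=
          ((freePoints T).orderIsoOfFin hN q).2
        simp only [dif_pos h, Subtype.coe_eta, OrderIso.symm_apply_apply]
      · by_cases h : p ∈ freePoints T
        · simp [h]
        · simp [h, pairMate_notMem_freePoints hT h, pairMate_pairMate hT h]
    ne_self := by
      rintro (q | p)
      · simp
      · by_cases h : p ∈ freePoints T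
        · simp [h]
        · simp only [h, dif_neg, not_false_eq_true, ne_eq, Sum.inr.injEq]
          intro e
          rcases pairMate_cases hT h with ⟨h1, h2, h3⟩ | ⟨h1, h2, h3⟩ <;> rw [e] at h3 <;> omega
    through_mono := by
      rintro i i' j j' h h' hi
      simp only [Sum.inr.injEq] at h h'
      rw [← h, ← h']
      exact ((freePoints T).orderIsoOfFin hN).strictMono hi
    left_planar := by
      rintro i i' a h
      simp at h
    right_planar := by
      rintro j j' b h h1 h2
      by_cases hj : j ∈ freePoints T
      · simp [hj] at h
      · simp only [hj, dif_neg, not_false_eq_true, Sum.inr.injEq] at h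
        rw [Fin.lt_def] at h1 h2
        rcases pairMate_cases hT hj with ⟨_, _, h3⟩ | ⟨_, _, h3⟩ <;> rw [h] at h3 <;> omega }

theorem diagramOfTops_mem (T : Finset (Fin n)) (hT : IsSparse T) (hN : (freePoints T).card = N) :
    diagramOfTops T hT hN ∈ Ytilde N n := by
  refine ⟨fun i i' => by simp [diagramOfTops], ?_⟩
  rintro p p' q q' h h' ⟨h1, h2, h3⟩
  by_cases hp : p ∈ freePoints T
  · simp [diagramOfTops, hp] at h
  · simp only [diagramOfTops, hp, dif_neg, not_false_eq_true, Sum.inr.injEq] at h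
    rw [Fin.lt_def] at h1 h2 h3
    rcases pairMate_cases hT hp with ⟨_, _, h4⟩ | ⟨_, _, h4⟩ <;> rw [h] at h4 <;> omega

theorem tops_diagramOfTops (T : Finset (Fin n)) (hT : IsSparse T)
    (hN : (freePoints T).card = N) : (diagramOfTops T hT hN).tops = T := by
  ext p
  rw [Ytilde.mem_tops_iff (diagramOfTops_mem T hT hN)]
  constructor
  · rintro ⟨p', h, hp'⟩
    by_cases hp : p ∈ freePoints T
    · simp [diagramOfTops, hp] at h
    · simp only [diagramOfTops, hp, dif_neg, not_false_eq_true, Sum.inr.injEq] at h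
      rw [Fin.lt_def] at hp'
      rcases pairMate_cases hT hp with ⟨h1, _, h4⟩ | ⟨_, _, h4⟩
      · exact h1
      · rw [h] at h4; omega
  · intro h
    have hp : p ∉ freePoints T := fun h' => (mem_freePoints.1 h').1 h
    refine ⟨pairMate T hT p, by simp [diagramOfTops, hp], ?_⟩
    rw [Fin.lt_def, (pairMate_of_mem hT h).1]; omega

namespace YIdx

variable {i : ℕ}

theorem card_tops (α : YIdx n i) : α.1.tops.card = i := by
  have h1 := (isSparse_tops α.1).card_freePoints
  rw [Ytilde.card_freePoints_tops α.2.2] at h1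
  have := α.2.1
  omega

theorem ext_tops {α β : YIdx n i} (h : α.1.tops = β.1.tops) : α = β :=
  Subtype.ext (Ytilde.eq_of_tops_eq α.2.2 β.2.2 h)

theorem exists_tops_eq {T : Finset (Fin n)} (hT : IsSparse T) (hi : T.card = i) :
    ∃ α : YIdx n i, α.1.tops = T := by
  have h := hT.card_freePoints
  exact ⟨⟨diagramOfTops T hT (by omega), by omega, diagramOfTops_mem _ _ _⟩,
    tops_diagramOfTops _ _ _⟩

end YIdx

/-! ### Counting -/

open Classical in
/-- The sets of `i` upper endpoints of disjoint pairs of neighbouring points among `0, …, n - 1`. -/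
def sparseSets (n i : ℕ) : Finset (Finset ℕ) :=
  ((Finset.range (n - 1)).powersetCard i).filter fun T => ∀ p ∈ T, p + 1 ∉ T

theorem mem_sparseSets {i : ℕ} {T : Finset ℕ} : T ∈ sparseSets n i ↔
    (∀ p ∈ T, p + 1 < n ∧ p + 1 ∉ T) ∧ T.card = i := by
  simp only [sparseSets, Finset.mem_filter, Finset.mem_powersetCard]
  constructor
  · rintro ⟨⟨h1, h2⟩, h3⟩
    exact ⟨fun p hp => ⟨by have := Finset.mem_range.1 (h1 hp); omega, h3 p hp⟩, h2⟩
  · rintro ⟨h1, h2⟩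
    exact ⟨⟨fun p hp => Finset.mem_range.2 (by have := (h1 p hp).1; omega), h2⟩,
      fun p hp => (h1 p hp).2⟩

/-- Either `n` is an upper endpoint of a pair among the points `0, …, n + 1`, and the other pairs
lie among `0, …, n - 1`, or all pairs lie among `0, …, n`. -/
theorem card_sparseSets_add_two (n i : ℕ) : (sparseSets (n + 2) (i + 1)).card =
    (sparseSets (n + 1) (i + 1)).card + (sparseSets n i).card := by
  classical
  have hn : ∀ T ∈ sparseSets n i, n ∉ T := fun T hT h => by
    have := ((mem_sparseSets.1 hT).1 n h).1
    omega
  have hinj : Set.InjOn (insert n) (sparseSets n i : Set (Finset ℕ)) := by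
    intro T hT T' hT' h
    rw [← Finset.erase_insert (hn T hT), ← Finset.erase_insert (hn T' hT'), h]
  rw [← Finset.card_image_of_injOn hinj, ← Finset.card_union_of_disjoint]
  · congr 1
    ext T
    simp only [Finset.mem_union, Finset.mem_image, mem_sparseSets]
    constructor
    · rintro ⟨h1, h2⟩
      by_cases hT : n ∈ T
      · refine Or.inr ⟨T.erase n, ⟨fun p hp => ?_, ?_⟩, Finset.insert_erase hT⟩
        · rw [Finset.mem_erase] at hp
          have h3 := h1 p hp.2
          refine ⟨?_, fun h => h3.2 (Finset.mem_of_mem_erase h)⟩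
          by_contra hlt
          have : p + 1 = n := by omega
          exact h3.2 (this ▸ hT)
        · rw [Finset.card_erase_of_mem hT, h2]; rfl
      · refine Or.inl ⟨fun p hp => ⟨?_, (h1 p hp).2⟩, h2⟩
        have h3 := (h1 p hp).1
        have : p ≠ n := fun h => hT (h ▸ hp)
        omega
    · rintro (⟨h1, h2⟩ | ⟨T, ⟨h1, h2⟩, rfl⟩)
      · exact ⟨fun p hp => ⟨by have := (h1 p hp).1; omega, (h1 p hp).2⟩, h2⟩
      · have hnT : n ∉ T := hn T (mem_sparseSets.2 ⟨h1, h2⟩)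
        refine ⟨fun p hp => ?_, by rw [Finset.card_insert_of_notMem hnT, h2]⟩
        rcases Finset.mem_insert.1 hp with rfl | hp
        · refine ⟨by omega, fun h => ?_⟩
          rcases Finset.mem_insert.1 h with h | h
          · omega
          · have := (h1 _ h).1
            omega
        · refine ⟨by have := (h1 p hp).1; omega, fun h => ?_⟩
          rcases Finset.mem_insert.1 h with h | h
          · have := (h1 p hp).1
            omega
          · exact (h1 p hp).2 h
  · rw [Finset.disjoint_left]
    rintro T hT hT'
    obtain ⟨T', -, rfl⟩ := Finset.mem_image.1 hT'
    have := ((mem_sparseSets.1 hT).1 n (Finset.mem_insert_self _ _)).1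
    omega

theorem card_sparseSets (n i : ℕ) : (sparseSets n i).card = (n - i).choose i := by
  induction n using Nat.strong_induction_on generalizing i with
  | _ n ih =>
  rcases i with _ | i
  · rw [Nat.choose_zero_right, Finset.card_eq_one]
    refine ⟨∅, ?_⟩
    ext T
    rw [mem_sparseSets, Finset.mem_singleton, Finset.card_eq_zero]
    constructor
    · exact fun h => h.2
    · rintro rfl; simp
  · rcases n with _ | _ | n
    · rw [Nat.choose_eq_zero_of_lt (by omega), Finset.card_eq_zero]
      refine Finset.eq_empty_of_forall_notMem fun T hT => ?_
      obtain ⟨h1, h2⟩ := mem_sparseSets.1 hT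
      obtain ⟨p, hp⟩ := Finset.card_pos.1 (by omega : 0 < T.card)
      have := (h1 p hp).1
      omega
    · rw [Nat.choose_eq_zero_of_lt (by omega), Finset.card_eq_zero]
      refine Finset.eq_empty_of_forall_notMem fun T hT => ?_
      obtain ⟨h1, h2⟩ := mem_sparseSets.1 hT
      obtain ⟨p, hp⟩ := Finset.card_pos.1 (by omega : 0 < T.card)
      have := (h1 p hp).1
      omega
    · rw [card_sparseSets_add_two, ih (n + 1) (by omega), ih n (by omega)]
      by_cases hi : i ≤ n
      · rw [show n + 1 + 1 - (i + 1) = (n - i) + 1 by omega, show n + 1 - (i + 1) = n - i by omega,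
          Nat.choose_succ_succ, add_comm]
      · rw [Nat.choose_eq_zero_of_lt (by omega), Nat.choose_eq_zero_of_lt (by omega),
          Nat.choose_eq_zero_of_lt (by omega)]

theorem card_YIdx (n i : ℕ) : Fintype.card (YIdx n i) = (n - i).choose i := by
  classical
  rw [← card_sparseSets, ← Finset.card_univ]
  refine Finset.card_bij (fun α _ => α.1.tops.map Fin.valEmbedding) ?_ ?_ ?_
  · intro α _
    rw [mem_sparseSets]
    refine ⟨fun p hp => ?_, by rw [Finset.card_map, α.card_tops]⟩
    obtain ⟨p, hpα, rfl⟩ := Finset.mem_map.1 hp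
    obtain ⟨p', h1, h2⟩ := isSparse_tops α.1 p hpα
    refine ⟨by have := p'.2; change (p : ℕ) + 1 < n; omega, fun h => ?_⟩
    obtain ⟨q, hq, h⟩ := Finset.mem_map.1 h
    have : q = p' := Fin.ext (by rw [h1]; exact h)
    exact h2 (this ▸ hq)
  · intro α _ β _ h
    exact YIdx.ext_tops (Finset.map_injective _ h)
  · intro T hT
    obtain ⟨h1, h2⟩ := mem_sparseSets.1 hT
    let U : Finset (Fin n) := Finset.univ.filter fun p => (p : ℕ) ∈ T
    have hU : U.map Fin.valEmbedding = T := by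
      ext p
      simp only [U, Finset.mem_map, Finset.mem_filter, Finset.mem_univ, true_and]
      constructor
      · rintro ⟨q, hq, rfl⟩; exact hq
      · intro hp
        exact ⟨⟨p, by have := (h1 p hp).1; omega⟩, hp, rfl⟩
    have hs : IsSparse U := by
      intro p hp
      have hp' := h1 p (Finset.mem_filter.1 hp).2
      exact ⟨⟨p + 1, hp'.1⟩, rfl, fun h => hp'.2 (Finset.mem_filter.1 h).2⟩
    obtain ⟨α, hα⟩ := YIdx.exists_tops_eq (i := i) hs (by
      rw [← h2, ← hU, Finset.card_map])
    exact ⟨α, Finset.mem_univ _, by rw [hα, hU]⟩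

end ChebyshevDiagrams

end

noncomputable section

namespace ChebyshevDiagrams

variable {n m l s N : ℕ}

/-! ### Right division of diagrams -/

namespace Diagram

/-- A diagram `β` without left returns divides `c` from the right if every right return of `β` is
a right return of `c`: contract the other arcs of `β`. -/
theorem exists_comp_eq (c : Diagram m n) (β : Diagram N n)
    (hβ : ∀ i i', β.partner (Sum.inl i) ≠ Sum.inl i')
    (H : ∀ p p', β.partner (Sum.inr p) = Sum.inr p' → c.partner (Sum.inr p) = Sum.inr p') :
    ∃ a : Diagram m N, a.comp β = some c := by
  have hb := β.invol
  have hc := c.invol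
  have hbn := β.ne_self
  have hcn := c.ne_self
  have hbt := β.through_mono
  have hbt' := @Diagram.through_mono' _ _ β
  let f : Fin m ⊕ Fin N → Fin m ⊕ Fin N := fun x => match x with
    | Sum.inl i => match c.partner (Sum.inl i) with
      | Sum.inl i' => Sum.inl i'
      | Sum.inr p => match β.partner (Sum.inr p) with
        | Sum.inl q => Sum.inr q
        | Sum.inr _ => Sum.inl i
    | Sum.inr q => match β.partner (Sum.inl q) with
      | Sum.inl _ => Sum.inr q
      | Sum.inr p => match c.partner (Sum.inr p) with
        | Sum.inl i => Sum.inl i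
        | Sum.inr p' => match β.partner (Sum.inr p') with
          | Sum.inl q' => Sum.inr q'
          | Sum.inr _ => Sum.inr q
  have f1 : ∀ i i', f (Sum.inl i) = Sum.inl i' ↔ c.partner (Sum.inl i) = Sum.inl i' := by
    intro i i'; simp only [f]; grind
  have f2 : ∀ i q, f (Sum.inl i) = Sum.inr q ↔
      ∃ p, c.partner (Sum.inl i) = Sum.inr p ∧ β.partner (Sum.inr p) = Sum.inl q := by
    intro i q; simp only [f]; grind
  have f3 : ∀ i q, f (Sum.inr q) = Sum.inl i ↔
      ∃ p, β.partner (Sum.inl q) = Sum.inr p ∧ c.partner (Sum.inr p) = Sum.inl i := by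
    intro i q; simp only [f]; grind
  have f4 : ∀ q q', f (Sum.inr q) = Sum.inr q' ↔ ∃ p p', β.partner (Sum.inl q) = Sum.inr p ∧
      c.partner (Sum.inr p) = Sum.inr p' ∧ β.partner (Sum.inr p') = Sum.inl q' := by
    intro q q'; simp only [f]; grind
  clear_value f
  let a : Diagram m N :=
    { partner := f
      invol := by
        rintro (i | q)
        · rcases e : f (Sum.inl i) with i' | q <;> grind
        · rcases e : f (Sum.inr q) with i' | q <;> grind
      ne_self := by
        rintro (i | q) e
        · grind
        · rw [f4] at e; grind
      through_mono := by
        intro i i' j j' e e' hi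
        rw [f2] at e e'
        obtain ⟨p, e1, e2⟩ := e
        obtain ⟨p', e1', e2'⟩ := e'
        exact hbt' e2 e2' (c.through_mono _ _ _ _ e1 e1' hi)
      left_planar := by
        intro i i' x e
        simp only [f1] at e ⊢
        exact c.left_planar i i' x e
      right_planar := by
        intro j j' x e h1 h2
        simp only [f4] at e ⊢
        obtain ⟨p, p', e1, e2, e3⟩ := e
        rcases e4 : β.partner (Sum.inl x) with y | y
        · exact absurd e4 (hβ _ _)
        obtain ⟨y', e5, h3, h4⟩ := c.right_planar p p' y e2 (hbt _ _ _ _ e1 e4 h1)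
          (hbt _ _ _ _ e4 (β.partner_eq_comm e3) h2)
        rcases e6 : β.partner (Sum.inr y') with x' | y''
        · exact ⟨x', ⟨y, y', rfl, e5, e6⟩, hbt' (β.partner_eq_comm e1) e6 h3, hbt' e6 e3 h4⟩
        · exfalso
          have := H _ _ e6
          grind }
  refine ⟨a, ?_⟩
  have hcomp : Composable a β := fun j j' j'' h => hβ _ _ h.2
  rw [Diagram.comp, dif_pos hcomp]
  congr 1
  ext1
  funext x
  change concatPartner a β x = _
  have ha : a.partner = f := rfl
  rcases x with i | p
  · rcases e : c.partner (Sum.inl i) with i' | p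
    · rw [concatPartner_inl_inl hcomp]
      exact Or.inl ((f1 _ _).2 e)
    · rw [concatPartner_inl_inr, ha]
      rcases e' : β.partner (Sum.inr p) with q | p'
      · exact ⟨q, (f2 _ _).2 ⟨p, e, e'⟩, β.partner_eq_comm e'⟩
      · have := H _ _ e'
        grind
  · rcases e : c.partner (Sum.inr p) with i | p'
    · rw [concatPartner_inr_inl, ha]
      rcases e' : β.partner (Sum.inr p) with q | p'
      · exact ⟨q, rfl, (f3 _ _).2 ⟨p, β.partner_eq_comm e', e⟩⟩
      · have := H _ _ e'
        grind
    · rw [concatPartner_inr_inr hcomp, ha]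
      rcases e' : β.partner (Sum.inr p) with q | p''
      · rcases e'' : β.partner (Sum.inr p') with q' | p''
        · exact Or.inr ⟨q, q', rfl, (f4 _ _).2 ⟨p, p', β.partner_eq_comm e', e, e''⟩,
            β.partner_eq_comm e''⟩
        · have := H _ _ e''
          grind
      · have := H _ _ e'
        exact Or.inl (congrArg Sum.inr (Sum.inr.inj (this.symm.trans e)))

theorem exists_comp_of_noLeft (a : Diagram m N) (β : Diagram N n)
    (hβ : ∀ i i', β.partner (Sum.inl i) ≠ Sum.inl i') : ∃ c, a.comp β = some c :=
  ⟨_, dif_pos fun _ _ _ h => hβ _ _ h.2⟩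

theorem comp_eq_some {a : Diagram m N} {β : Diagram N n} {c : Diagram m n} :
    a.comp β = some c ↔ Composable a β ∧ c.partner = concatPartner a β := by
  unfold Diagram.comp
  split_ifs with h
  · rw [Option.some_inj]
    constructor
    · rintro rfl; exact ⟨h, rfl⟩
    · rintro ⟨_, e⟩; exact Diagram.ext e.symm
  · simp [h]

/-- If `β` has no left returns, right multiplication by `β` is injective on diagrams. -/
theorem comp_right_cancel {a a' : Diagram m N} {β : Diagram N n} {c : Diagram m n}
    (hβ : ∀ i i', β.partner (Sum.inl i) ≠ Sum.inl i') (h : a.comp β = some c)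
    (h' : a'.comp β = some c) : a = a' := by
  obtain ⟨h1, h2⟩ := comp_eq_some.1 h
  obtain ⟨h3, h4⟩ := comp_eq_some.1 h'
  have he : ∀ x, concatPartner a β x = concatPartner a' β x := fun x => by rw [← h2, h4]
  have hb := β.invol
  ext1
  funext x
  rcases x with i | q
  · have h5 := he (Sum.inl i)
    rcases e : a.partner (Sum.inl i) with i' | q
    · rw [(concatPartner_inl_inl h1).2 (Or.inl e), eq_comm, concatPartner_inl_inl h3] at h5
      grind
    · rcases e' : β.partner (Sum.inl q) with _ | p
      · exact absurd e' (hβ _ _)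
      · rw [concatPartner_inl_inr.2 ⟨q, e, e'⟩, eq_comm, concatPartner_inl_inr] at h5
        grind
  · rcases e' : β.partner (Sum.inl q) with _ | p
    · exact absurd e' (hβ _ _)
    have h5 := he (Sum.inr p)
    have e'' := β.partner_eq_comm e'
    rcases e : a.partner (Sum.inr q) with i | q'
    · rw [concatPartner_inr_inl.2 ⟨q, e'', e⟩, eq_comm, concatPartner_inr_inl] at h5
      grind
    · rcases e3 : β.partner (Sum.inl q') with _ | p'
      · exact absurd e3 (hβ _ _)
      · rw [(concatPartner_inr_inr h1).2 (Or.inr ⟨q, q', e'', e, e3⟩), eq_comm,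
          concatPartner_inr_inr h3] at h5
        grind

theorem partner_of_comp {a : Diagram m N} {β : Diagram N n} {c : Diagram m n}
    (h : a.comp β = some c) {p p' : Fin n} (hp : β.partner (Sum.inr p) = Sum.inr p') :
    c.partner (Sum.inr p) = Sum.inr p' := by
  obtain ⟨h1, h2⟩ := comp_eq_some.1 h
  rw [h2, concatPartner_inr_inr h1]
  exact Or.inl hp

theorem tops_subset_of_comp {a : Diagram m N} {β : Diagram N n} {c : Diagram m n}
    (h : a.comp β = some c) : β.tops ⊆ c.tops := by
  intro p hp
  obtain ⟨p', h1, h2⟩ := mem_tops.1 hp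
  exact mem_tops.2 ⟨p', h1, partner_of_comp h h2⟩

end Diagram

theorem Ytilde.exists_comp_eq {β : Diagram N n} (hβ : β ∈ Ytilde N n) {c : Diagram m n}
    (h : β.tops ⊆ c.tops) : ∃ a : Diagram m N, a.comp β = some c := by
  refine Diagram.exists_comp_eq c β hβ.1 ?_
  have key : ∀ p p', β.partner (Sum.inr p) = Sum.inr p' → p < p' →
      c.partner (Sum.inr p) = Sum.inr p' := by
    intro p p' e hlt
    obtain ⟨p'', h1, h2⟩ := Diagram.mem_tops.1 (h ((Ytilde.mem_tops_iff hβ).2 ⟨p', e, hlt⟩))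
    rw [h2, show p'' = p' from Fin.ext (by rw [h1, Ytilde.eq_add_one hβ e hlt])]
  intro p p' e
  rcases lt_trichotomy p p' with hlt | heq | hlt
  · exact key _ _ e hlt
  · exact absurd e (by rw [← heq]; exact β.ne_self _)
  · exact c.partner_eq_comm (key _ _ (β.partner_eq_comm e) hlt)

/-- If `α = b β`, a right return of `α` that is not one of `β` comes from a right return of `b`. -/
theorem exists_return_of_comp {α : Diagram m n} {b : Diagram m N} {β : Diagram N n}
    (h : b.comp β = some α) {r : Fin n} (h1 : r ∈ α.tops) (h2 : r ∉ β.tops) :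
    ∃ j j' r', b.partner (Sum.inr j) = Sum.inr j' ∧ j < j' ∧ β.partner (Sum.inl j) = Sum.inr r ∧
      β.partner (Sum.inl j') = Sum.inr r' ∧ (r' : ℕ) = r + 1 := by
  obtain ⟨h3, h4⟩ := Diagram.comp_eq_some.1 h
  obtain ⟨r', e1, e2⟩ := Diagram.mem_tops.1 h1
  rw [h4, concatPartner_inr_inr h3] at e2
  rcases e2 with e2 | ⟨j, j', e2, e3, e4⟩
  · exact absurd (Diagram.mem_tops.2 ⟨r', e1, e2⟩) h2
  · exact ⟨j, j', r', e3, β.through_mono' e2 (β.partner_eq_comm e4) (by rw [Fin.lt_def]; omega),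
      β.partner_eq_comm e2, e4, e1⟩

/-- If `α = b β`, a right return of `b` gives a right return of `α` that is not one of `β`. -/
theorem mem_tops_of_return {α : Diagram m n} {b : Diagram m N} {β : Diagram N n}
    (hα : α ∈ Ytilde m n) (hβ : β ∈ Ytilde N n) (h : b.comp β = some α) {j j' : Fin N} {p : Fin n}
    (hb : b.partner (Sum.inr j) = Sum.inr j') (hj : j < j')
    (hp : β.partner (Sum.inl j) = Sum.inr p) : p ∈ α.tops ∧ p ∉ β.tops := by
  obtain ⟨h3, h4⟩ := Diagram.comp_eq_some.1 h
  obtain ⟨p', hp'⟩ := Ytilde.exists_partner_inl hβ j'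
  constructor
  · refine (Ytilde.mem_tops_iff hα).2 ⟨p', ?_, β.through_mono _ _ _ _ hp hp' hj⟩
    rw [h4, concatPartner_inr_inr h3]
    exact Or.inr ⟨j, j', β.partner_eq_comm hp, hb, hp'⟩
  · intro h5
    obtain ⟨q, _, e⟩ := Diagram.mem_tops.1 h5
    rw [β.partner_eq_comm hp] at e
    cases e

/-- The quotient of two diagrams that differ by a single right return is elementary. -/
theorem isElementary_of_comp {α : Diagram m n} {b : Diagram m N} {β : Diagram N n}
    (hα : α ∈ Ytilde m n) (hβ : β ∈ Ytilde N n) (h : b.comp β = some α) {r : Fin n}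
    (hr : r ∈ α.tops) (ht : β.tops = α.tops.erase r) : IsElementary b := by
  classical
  obtain ⟨h3, h4⟩ := Diagram.comp_eq_some.1 h
  refine ⟨fun i i' e => hα.1 i i' ?_, ?_⟩
  · rw [h4, concatPartner_inl_inl h3]
    exact Or.inl e
  obtain ⟨j, j', r', e1, e2, e3, e4, e5⟩ := exists_return_of_comp h hr (by simp [ht])
  refine ⟨j, j', ?_, e1, ?_⟩
  · -- a point between `j` and `j'` would be joined by `β` to a point between `r` and `r + 1`
    by_contra hne
    have hlt : (j : ℕ) + 1 < j' := by rw [Fin.lt_def] at e2; omega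
    obtain ⟨p, hp⟩ := Ytilde.exists_partner_inl hβ ⟨j + 1, hlt.trans j'.2⟩
    have h5 := β.through_mono _ _ _ _ e3 hp (by rw [Fin.lt_def]; simp)
    have h6 := β.through_mono _ _ _ _ hp e4 (by rw [Fin.lt_def]; exact hlt)
    rw [Fin.lt_def] at h5 h6
    omega
  · have key : ∀ t t', b.partner (Sum.inr t) = Sum.inr t' → t < t' → t = j := by
      intro t t' e hlt
      obtain ⟨p, hp⟩ := Ytilde.exists_partner_inl hβ t
      have h5 := mem_tops_of_return hα hβ h e hlt hp
      have h6 : p = r := by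
        by_contra hne
        exact h5.2 (by rw [ht]; exact Finset.mem_erase.2 ⟨hne, h5.1⟩)
      subst h6
      have := β.partner_eq_comm hp
      rw [β.partner_eq_comm e3] at this
      exact (Sum.inl.inj this).symm
    intro t t' e
    rcases lt_trichotomy t t' with hlt | heq | hlt
    · exact Or.inl (key t t' e hlt)
    · exact absurd e (by rw [← heq]; exact b.ne_self _)
    · have e' := b.partner_eq_comm e
      have := key t' t e' hlt
      subst this
      rw [e1] at e'
      exact Or.inr (Sum.inr.inj e').symm

open Classical in
/-- The exponent of the sign in the differential is the one of a simplicial boundary map. -/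
theorem returnsAbove_eq {α : Diagram m n} {b : Diagram m N} {β : Diagram N n}
    (hα : α ∈ Ytilde m n) (hβ : β ∈ Ytilde N n) (h : b.comp β = some α) {r : Fin n}
    (hr : r ∈ α.tops) (ht : β.tops = α.tops.erase r) :
    returnsAbove α b β = (α.tops.filter (· < r)).card := by
  obtain ⟨j, j', r', e1, e2, e3, -, -⟩ := exists_return_of_comp h hr (by simp [ht])
  refine Nat.subtype_card _ fun q => ?_
  rw [Finset.mem_filter, Ytilde.mem_tops_iff hα]
  refine and_congr_right fun _ => ⟨fun hq => ⟨j, j', r, e1, e2, e3, hq⟩, ?_⟩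
  rintro ⟨t, t', p, e4, e5, e6, hq⟩
  obtain ⟨h1, h2⟩ := mem_tops_of_return hα hβ h e4 e5 e6
  have h3 : p = r := by
    by_contra hne
    exact h2 (by rw [ht]; exact Finset.mem_erase.2 ⟨hne, h1⟩)
  exact h3 ▸ hq

end ChebyshevDiagrams

end

noncomputable section

namespace ChebyshevDiagrams

variable {n m l s N : ℕ}

/-! ### Spanning vectors of the terms of the resolution -/

section Spanning

variable (k : Type u) [Field k]

open Classical in
/-- The diagram `a` with `c = a β`, or `0` if there is none. -/
def quot (c : Diagram m n) (β : Diagram N n) : P k N :=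
  if h : ∃ a : Diagram m N, a.comp β = some c then ⟨diag h.choose, mem_P.2 (diag_mul_idem _)⟩ else 0

variable {k} in
theorem quot_of_comp {a : Diagram m N} {c : Diagram m n} {β : Diagram N n}
    (hβ : ∀ i i', β.partner (Sum.inl i) ≠ Sum.inl i') (h : a.comp β = some c) :
    quot k c β = ⟨diag a, mem_P.2 (diag_mul_idem _)⟩ := by
  have h' : ∃ a : Diagram m N, a.comp β = some c := ⟨a, h⟩
  rw [quot, dif_pos h']
  exact Subtype.ext (congrArg diag (Diagram.comp_right_cancel hβ h'.choose_spec h))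

open Classical in
/-- The element of the `i`-th term of the resolution that is the quotient of `c` by `β` in the copy
whose index `β` has its right returns at `T`.  For `T ⊆ c.tops` with `i` elements this is a diagram
in a single copy, and these elements form a basis; it is `0` if `T` does not have `i` elements. -/
def resVec (i : ℕ) (c : Diagram m n) (T : Finset (Fin n)) : ResTerm k n i :=
  fun β => if β.1.tops = T then quot k c β.1 else 0

variable {k}

theorem resVec_eq_zero {i : ℕ} {c : Diagram m n} {T : Finset (Fin n)} (h : T.card ≠ i) :
    resVec k i c T = 0 := by
  funext β
  rw [resVec, if_neg]
  · rfl
  · rintro rfl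
    exact h β.card_tops

theorem resVec_eq_single {i : ℕ} (c : Diagram m n) (β : YIdx n i) {T : Finset (Fin n)}
    (h : β.1.tops = T) [DecidableEq (YIdx n i)] :
    resVec k i c T = Pi.single β (quot k c β.1) := by
  subst h
  funext γ
  by_cases hγ : γ = β
  · subst hγ
    rw [resVec, if_pos rfl, Pi.single_eq_same]
  · rw [resVec, if_neg fun h => hγ (YIdx.ext_tops h), Pi.single_eq_of_ne hγ]

variable (k) in
/-- The projection of the algebra onto `P_n`. -/
def projectToP (n : ℕ) : UAlg k →ₗ[UAlg k] P k n :=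
  (LinearMap.toSpanSingleton (UAlg k) (UAlg k) (idem n)).codRestrict (P k n) fun x => by
    rw [mem_P, LinearMap.toSpanSingleton_apply, smul_eq_mul, mul_assoc, idem_mul_idem]

theorem projectToP_of_mem {x : UAlg k} (hx : x ∈ P k n) : projectToP k n x = ⟨x, hx⟩ :=
  Subtype.ext (mem_P.1 hx)

theorem hom_P_ext_diag {X : Type*} [AddCommGroup X] [Module k X] {F G : P k n →ₗ[k] X}
    (h : ∀ (m : ℕ) (c : Diagram m n),
      F ⟨diag c, mem_P.2 (diag_mul_idem _)⟩ = G ⟨diag c, mem_P.2 (diag_mul_idem _)⟩) : F = G := by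
  refine LinearMap.ext fun x => ?_
  have := LinearMap.eqOn_span (f := F ∘ₗ (projectToP k n).restrictScalars k)
    (g := G ∘ₗ (projectToP k n).restrictScalars k)
    (s := {a : UAlg k | ∃ (c : ℕ) (d : Diagram c n), a = diag d}) ?_ (mem_span_of_mem_P x.2)
  · simpa only [LinearMap.comp_apply, LinearMap.restrictScalars_apply,
      projectToP_of_mem x.2] using this
  · rintro _ ⟨m, c, rfl⟩
    simp only [LinearMap.comp_apply, LinearMap.restrictScalars_apply,
      projectToP_of_mem (mem_P.2 (diag_mul_idem c))]
    exact h m c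

/-- Linear maps on a term of the resolution agree if they agree on the spanning vectors. -/
theorem hom_resTerm_ext {i : ℕ} {X : Type*} [AddCommGroup X] [Module k X]
    {F G : ResTerm k n i →ₗ[k] X}
    (h : ∀ (m : ℕ) (c : Diagram m n) (T : Finset (Fin n)), T ⊆ c.tops → T.card = i →
      F (resVec k i c T) = G (resVec k i c T)) : F = G := by
  classical
  refine LinearMap.pi_ext' fun β => hom_P_ext_diag fun m a => ?_
  obtain ⟨c, hc⟩ := Diagram.exists_comp_of_noLeft a β.1 β.2.2.1
  have := h m c β.1.tops (Diagram.tops_subset_of_comp hc) β.card_tops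
  rw [resVec_eq_single c β rfl, quot_of_comp β.2.2.1 hc] at this
  exact this

theorem rightMul_quot {c : Diagram m n} {β : Diagram N n} (hβ : β ∈ Ytilde N n)
    (h : β.tops ⊆ c.tops) :
    rightMul k β (quot k c β) = ⟨diag c, mem_P.2 (diag_mul_idem _)⟩ := by
  obtain ⟨a, ha⟩ := Ytilde.exists_comp_eq hβ h
  rw [quot_of_comp hβ.1 ha]
  exact Subtype.ext (diag_mul_of_some ha)

/-- Multiplying the quotients of `c` back by the indices recovers `c`. -/
theorem sum_rightMul_resVec {X : Type*} [AddCommGroup X] [Module k X] {i : ℕ}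
    (F : YIdx n i → P k n →ₗ[k] X) {c : Diagram m n} {T : Finset (Fin n)} (hT : T ⊆ c.tops)
    {β : YIdx n i} (hβ : β.1.tops = T) :
    ∑ γ, F γ (rightMul k γ.1 (resVec k i c T γ)) =
      F β ⟨diag c, mem_P.2 (diag_mul_idem _)⟩ := by
  classical
  rw [resVec_eq_single c β hβ, Finset.sum_eq_single β]
  · rw [Pi.single_eq_same, rightMul_quot β.2.2 (hβ ▸ hT)]
  · intro γ _ hγ
    rw [Pi.single_eq_of_ne hγ, map_zero, map_zero]
  · exact fun h => absurd (Finset.mem_univ _) h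

/-! ### The differential on the spanning vectors -/

open Classical in
theorem resComponent_of_erase {i : ℕ} {β : YIdx n i} {α : YIdx n (i + 1)} {r : Fin n}
    (hr : r ∈ α.1.tops) (ht : β.1.tops = α.1.tops.erase r)
    {b : Diagram (n - 2 * (i + 1)) (n - 2 * i)} (hb : b.comp β.1 = some α.1) :
    resComponent k n i β α = ((-1 : ℤ) ^ (α.1.tops.filter (· < r)).card) • rightMul k b := by
  rw [resComponent, Finset.sum_eq_single b]
  · rw [if_pos ⟨isElementary_of_comp α.2.2 β.2.2 hb hr ht, hb⟩,
      returnsAbove_eq α.2.2 β.2.2 hb hr ht]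
  · rintro b' - hne
    rw [if_neg]
    exact fun h => hne (Diagram.comp_right_cancel β.2.2.1 h.2 hb)
  · exact fun h => absurd (Finset.mem_univ _) h

theorem resComponent_eq_zero {i : ℕ} {β : YIdx n i} {α : YIdx n (i + 1)}
    (h : ¬ β.1.tops ⊆ α.1.tops) : resComponent k n i β α = 0 := by
  rw [resComponent]
  refine Finset.sum_eq_zero fun b _ => ?_
  rw [if_neg]
  exact fun hb => h (Diagram.tops_subset_of_comp hb.2)

open Classical in
/-- On the spanning vectors the differential is the boundary map of a simplicial complex. -/
theorem resD_resVec {i : ℕ} {c : Diagram m n} {T : Finset (Fin n)} (hT : T ⊆ c.tops)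
    (hi : T.card = i + 1) : resD k n i (resVec k (i + 1) c T) =
      ∑ r ∈ T, ((-1 : ℤ) ^ (T.filter (· < r)).card) • resVec k i c (T.erase r) := by
  obtain ⟨α, hα⟩ := YIdx.exists_tops_eq ((isSparse_tops c).mono hT) hi
  obtain ⟨a, ha⟩ := Ytilde.exists_comp_eq α.2.2 (hα ▸ hT)
  funext β
  have h1 : resD k n i (resVec k (i + 1) c T) β = resComponent k n i β α (quot k c α.1) := by
    rw [resVec_eq_single c α hα]
    simp only [resD, LinearMap.pi_apply, LinearMap.sum_apply, LinearMap.comp_apply,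
      LinearMap.proj_apply]
    rw [Finset.sum_eq_single α]
    · rw [Pi.single_eq_same]
    · intro γ _ hγ
      rw [Pi.single_eq_of_ne hγ, map_zero]
    · exact fun h => absurd (Finset.mem_univ _) h
  rw [h1, Finset.sum_apply]
  simp only [Pi.smul_apply]
  by_cases hβ : β.1.tops ⊆ T
  · obtain ⟨r, hr, hrT⟩ := Finset.exists_eq_insert_iff.2 ⟨hβ, by rw [β.card_tops, hi]⟩
    have hrT' : r ∈ T := hrT ▸ Finset.mem_insert_self _ _
    have ht : β.1.tops = T.erase r := by rw [← hrT, Finset.erase_insert hr]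
    -- `c = a α` and `α = b β`, so that `c = (a b) β`
    obtain ⟨b, hb⟩ := Ytilde.exists_comp_eq β.2.2 (c := α.1) (hα ▸ hβ)
    rw [resComponent_of_erase (hα ▸ hrT') (hα ▸ ht) hb, hα, Finset.sum_eq_single r]
    · rw [resVec, if_pos ht, LinearMap.smul_apply, quot_of_comp α.2.2.1 ha]
      congr 1
      have hab := comp_assoc a b β.1
      rw [hb, Option.bind_some, ha] at hab
      obtain ⟨w, hw, hwβ⟩ := Option.bind_eq_some_iff.1 hab
      rw [quot_of_comp β.2.2.1 hwβ]
      exact Subtype.ext (diag_mul_of_some hw)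
    · intro r' hr' hne
      rw [resVec, if_neg, smul_zero]
      rw [ht]
      intro h
      exact hne ((Finset.erase_inj _ hrT').1 h).symm
    · exact fun h => absurd hrT' h
  · rw [resComponent_eq_zero (hα.symm ▸ hβ), LinearMap.zero_apply]
    symm
    refine Finset.sum_eq_zero fun r _ => ?_
    rw [resVec, if_neg, smul_zero]
    exact fun h => hβ (h ▸ Finset.erase_subset _ _)

/-- The square of a simplicial boundary map vanishes. -/
theorem sum_sum_erase_eq_zero {ι G : Type*} [LinearOrder ι] [AddCommGroup G]
    (g : Finset ι → G) (T : Finset ι) :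
    ∑ r ∈ T, ((-1 : ℤ) ^ (T.filter (· < r)).card) • ∑ s ∈ T.erase r,
      ((-1 : ℤ) ^ ((T.erase r).filter (· < s)).card) • g ((T.erase r).erase s) = 0 := by
  have key : ∀ r ∈ T, ∀ s ∈ T, r < s →
      ((-1 : ℤ) ^ (T.filter (· < r)).card) • ((-1 : ℤ) ^ ((T.erase r).filter (· < s)).card) •
        g ((T.erase r).erase s) + ((-1 : ℤ) ^ (T.filter (· < s)).card) •
        ((-1 : ℤ) ^ ((T.erase s).filter (· < r)).card) • g ((T.erase s).erase r) = 0 := by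
    intro r hr s hs hrs
    have h1 : (T.erase s).filter (· < r) = T.filter (· < r) := by
      ext q
      simp only [Finset.mem_filter, Finset.mem_erase]
      constructor
      · rintro ⟨⟨_, h⟩, h'⟩; exact ⟨h, h'⟩
      · rintro ⟨h, h'⟩; exact ⟨⟨(h'.trans hrs).ne, h⟩, h'⟩
    have h2 : T.filter (· < s) = insert r ((T.erase r).filter (· < s)) := by
      ext q
      simp only [Finset.mem_filter, Finset.mem_erase, Finset.mem_insert]
      by_cases hq : q = r
      · subst hq; simp [hr, hrs]
      · simp [hq]
    rw [h1, h2, Finset.card_insert_of_notMem (by simp), Finset.erase_right_comm, smul_smul,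
      smul_smul, ← add_smul, pow_succ]
    rw [show ∀ x y : ℤ, x * y + y * (-1) * x = 0 by intros; ring, zero_smul]
  simp only [Finset.smul_sum]
  rw [Finset.sum_sigma']
  refine Finset.sum_involution (fun x _ => ⟨x.2, x.1⟩) ?_ ?_ ?_ ?_
  · rintro ⟨r, s⟩ h
    simp only [Finset.mem_sigma, Finset.mem_erase] at h
    rcases lt_or_gt_of_ne h.2.1 with hlt | hlt
    · rw [add_comm]; exact key s h.2.2 r h.1 hlt
    · exact key r h.1 s h.2.2 hlt
  · rintro ⟨r, s⟩ h _ e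
    simp only [Finset.mem_sigma, Finset.mem_erase] at h
    simp only [Sigma.mk.injEq] at e
    exact h.2.1 e.1
  · rintro ⟨r, s⟩ h
    simp only [Finset.mem_sigma, Finset.mem_erase] at h ⊢
    exact ⟨h.2.2, h.2.1.symm, h.1⟩
  · rintro ⟨r, s⟩ h
    rfl

theorem resD_comp_resD (i : ℕ) : resD k n i ∘ₗ resD k n (i + 1) = 0 := by
  classical
  have : (resD k n i).restrictScalars k ∘ₗ (resD k n (i + 1)).restrictScalars k = 0 := by
    refine hom_resTerm_ext fun m c T hT hi => ?_
    simp only [LinearMap.comp_apply, LinearMap.restrictScalars_apply, LinearMap.zero_apply]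
    rw [resD_resVec hT hi, map_sum, ← sum_sum_erase_eq_zero (resVec k i c) T]
    refine Finset.sum_congr rfl fun r hr => ?_
    rw [map_zsmul, resD_resVec ((Finset.erase_subset _ _).trans hT)
      (by rw [Finset.card_erase_of_mem hr, hi]; rfl)]
  exact LinearMap.ext fun x => LinearMap.congr_fun this x

/-! ### The contracting homotopy -/

/-- The linear map on the algebra with prescribed values on the diagrams with `n` right endpoints,
and `0` on the other diagrams. -/
def liftRight {X : Type*} [AddCommGroup X] [Module k X] (g : ∀ m, Diagram m n → X) :
    UAlg k →ₗ[k] X :=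
  liftDiag fun x => if h : x.2.1 = n then g x.1 (h ▸ x.2.2) else 0

theorem liftRight_diag {X : Type*} [AddCommGroup X] [Module k X] (g : ∀ m, Diagram m n → X)
    (c : Diagram m n) : liftRight g (diag c : UAlg k) = g m c := by
  rw [liftRight, liftDiag_diag]
  simp

variable (k) in
open Classical in
/-- The cone with apex the uppermost minimal right return of `c`. -/
def coneVec (i : ℕ) (T : Finset (Fin n)) (m : ℕ) (c : Diagram m n) : ResTerm k n (i + 1) :=
  if h : c.tops.Nonempty then resVec k (i + 1) c (insert (c.tops.min' h) T) else 0

variable (k) in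
/-- The contracting homotopy: a spanning vector is sent to the cone over it. -/
def resHtpy (n i : ℕ) : ResTerm k n i →ₗ[k] ResTerm k n (i + 1) :=
  ∑ β : YIdx n i, liftRight (coneVec k i β.1.tops) ∘ₗ (P k n).subtype.restrictScalars k ∘ₗ
    (rightMul k β.1).restrictScalars k ∘ₗ LinearMap.proj β

theorem resHtpy_resVec {i : ℕ} {c : Diagram m n} {T : Finset (Fin n)} (hT : T ⊆ c.tops)
    (hi : T.card = i) : resHtpy k n i (resVec k i c T) = coneVec k i T m c := by
  obtain ⟨β, hβ⟩ := YIdx.exists_tops_eq ((isSparse_tops c).mono hT) hi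
  have := sum_rightMul_resVec (k := k) (fun γ : YIdx n i => liftRight (coneVec k i γ.1.tops) ∘ₗ
    (P k n).subtype.restrictScalars k) hT hβ
  rw [resHtpy, LinearMap.sum_apply]
  refine Eq.trans this ?_
  simp only [LinearMap.comp_apply, LinearMap.restrictScalars_apply, Submodule.subtype_apply]
  rw [liftRight_diag, hβ]

/-- The boundary of a cone over `T` is `T` minus the cone over the boundary of `T`.  If `T` already
contains the apex, the cone vanishes and only one summand of the cone over the boundary remains. -/
theorem resD_coneVec {i : ℕ} {c : Diagram m n} {T : Finset (Fin n)} (hT : T ⊆ c.tops)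
    (hi : T.card = i + 1) :
    resD k n (i + 1) (coneVec k (i + 1) T m c) + resHtpy k n i (resD k n i (resVec k (i + 1) c T)) =
      resVec k (i + 1) c T := by
  classical
  have hne : c.tops.Nonempty := Finset.Nonempty.mono hT (Finset.card_pos.1 (by omega))
  have hmem := c.tops.min'_mem hne
  have hmin : ∀ q ∈ T, c.tops.min' hne ≤ q := fun q hq => c.tops.min'_le q (hT hq)
  have hH : ∀ r ∈ T, resHtpy k n i (resVec k i c (T.erase r)) =
      resVec k (i + 1) c (insert (c.tops.min' hne) (T.erase r)) := fun r hr => by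
    rw [resHtpy_resVec ((Finset.erase_subset _ _).trans hT)
      (by rw [Finset.card_erase_of_mem hr, hi]; rfl), coneVec, dif_pos hne]
  rw [resD_resVec hT hi, map_sum, coneVec, dif_pos hne]
  rw [Finset.sum_congr rfl fun r hr => by rw [map_zsmul, hH r hr]]
  generalize c.tops.min' hne = r₀ at *
  by_cases hr₀ : r₀ ∈ T
  · rw [Finset.insert_eq_of_mem hr₀, resVec_eq_zero (by omega : T.card ≠ i + 1 + 1), map_zero,
      zero_add, Finset.sum_eq_single r₀]
    · rw [Finset.insert_erase hr₀, Finset.card_eq_zero.2, pow_zero, one_smul]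
      rw [Finset.filter_eq_empty_iff]
      exact fun q hq => not_lt.2 (hmin q hq)
    · intro r hr hne
      rw [Finset.insert_eq_of_mem (Finset.mem_erase.2 ⟨hne.symm, hr₀⟩), resVec_eq_zero, smul_zero]
      rw [Finset.card_erase_of_mem hr]; omega
    · exact fun h => absurd hr₀ h
  · rw [resD_resVec (Finset.insert_subset hmem hT) (by rw [Finset.card_insert_of_notMem hr₀, hi]),
      Finset.sum_insert hr₀, Finset.erase_insert hr₀, add_assoc, ← Finset.sum_add_distrib]
    have h0 : ((insert r₀ T).filter (· < r₀)).card = 0 := by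
      rw [Finset.card_eq_zero, Finset.filter_eq_empty_iff]
      intro q hq
      rcases Finset.mem_insert.1 hq with rfl | hq
      · exact lt_irrefl _
      · exact not_lt.2 (hmin q hq)
    rw [h0, pow_zero, one_smul, Finset.sum_eq_zero, add_zero]
    intro r hr
    have hlt : r₀ < r := lt_of_le_of_ne (hmin r hr) fun h => hr₀ (h ▸ hr)
    rw [Finset.filter_insert, if_pos hlt, Finset.card_insert_of_notMem (by simp [hr₀]), pow_succ,
      Finset.erase_insert_of_ne hlt.ne, ← add_smul,
      show ∀ x : ℤ, x * (-1) + x = 0 by intros; ring, zero_smul]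

theorem resD_resHtpy_add (i : ℕ) (x : ResTerm k n (i + 1)) :
    resD k n (i + 1) (resHtpy k n (i + 1) x) + resHtpy k n i (resD k n i x) = x := by
  have : (resD k n (i + 1)).restrictScalars k ∘ₗ resHtpy k n (i + 1) +
      resHtpy k n i ∘ₗ (resD k n i).restrictScalars k = LinearMap.id := by
    refine hom_resTerm_ext fun m c T hT hi => ?_
    simp only [LinearMap.add_apply, LinearMap.comp_apply, LinearMap.restrictScalars_apply,
      LinearMap.id_apply]
    rw [resHtpy_resVec hT hi, resD_coneVec hT hi]
  exact LinearMap.congr_fun this x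

theorem exact_resD (i : ℕ) : Function.Exact (resD k n (i + 1)) (resD k n i) := by
  intro x
  constructor
  · intro hx
    have := resD_resHtpy_add i x
    rw [hx, map_zero, add_zero] at this
    exact ⟨_, this⟩
  · rintro ⟨y, rfl⟩
    exact LinearMap.congr_fun (resD_comp_resD i) y

/-! ### The augmentation -/

variable (k) in
/-- The identification of the `0`-th term of the resolution with `P_n`. -/
def resZero (n : ℕ) : ResTerm k n 0 →ₗ[UAlg k] P k n :=
  ∑ α : YIdx n 0, rightMul k α.1 ∘ₗ LinearMap.proj α

theorem resAug_apply (x : ResTerm k n 0) : resAug k n x = (I k n).mkQ (resZero k n x) := rfl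

theorem resZero_resVec (c : Diagram m n) :
    resZero k n (resVec k 0 c ∅) = ⟨diag c, mem_P.2 (diag_mul_idem _)⟩ := by
  obtain ⟨β, hβ⟩ := YIdx.exists_tops_eq (n := n) (T := ∅) (i := 0) (by simp [IsSparse]) rfl
  rw [resZero, LinearMap.sum_apply]
  exact sum_rightMul_resVec (k := k) (fun γ : YIdx n 0 => LinearMap.id) (by simp) hβ

theorem resAug_surjective : Function.Surjective (resAug k n) := by
  intro y
  obtain ⟨x, rfl⟩ := Submodule.mkQ_surjective _ y
  refine ⟨(x : UAlg k) • resVec k 0 (Diagram.one n) ∅, ?_⟩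
  rw [resAug_apply, map_smul, resZero_resVec]
  exact congrArg _ (Subtype.ext (mem_P.1 x.2))

theorem resAug_comp_resD : resAug k n ∘ₗ resD k n 0 = 0 := by
  classical
  have : (resAug k n).restrictScalars k ∘ₗ (resD k n 0).restrictScalars k = 0 := by
    refine hom_resTerm_ext fun m c T hT hi => ?_
    obtain ⟨r, rfl⟩ := Finset.card_eq_one.1 hi
    simp only [LinearMap.comp_apply, LinearMap.restrictScalars_apply, LinearMap.zero_apply]
    rw [resD_resVec hT hi, Finset.sum_singleton, map_zsmul, Finset.erase_singleton, resAug_apply,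
      resZero_resVec, Submodule.mkQ_apply, (Submodule.Quotient.mk_eq_zero _).2, smul_zero]
    obtain ⟨r', _, h⟩ := Diagram.mem_tops.1 (hT (Finset.mem_singleton_self r))
    exact Submodule.subset_span ⟨m, c, ⟨r, r', h⟩, rfl⟩
  exact LinearMap.ext fun x => LinearMap.congr_fun this x

variable (k) in
open Classical in
/-- The projection of the algebra onto the span of the diagrams with `n` right endpoints and
without right returns, with values in the `0`-th term. -/
def noReturnPart (n : ℕ) : UAlg k →ₗ[k] ResTerm k n 0 :=
  liftRight fun _ c => if c.tops.Nonempty then 0 else resVec k 0 c ∅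

/-- A right return of the right factor survives in a product. -/
theorem noReturnPart_mul_diag (a : UAlg k) {d : Diagram m n} {j j' : Fin n}
    (hd : d.partner (Sum.inr j) = Sum.inr j') : noReturnPart k n (a * diag d) = 0 := by
  rw [← idem_mul_diag d, ← mul_assoc]
  have ha : a * idem m ∈ P k m := mem_P.2 (by rw [mul_assoc, idem_mul_idem])
  refine Submodule.span_induction (p := fun x _ => noReturnPart k n (x * diag d) = 0) ?_ ?_ ?_ ?_
    (mem_span_of_mem_P ha)
  · rintro _ ⟨l, e, rfl⟩
    rcases h : e.comp d with _ | c
    · rw [diag_mul_of_none h, map_zero]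
    · rw [diag_mul_of_some h, noReturnPart, liftRight_diag, if_pos]
      exact c.tops_nonempty (Diagram.partner_of_comp h hd)
  · rw [zero_mul, map_zero]
  · intro x y _ _ hx hy
    rw [add_mul, map_add, hx, hy, add_zero]
  · intro r x _ hx
    rw [smul_mul_assoc, map_smul, hx]
    exact smul_zero (A := ResTerm k n 0) r

theorem noReturnPart_of_mem_I {x : P k n} (hx : x ∈ I k n) : noReturnPart k n x = 0 := by
  have : ∀ a : UAlg k, noReturnPart k n (a * (x : UAlg k)) = 0 := by
    refine Submodule.span_induction
      (p := fun (x : P k n) _ => ∀ a : UAlg k, noReturnPart k n (a * (x : UAlg k)) = 0) ?_ ?_ ?_ ?_ hx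
    · rintro x ⟨m, d, ⟨j, j', h⟩, e⟩ a
      rw [e, noReturnPart_mul_diag a h]
    · intro a
      exact (congrArg _ (mul_zero a)).trans (map_zero (noReturnPart k n))
    · intro x y _ _ hx hy a
      rw [Submodule.coe_add, mul_add, map_add, hx, hy, add_zero]
    · intro b x _ hx a
      rw [Submodule.coe_smul, smul_eq_mul, ← mul_assoc, hx]
  simpa using this 1

/-- In degree `0` the homotopy contracts the complex onto the diagrams without right returns. -/
theorem resD_resHtpy_add_noReturnPart (x : ResTerm k n 0) :
    resD k n 0 (resHtpy k n 0 x) + noReturnPart k n (resZero k n x) = x := by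
  classical
  have : (resD k n 0).restrictScalars k ∘ₗ resHtpy k n 0 +
      noReturnPart k n ∘ₗ (P k n).subtype.restrictScalars k ∘ₗ (resZero k n).restrictScalars k =
      LinearMap.id := by
    refine hom_resTerm_ext fun m c T hT hi => ?_
    obtain rfl := Finset.card_eq_zero.1 hi
    simp only [LinearMap.add_apply, LinearMap.comp_apply, LinearMap.restrictScalars_apply,
      LinearMap.id_apply, Submodule.subtype_apply]
    rw [resHtpy_resVec hT hi, resZero_resVec, noReturnPart, liftRight_diag, coneVec]
    by_cases h : c.tops.Nonempty
    · rw [dif_pos h, if_pos h, resD_resVec (i := 0) (Finset.insert_subset (c.tops.min'_mem h) hT) rfl,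
        insert_empty_eq, Finset.sum_singleton, Finset.erase_singleton, Finset.filter_singleton,
        if_neg (lt_irrefl _), Finset.card_empty, pow_zero, one_smul, add_zero]
    · rw [dif_neg h, if_neg h, map_zero, zero_add]
  exact LinearMap.congr_fun this x

theorem exact_resAug : Function.Exact (resD k n 0) (resAug k n) := by
  intro x
  constructor
  · intro hx
    rw [resAug_apply, Submodule.mkQ_apply, Submodule.Quotient.mk_eq_zero] at hx
    have := resD_resHtpy_add_noReturnPart x
    rw [noReturnPart_of_mem_I hx, add_zero] at this
    exact ⟨_, this⟩
  · rintro ⟨y, rfl⟩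
    exact LinearMap.congr_fun resAug_comp_resD y

end Spanning

end ChebyshevDiagrams

end

noncomputable section

namespace ChebyshevDiagrams

/-! ### The resolution as a complex -/

section Resolution

open Limits

variable {k : Type u} [Field k] (n : ℕ) (hd : ∀ i, resD k n i ∘ₗ resD k n (i + 1) = 0)

theorem isFGProj_resTerm (i : ℕ) : IsFGProj (ModuleCat.of (UAlg k) (ResTerm k n i)) :=
  IsFGProj.pi fun _ => isFGProj_P _

/-- The term of the resolution in degree `-i`. -/
def resCochainXIso (i : ℕ) : (resCochain k n hd).X (-i) ≅ ModuleCat.of (UAlg k) (ResTerm k n i) :=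
  (resChain k n hd).extendXIso ComplexShape.embeddingDownNat (i := i) rfl

theorem isZero_resCochain_X_of_pos {j : ℤ} (hj : 0 < j) : IsZero ((resCochain k n hd).X j) :=
  HomologicalComplex.isZero_extend_X _ _ _ fun i h => by
    rw [ComplexShape.embeddingDownNat_f] at h
    omega

theorem isZero_resCochain_X {j : ℤ} (hj : 0 < j ∨ j < -n) : IsZero ((resCochain k n hd).X j) := by
  rcases hj with hj | hj
  · exact isZero_resCochain_X_of_pos n hd hj
  · obtain ⟨i, rfl⟩ : ∃ i : ℕ, j = -i := ⟨j.natAbs, by omega⟩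
    have : IsEmpty (YIdx n i) := ⟨fun α => by have := α.2.1; omega⟩
    exact (ModuleCat.isZero_of_subsingleton _).of_iso (resCochainXIso n hd i)

theorem isPerf_resCochain : IsPerf (resCochain k n hd) where
  bounded := ⟨-n, 0, fun i hi => isZero_resCochain_X n hd hi.symm⟩
  fgProj j := by
    rcases lt_or_ge 0 j with hj | hj
    · exact isFGProj_of_isZero (isZero_resCochain_X_of_pos n hd hj)
    · obtain ⟨i, rfl⟩ : ∃ i : ℕ, j = -i := ⟨j.natAbs, by omega⟩
      exact (isFGProj_resTerm n i).of_iso (resCochainXIso n hd i).symm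

theorem resChain_d (i : ℕ) :
    (resChain k n hd).d (i + 1) i = ModuleCat.ofHom (resD k n i) :=
  ChainComplex.of_d (fun i => ModuleCat.of (UAlg k) (ResTerm k n i))
    (fun i => ModuleCat.ofHom (resD k n i)) i

theorem resChain_d_comp_resAug : (resChain k n hd).d 1 0 ≫ ModuleCat.ofHom (resAug k n) = 0 := by
  rw [resChain_d]
  exact congrArg ModuleCat.ofHom (resAug_comp_resD (k := k) (n := n))

/-- The augmentation as a map of complexes. -/
def resAugHom : resChain k n hd ⟶
    (ChainComplex.single₀ (ModuleCat.{u} (UAlg k))).obj (ModuleCat.of (UAlg k) (M k n)) :=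
  (ChainComplex.toSingle₀Equiv _ _).symm
    ⟨ModuleCat.ofHom (resAug k n), resChain_d_comp_resAug n hd⟩

theorem resAugHom_f_zero : (resAugHom n hd).f 0 = ModuleCat.ofHom (resAug k n) :=
  ChainComplex.toSingle₀Equiv_symm_apply_f_zero _ _

/-- The resolution of the standard module as a projective resolution in the sense of Mathlib. -/
def resolution : ProjectiveResolution (ModuleCat.of (UAlg k) (M k n)) where
  complex := resChain k n hd
  projective i := by
    have := (isFGProj_resTerm (k := k) n i).projective
    exact (IsProjective.iff_projective (R := UAlg k) (ResTerm k n i)).1 this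
  π := resAugHom n hd
  quasiIso := ⟨fun i => by
    rcases i with _ | i
    · rw [ChainComplex.quasiIsoAt₀_iff, ShortComplex.quasiIso_iff_of_zeros']
      · have : Epi (ModuleCat.ofHom (resAug k n)) :=
          (ModuleCat.epi_iff_surjective _).2 resAug_surjective
        refine (ShortComplex.exact_and_epi_g_iff_of_iso
          (S₂ := ShortComplex.mk (ModuleCat.ofHom (resD k n 0)) (ModuleCat.ofHom (resAug k n))
            (congrArg ModuleCat.ofHom (resAug_comp_resD (k := k) (n := n)))) ?_).2
          ⟨(ShortComplex.ShortExact.moduleCat_exact_iff_function_exact _).2 exact_resAug, this⟩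
        refine ShortComplex.isoMk (Iso.refl _) (Iso.refl _) (Iso.refl _) ?_ ?_
        · exact (Category.id_comp _).trans
            ((resChain_d n hd 0).symm.trans (Category.comp_id _).symm)
        · exact (Category.id_comp _).trans
            ((resAugHom_f_zero n hd).symm.trans (Category.comp_id _).symm)
      all_goals rfl
    · rw [quasiIsoAt_iff_exactAt']
      · rw [HomologicalComplex.exactAt_iff' _ (i + 1 + 1) (i + 1) i
          (by simp only [ChainComplex.prev]) (by simp)]
        refine (ShortComplex.ShortExact.moduleCat_exact_iff_function_exact _).2 ?_
        have h := exact_resD (k := k) (n := n) i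
        simp only [HomologicalComplex.shortComplexFunctor'_obj_f,
          HomologicalComplex.shortComplexFunctor'_obj_g]
        rw [resChain_d, resChain_d]
        exact h
      · apply ChainComplex.exactAt_succ_single_obj⟩

theorem exists_quasiIso_resCochain :
    ∃ f : resCochain k n hd ⟶ single (ModuleCat.of (UAlg k) (M k n)), QuasiIso f ∧
      ((resChain k n hd).extendXIso ComplexShape.embeddingDownNat (i := 0) (i' := 0) rfl).inv ≫
        f.f 0 ≫ (HomologicalComplex.singleObjXSelf (ComplexShape.up ℤ) 0
          (ModuleCat.of (UAlg k) (M k n))).hom = ModuleCat.ofHom (resAug k n) := by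
  refine ⟨(resolution n hd).π', inferInstanceAs (QuasiIso (resolution n hd).π'), ?_⟩
  have h1 := (resolution n hd).π'_f_zero
  have h2 : (resolution n hd).π.f 0 = ModuleCat.ofHom (resAug k n) := resAugHom_f_zero n hd
  rw [h2] at h1
  have h3 : ∀ {A B C D : ModuleCat.{u} (UAlg k)} (e : A ≅ B) (g : B ⟶ C) (e' : D ≅ C),
      e.inv ≫ (e.hom ≫ g ≫ e'.inv) ≫ e'.hom = g := fun e g e' => by simp
  exact (congrArg (fun t => ((resolution n hd).cochainComplexXIso 0 0).inv ≫ t ≫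
    (HomologicalComplex.singleObjXSelf (ComplexShape.up ℤ) 0
      (ModuleCat.of (UAlg k) (M k n))).hom) h1).trans (h3 ((resolution n hd).cochainComplexXIso 0 0)
    (ModuleCat.ofHom (resAug k n)) (HomologicalComplex.singleObjXSelf (ComplexShape.up ℤ) 0
      (ModuleCat.of (UAlg k) (M k n))))

/-! ### The class of the standard module -/

theorem mult_resCochain (m i : ℕ) : mult (k := k) m ((resCochain k n hd).X (-i)) =
    (n - i).choose i * if n - 2 * i = m then 1 else 0 := by
  have := (isFGProj_P (k := k) (n - 2 * i)).finite
  rw [mult_congr m (resCochainXIso n hd i).toLinearEquiv, ← card_YIdx, ← mult_P (k := k)]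
  exact mult_pi m (P k (n - 2 * i))

theorem eulerMult_resCochain (m : ℕ) : eulerMult m (resCochain k n hd) =
    ∑ i ∈ Finset.range (n / 2 + 1), ((-1 : ℤ) ^ i * ((n - i).choose i : ℤ)) *
      if n - 2 * i = m then 1 else 0 := by
  have hinj : Function.Injective fun i : ℕ => -(i : ℤ) := fun i j h => by
    simpa using h
  rw [eulerMult, finsum_eq_sum_of_support_subset
    (s := (Finset.range (n / 2 + 1)).map ⟨fun i : ℕ => -(i : ℤ), hinj⟩), Finset.sum_map]
  · refine Finset.sum_congr rfl fun i _ => ?_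
    rw [Function.Embedding.coeFn_mk, mult_resCochain, Int.negOnePow_neg, Int.coe_negOnePow_natCast]
    push_cast
    ring
  · intro j hj
    rw [Function.mem_support] at hj
    rcases lt_or_ge 0 j with hj' | hj'
    · exact absurd (by rw [mult_of_isZero m (isZero_resCochain_X_of_pos n hd hj')]; simp) hj
    · obtain ⟨i, rfl⟩ : ∃ i : ℕ, j = -i := ⟨j.natAbs, by omega⟩
      simp only [Finset.coe_map, Function.Embedding.coeFn_mk, Set.mem_image, Finset.mem_coe,
        Finset.mem_range]
      refine ⟨i, ?_, rfl⟩
      by_contra h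
      refine hj ?_
      rw [mult_resCochain, Nat.choose_eq_zero_of_lt (by omega)]
      simp

/-- Every resolution is homotopy equivalent to the explicit one, so that its class is determined by
the multiplicities of the modules `P_m` in the explicit one. -/
theorem equivHtpy_symm_mk_of_quasiIso (C : PerfCpx k)
    (f : C.1 ⟶ single (ModuleCat.of (UAlg k) (M k n))) (hf : QuasiIso f) :
    (K0.equivHtpy k).symm (K0Htpy.mk C) = ∑ i ∈ Finset.range (n / 2 + 1),
      ((-1 : ℤ) ^ i * ((n - i).choose i : ℤ)) • K0.mk (projP k (n - 2 * i)) := by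
  have hd := resD_comp_resD (k := k) (n := n)
  obtain ⟨g, hg, -⟩ := exists_quasiIso_resCochain n hd
  obtain ⟨e⟩ := nonempty_htpy_iso_of_quasiIso (C := C) (D := ⟨_, isPerf_resCochain n hd⟩) f g hf hg
  rw [← K0Htpy.mk_eq_of_iso e]
  refine K0.ext_multHom fun m => ?_
  rw [K0.multHom_equivHtpy_symm, map_sum]
  refine (eulerMult_resCochain n hd m).trans (Finset.sum_congr rfl fun i _ => ?_)
  rw [map_zsmul, K0.multHom_mk, smul_eq_mul]
  congr 1
  have := mult_P (k := k) m (n - 2 * i)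
  change _ = ((mult (k := k) m (P k (n - 2 * i)) : ℕ) : ℤ)
  rw [this]
  push_cast
  rfl

end Resolution

/-- The coefficients of the rescaled Chebyshev polynomials of the second kind. -/
theorem sum_choose_smul_X_pow (n : ℕ) : ∑ i ∈ Finset.range (n / 2 + 1),
    ((-1 : ℤ) ^ i * ((n - i).choose i : ℤ)) • (X : ℤ[X]) ^ (n - 2 * i) =
      Polynomial.Chebyshev.S ℤ n := by
  -- the number of summands may be enlarged, because the additional coefficients vanish
  have hN : ∀ n N : ℕ, n / 2 + 1 ≤ N → ∑ i ∈ Finset.range (n / 2 + 1),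
      ((-1 : ℤ) ^ i * ((n - i).choose i : ℤ)) • (X : ℤ[X]) ^ (n - 2 * i) =
      ∑ i ∈ Finset.range N, ((-1 : ℤ) ^ i * ((n - i).choose i : ℤ)) • (X : ℤ[X]) ^ (n - 2 * i) := by
    intro n N h
    refine Finset.sum_subset (Finset.range_subset_range.2 h) fun i _ hi => ?_
    rw [Finset.mem_range] at hi
    rw [Nat.choose_eq_zero_of_lt (by omega)]
    simp
  induction n using Nat.strong_induction_on with
  | _ n ih =>
  rcases n with _ | _ | n
  · simp
  · simp
  · rw [show ((n + 1 + 1 : ℕ) : ℤ) = (n : ℤ) + 2 by push_cast; ring, Polynomial.Chebyshev.S_add_two]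
    have h1 := ih (n + 1) (by omega)
    push_cast at h1
    rw [← h1, ← ih n (by omega), hN (n + 1 + 1) (n + 2) (by omega), hN (n + 1) (n + 2) (by omega),
      hN n (n + 1) (by omega), Finset.sum_range_succ', Finset.sum_range_succ' _ (n + 1), mul_add,
      add_sub_right_comm, Finset.mul_sum, ← Finset.sum_sub_distrib]
    congr 1
    · refine Finset.sum_congr rfl fun j hj => ?_
      rw [Finset.mem_range] at hj
      rw [show n + 1 + 1 - (j + 1) = (n - j) + 1 by omega, show n + 1 - (j + 1) = n - j by omega,
        show n + 1 + 1 - 2 * (j + 1) = n - 2 * j by omega, Nat.choose_succ_succ]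
      by_cases h : n - j < j + 1
      · rw [Nat.choose_eq_zero_of_lt h]
        simp [pow_succ]
      · rw [show n - 2 * j = n + 1 - 2 * (j + 1) + 1 by omega]
        simp only [zsmul_eq_mul]
        push_cast
        ring
    · simp [pow_succ]
      ring

end ChebyshevDiagrams

end

theorem mainTheorem1 (k : Type u) [Field k] :
    ∃ (φ : K0 k ≃+ ℤ[X]) (ι : K0 k ≃+ K0Htpy k),
      -- `φ : K_0(A^c) ≅ ℤ[x]` sends `[P_n]` to `x^n`
      (∀ n : ℕ, φ (K0.mk (projP k n)) = X ^ n) ∧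
      -- the tensor product of modules extends `P_a ⊗ P_b = P_{a+b}`
      (∀ a b : ℕ, ∃ e : tensor (projP k a).1 (projP k b).1 ≃ₗ[UAlg k] P k (a + b),
        e (tensorMk (V := (projP k a).1) (W := (projP k b).1) 1 (genP k a) (genP k b)) =
          genP k (a + b)) ∧
      -- `φ` takes the product induced by the tensor product of projectives to the product of `ℤ[x]`
      (∀ V W : FGProj k, ∃ h : IsFGProj (tensor V.1 W.1),
        φ (K0.mk ⟨tensor V.1 W.1, h⟩) = φ (K0.mk V) * φ (K0.mk W)) ∧
      -- `ι` is induced by the inclusion of projectives into bounded complexes of projectives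
      (∀ V : FGProj k, ∃ h : IsPerf (single V.1), ι (K0.mk V) = K0Htpy.mk ⟨single V.1, h⟩) ∧
      ∀ n : ℕ,
        -- the explicit finite projective resolution of `M_n`
        (∀ i : ℕ, Fintype.card (YIdx n i) = (n - i).choose i) ∧
        Function.Surjective (resAug k n) ∧
        Function.Exact (resD k n 0) (resAug k n) ∧
        (∀ i : ℕ, Function.Exact (resD k n (i + 1)) (resD k n i)) ∧
        -- which is an object of the homotopy category, quasi-isomorphic to `M_n`
        (∃ hd : ∀ i, resD k n i ∘ₗ resD k n (i + 1) = 0, IsPerf (resCochain k n hd) ∧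
          ∃ f : resCochain k n hd ⟶ single (ModuleCat.of (UAlg k) (M k n)), QuasiIso f ∧
            ((resChain k n hd).extendXIso ComplexShape.embeddingDownNat (i := 0) (i' := 0) rfl).inv ≫
              f.f 0 ≫ (HomologicalComplex.singleObjXSelf (ComplexShape.up ℤ) 0
                (ModuleCat.of (UAlg k) (M k n))).hom = ModuleCat.ofHom (resAug k n)) ∧
        -- the symbol of `M_n`, computed from any finite resolution by projectives
        ∀ (C : PerfCpx k) (f : C.1 ⟶ single (ModuleCat.of (UAlg k) (M k n))), QuasiIso f →
          ι.symm (K0Htpy.mk C) = ∑ i ∈ Finset.range (n / 2 + 1),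
            ((-1 : ℤ) ^ i * ((n - i).choose i : ℤ)) • K0.mk (projP k (n - 2 * i)) ∧
          φ (ι.symm (K0Htpy.mk C)) = ∑ i ∈ Finset.range (n / 2 + 1),
            ((-1 : ℤ) ^ i * ((n - i).choose i : ℤ)) • (X : ℤ[X]) ^ (n - 2 * i) ∧
          φ (ι.symm (K0Htpy.mk C)) = Polynomial.Chebyshev.S ℤ n := by
  refine ⟨K0.equivPolynomial k, K0.equivHtpy k, K0.equivPolynomial_mk_projP k,
    fun a b => ⟨tensorPEquiv k a b, tensorPEquiv_mk k a b⟩, equivPolynomial_mk_tensor,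
    fun V => ⟨isPerf_single V.2 0, K0.toHtpy_mk V⟩, fun n => ⟨card_YIdx n, resAug_surjective,
      exact_resAug, exact_resD, ⟨resD_comp_resD, isPerf_resCochain n _,
      exists_quasiIso_resCochain n _⟩, fun C f hf => ?_⟩⟩
  have h1 := equivHtpy_symm_mk_of_quasiIso n C f hf
  have h2 : K0.equivPolynomial k ((K0.equivHtpy k).symm (K0Htpy.mk C)) =
      ∑ i ∈ Finset.range (n / 2 + 1),
        ((-1 : ℤ) ^ i * ((n - i).choose i : ℤ)) • (X : ℤ[X]) ^ (n - 2 * i) := by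
    rw [h1, map_sum]
    exact Finset.sum_congr rfl fun i _ => by rw [map_zsmul, K0.equivPolynomial_mk_projP]
  exact ⟨h1, h2, h2.trans (sum_choose_smul_X_pow n)⟩
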